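/- Let $1<p<\infty$ and $0<\alpha<\infty$. For $\mu>0$ let $A^p_\mu$ be the weighted Bergman space of all analytic functions $f$ on the unit disc $\mathbb D\subset\mathbb C$ with $\|f\|_{p,\mu}=\big(\int_{\mathbb D}|f(z)|^p(1-|z|)^\mu\,dA(z)\big)^{1/p}<\infty$, where $dA=\frac1\pi\,dx\,dy$. Let $A^p_{\alpha-}=\bigcup_{0<\mu<\alpha}A^p_\mu$, endowed with the finest locally convex topology for which all the inclusions $A^p_\mu\hookrightarrow A^p_{\alpha-}$, $0<\mu<\alpha$, are continuous. Let $\mathsf C$ be the Cesàro operator, $\mathsf Cf(z)=\frac1z\int_0^z\frac{f(\zeta)}{1-\zeta}\,d\zeta$ for $0<|z|<1$ and $\mathsf Cf(0)=f(0)$. For a continuous linear operator $T$ on a locally convex space $X$, let $\sigma_{pt}(T)$ be the set of $\lambda\in\mathbb C$ for which $\lambda I-T$ is not injective; let $\rho(T)$ be the set of $\lambda\in\mathbb C$ for which $\lambda I-T$ has an inverse in the space $\mathcal L(X)$ of continuous linear operators on $X$, and $\sigma(T)=\mathbb C\setminus\rho(T)$; let $\rho^*(T)$ be the set of $\lambda\in\mathbb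 C$ for which there is $\delta>0$ such that $B(\lambda,\delta)=\{\nu\in\mathbb C:|\nu-\lambda|<\delta\}\subseteq\rho(T)$ and $\{(\nu I-T)^{-1}:\nu\in B(\lambda,\delta)\}$ is equicontinuous, and let $\sigma^*(T)=\mathbb C\setminus\rho^*(T)$ (the Waelbroeck spectrum). For $r>0$ let $\overline D_r=\{\lambda\in\mathbb C:|\lambda-\frac1{2r}|\le\frac1{2r}\}$. **Theorem.** $\mathsf C$ is a continuous linear operator from $A^p_{\alpha-}$ into itself, and 1. $\sigma_{pt}(\mathsf C)=\{\frac1m:\ m\in\mathbb N,\ m\ge 1,\ m<\frac{2+\alpha}p\}$; 2. $\sigma(\mathsf C)=\sigma_{pt}(\mathsf C)\cup\overline D_{(2+\alpha)/p}$; 3. $\sigma^*(\mathsf C)=\sigma(\mathsf C)$. -/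

import Mathlib

open MeasureTheory

noncomputable section

/-! ### Weighted Bergman spaces on the unit disc -/

/-- The space `H(𝔻)` of analytic functions on the open unit disc `𝔻 ⊂ ℂ`. A function on `𝔻` is
represented by its extension by zero to `ℂ`, so that two elements are equal exactly when they
agree on `𝔻`. -/
def holoDisc : Submodule ℂ (ℂ → ℂ) where
  carrier := {f | DifferentiableOn ℂ f (Metric.ball 0 1) ∧ ∀ z ∉ Metric.ball (0 : ℂ) 1, f z = 0}
  zero_mem' := ⟨differentiableOn_const 0, fun _ _ => rfl⟩
  add_mem' := fun hf hg =>
    ⟨hf.1.add hg.1, fun z hz => by simp [hf.2 z hz, hg.2 z hz]⟩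
  smul_mem' := fun c _ hf =>
    ⟨hf.1.const_smul c, fun z hz => by simp [hf.2 z hz]⟩

/-- The measure `dA_μ = (1 - |z|)^μ dA` on the unit disc, with `dA = π⁻¹ dx dy`. -/
def bergmanMeasure (μ : ℝ) : Measure ℂ :=
  (volume.restrict (Metric.ball (0 : ℂ) 1)).withDensity
    fun z => ENNReal.ofReal ((1 - ‖z‖) ^ μ / Real.pi)

theorem bergmanMeasure_mono {μ γ : ℝ} (h : μ ≤ γ) : bergmanMeasure γ ≤ bergmanMeasure μ := by
  refine withDensity_mono ?_
  filter_upwards [ae_restrict_mem Metric.isOpen_ball.measurableSet] with z hz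
  have hz' : ‖z‖ < 1 := by simpa using hz
  refine ENNReal.ofReal_le_ofReal (div_le_div_of_nonneg_right ?_ Real.pi_pos.le)
  exact Real.rpow_le_rpow_of_exponent_ge (by linarith) (by linarith [norm_nonneg z]) h

/-- The weighted Bergman space `A^p_μ` as a set of functions: the analytic functions on `𝔻` in
`L^p(𝔻, dA_μ)`. -/
def bergmanSubmodule (p μ : ℝ) : Submodule ℂ (ℂ → ℂ) where
  carrier := {f | f ∈ holoDisc ∧ MemLp f (ENNReal.ofReal p) (bergmanMeasure μ)}
  zero_mem' := ⟨holoDisc.zero_mem, MemLp.zero⟩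
  add_mem' := fun hf hg => ⟨holoDisc.add_mem hf.1 hg.1, hf.2.add hg.2⟩
  smul_mem' := fun c _ hf => ⟨holoDisc.smul_mem c hf.1, hf.2.const_smul c⟩

theorem bergmanSubmodule_mono (p : ℝ) {μ γ : ℝ} (h : μ ≤ γ) :
    bergmanSubmodule p μ ≤ bergmanSubmodule p γ :=
  fun _ hf => ⟨hf.1, hf.2.mono_measure (bergmanMeasure_mono h)⟩

/-- The weighted Bergman space `A^p_μ`. It is a separate type, so that the only topology on it is
the one of its norm. -/
def Bergman (p μ : ℝ) : Type := ↥(bergmanSubmodule p μ)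

instance (p μ : ℝ) : AddCommGroup (Bergman p μ) :=
  inferInstanceAs (AddCommGroup ↥(bergmanSubmodule p μ))

instance (p μ : ℝ) : Module ℂ (Bergman p μ) :=
  inferInstanceAs (Module ℂ ↥(bergmanSubmodule p μ))

instance (p μ : ℝ) : CoeFun (Bergman p μ) fun _ => ℂ → ℂ := ⟨fun f => f.1⟩

instance (p : ℝ) [hp : Fact (1 < p)] : Fact (1 ≤ ENNReal.ofReal p) :=
  ⟨ENNReal.one_le_ofReal.2 hp.out.le⟩

/-- The embedding of `A^p_μ` into `L^p(𝔻, dA_μ)`. -/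
def bergmanToLp (p μ : ℝ) :
    Bergman p μ →ₗ[ℂ] Lp ℂ (ENNReal.ofReal p) (bergmanMeasure μ) where
  toFun f := f.2.2.toLp f.1
  map_add' f g := MemLp.toLp_add f.2.2 g.2.2
  map_smul' c f := MemLp.toLp_const_smul c f.2.2

/-- `A^p_μ` carries the norm of `L^p(𝔻, dA_μ)`. -/
instance (p μ : ℝ) [Fact (1 < p)] : SeminormedAddCommGroup (Bergman p μ) :=
  SeminormedAddCommGroup.induced (Bergman p μ) (Lp ℂ (ENNReal.ofReal p) (bergmanMeasure μ))
    (bergmanToLp p μ)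

/-- The norm of `A^p_μ` is `‖f‖ = (∫ |f(z)|^p dA_μ(z))^{1/p}`. -/
theorem Bergman.norm_eq (p μ : ℝ) [hp : Fact (1 < p)] (f : Bergman p μ) :
    ‖f‖ = (∫ z, ‖f z‖ ^ p ∂(bergmanMeasure μ)) ^ (1 / p) := by
  have hp0 : 0 < p := one_pos.trans hp.out
  have h1 : ‖f‖ = ‖f.2.2.toLp f.1‖ := rfl
  rw [h1, Lp.norm_toLp, MemLp.eLpNorm_eq_integral_rpow_norm (by simpa using hp0) (by simp) f.2.2,
    ENNReal.toReal_ofReal hp0.le, ENNReal.toReal_ofReal (by positivity), one_div]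

/-! ### The (LB)-space `A^p_{α-}` -/

/-- The union of the spaces `A^p_μ` over `0 < μ < α`, as a space of functions. -/
def bergmanMinusSubmodule (p α : ℝ) [hα : Fact (0 < α)] : Submodule ℂ (ℂ → ℂ) where
  carrier := {f | ∃ μ, 0 < μ ∧ μ < α ∧ f ∈ bergmanSubmodule p μ}
  zero_mem' := ⟨α / 2, half_pos hα.out, half_lt_self hα.out, Submodule.zero_mem _⟩
  add_mem' := by
    rintro f g ⟨μ, hμ, hμα, hf⟩ ⟨γ, hγ, hγα, hg⟩
    exact ⟨max μ γ, lt_max_of_lt_left hμ, max_lt hμα hγα,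
      Submodule.add_mem _ (bergmanSubmodule_mono p (le_max_left _ _) hf)
        (bergmanSubmodule_mono p (le_max_right _ _) hg)⟩
  smul_mem' := by
    rintro c f ⟨μ, hμ, hμα, hf⟩
    exact ⟨μ, hμ, hμα, Submodule.smul_mem _ c hf⟩

/-- The space `A^p_{α-} = ⋃_{0 < μ < α} A^p_μ`. It is a separate type, so that the only topology on
it is the inductive limit topology below. -/
def BergmanMinus (p α : ℝ) [Fact (0 < α)] : Type := ↥(bergmanMinusSubmodule p α)

instance (p α : ℝ) [Fact (0 < α)] : AddCommGroup (BergmanMinus p α) :=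
  inferInstanceAs (AddCommGroup ↥(bergmanMinusSubmodule p α))

instance (p α : ℝ) [Fact (0 < α)] : Module ℂ (BergmanMinus p α) :=
  inferInstanceAs (Module ℂ ↥(bergmanMinusSubmodule p α))

instance (p α : ℝ) [Fact (0 < α)] : CoeFun (BergmanMinus p α) fun _ => ℂ → ℂ := ⟨fun f => f.1⟩

/-- The natural inclusion of the step `A^p_μ`, `0 < μ < α`, into `A^p_{α-}`. -/
def stepInclusion (p α : ℝ) [Fact (0 < α)] (μ : ℝ) (h0 : 0 < μ) (h1 : μ < α) :
    Bergman p μ →ₗ[ℂ] BergmanMinus p α :=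
  Submodule.inclusion (show bergmanSubmodule p μ ≤ bergmanMinusSubmodule p α from
    fun _ hf => ⟨μ, h0, h1, hf⟩)

/-- `t` is a locally convex vector space topology on `A^p_{α-}` for which all the natural
inclusions `A^p_μ → A^p_{α-}`, `0 < μ < α`, are continuous. -/
structure IsStepTopology (p α : ℝ) [Fact (1 < p)] [Fact (0 < α)]
    (t : TopologicalSpace (BergmanMinus p α)) : Prop where
  isTopologicalAddGroup : IsTopologicalAddGroup (BergmanMinus p α)
  continuousSMul : ContinuousSMul ℂ (BergmanMinus p α)
  locallyConvexSpace : LocallyConvexSpace ℝ (BergmanMinus p α)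
  continuous_inclusion : ∀ (μ : ℝ) (h0 : 0 < μ) (h1 : μ < α),
    Continuous (stepInclusion p α μ h0 h1)

/-- The topology of the (LB)-space `A^p_{α-}`: the finest locally convex topology for which all the
natural inclusions `A^p_μ → A^p_{α-}` are continuous. (In Mathlib's order on topologies the finer
one is the smaller one; the infimum is attained, see `isStepTopology`.) -/
instance (p α : ℝ) [Fact (1 < p)] [Fact (0 < α)] : TopologicalSpace (BergmanMinus p α) :=
  sInf {t | IsStepTopology p α t}

theorem isStepTopology (p α : ℝ) [Fact (1 < p)] [Fact (0 < α)] :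
    IsStepTopology p α inferInstance where
  isTopologicalAddGroup := topologicalAddGroup_sInf fun _ ht => ht.isTopologicalAddGroup
  continuousSMul := continuousSMul_sInf fun _ ht => ht.continuousSMul
  locallyConvexSpace := LocallyConvexSpace.sInf fun _ ht => ht.locallyConvexSpace
  continuous_inclusion μ h0 h1 :=
    continuous_sInf_rng.2 fun _ ht => ht.continuous_inclusion μ h0 h1

instance (p α : ℝ) [Fact (1 < p)] [Fact (0 < α)] : IsTopologicalAddGroup (BergmanMinus p α) :=
  (isStepTopology p α).isTopologicalAddGroup

instance (p α : ℝ) [Fact (1 < p)] [Fact (0 < α)] : ContinuousSMul ℂ (BergmanMinus p α) :=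
  (isStepTopology p α).continuousSMul

/-! ### The Cesàro operator -/

/-- The Cesàro operator on functions on `𝔻` (extended by zero to `ℂ`): `C f (0) = f 0` and
`C f (z) = z⁻¹ ∫_0^z f(ζ) / (1 - ζ) dζ` for `0 < |z| < 1`, the integral being taken along the
segment `ζ = t z`, `0 ≤ t ≤ 1`. -/
def cesaro (f : ℂ → ℂ) (z : ℂ) : ℂ :=
  if z = 0 then f 0
  else if ‖z‖ < 1 then z⁻¹ * ∫ t in (0 : ℝ)..1, f (t * z) / (1 - t * z) * z
  else 0

/-! ### Spectra of continuous linear operators -/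

section Spectra

variable {X : Type*} [AddCommGroup X] [Module ℂ X] [TopologicalSpace X] [IsTopologicalAddGroup X]
  [ContinuousSMul ℂ X]

/-- The point spectrum: all `l` such that `l I - T` is not injective. -/
def pointSpectrum (T : X →L[ℂ] X) : Set ℂ :=
  {l | ¬ Function.Injective (algebraMap ℂ (X →L[ℂ] X) l - T)}

/-- The set `ρ*(T)` of all `l` for which there is `δ > 0` such that the open disc `B(l, δ)` is
contained in the resolvent set `ρ(T)` and the resolvents `(ν I - T)⁻¹`, `ν ∈ B(l, δ)`, are
equicontinuous. -/
def waelbroeckResolventSet (T : X →L[ℂ] X) : Set ℂ :=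
  letI : UniformSpace X := IsTopologicalAddGroup.rightUniformSpace X
  {l | ∃ δ > 0, Metric.ball l δ ⊆ resolventSet ℂ T ∧
    Equicontinuous fun (ν : Metric.ball l δ) (x : X) => resolvent T (ν : ℂ) x}

/-- The Waelbroeck spectrum `σ*(T) = ℂ \ ρ*(T)`. -/
def waelbroeckSpectrum (T : X →L[ℂ] X) : Set ℂ := (waelbroeckResolventSet T)ᶜ

end Spectra

/-- The closed disc `|l - 1/(2r)| ≤ 1/(2r)`. -/
def closedDisc (r : ℝ) : Set ℂ := {l | ‖l - 1 / (2 * r)‖ ≤ 1 / (2 * r)}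

end

/-!
For `l ≠ 0` put `w = l⁻¹`. Since `z · C f(z)` is a primitive of `f / (1 - z)`, the resolvent
equation `l f - C f = h` is the differential equation `(z (f - w h))' = w f / (1 - z)` on the disc
(`SolvesOn`, `solvesOn_iff`). Write `r = (2 + α) / p`. Elements of `A^p_{α-}` are
`o((1 - |z|) ^ (-r))` (`tendsto_rpow_mul_norm_bergmanMinus`), while analytic functions bounded by
`C |1 - z| ^ (-A)` with `A < r` belong to the space (`exists_bergmanMinus_of_norm_le`).

*Point spectrum.* Comparing leading coefficients at `0`, the homogeneous equation has a nonzero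
solution only if `w = j + 1` is a positive integer, and this solution is a multiple of
`z ^ j / (1 - z) ^ (j + 1)`, which lies in the space exactly when `j + 1 < r`.

*Resolvent set.* Let `Re w < r` and let `w` be no positive integer. On functions `h = z ^ N k` with
`N + 1 > Re w` the equation is solved by an integral operator (`resolventKernel`) with kernel
`(1 - z) ^ (-w) z ^ N t ^ (N - w) (1 - t z) ^ (w - 1)`. Splitting the kernel with
`|1 - t z| ≥ max (1 - t) (1 - |z|)` and using the dilation estimate `lintegral_dilation_le` and the
pointwise growth of elements of `A^p_μ`, it maps `A^p_μ` boundedly into `A^p_γ` for a slightly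
larger `γ < α`, uniformly for `w` in a small disc (`exists_eLpNorm_resolventKernel_le`). Choosing
`N` with `Re w - 1 < N < r`, a general `h` is reduced to this case by subtracting eigenfunctions of
`C` with eigenvalues `1 / (j + 1)`, `j < N`, which belong to the space and on which the resolvent
acts as a scalar (`exists_eigenfun_decomposition`, `exists_uniform_solution`). The maps
`(ν - C)⁻¹`, `ν` near `l`, are therefore bounded from step to step with common bounds. As seminorms
on `A^p_{α-}` that are bounded on every step are continuous
(`continuous_seminorm_of_bounded_on_steps`), such a family is equicontinuous
(`UniformlyStepBounded.equicontinuous`), and `l` belongs to `ρ*(C)`. The case `w = 0`, `N = 0` of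
the same estimate gives the continuity of `C`.

*The closed disc lies in the spectrum.* A point `l ≠ 0` lies in the disc iff `Re w ≥ r`. If `w` is
a positive integer, `z ^ (w - 1)` is not in the range (`not_solvesOn_pow`). Otherwise there is, for
every `n ≥ 1`, a solution with right-hand side a multiple of `(1 - z) ^ (n - w)` which behaves like
`(1 - z) ^ (-w)` at `1`; for large `n` the right-hand side is in the space and the solution, which
is unique, is not (`not_surjective_of_ne_natCast`). Finally `C f = h` forces `f = (1 - z) (z h)'`,
which for `h = (1 + z) ^ (-b)` with `b < r ≤ b + 1` grows too fast at `-1`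
(`not_surjective_cesaroCLM`).

Since `ρ*(C) ⊆ ρ(C)` always, this determines the three spectra.
-/

noncomputable section

open Metric Set Filter Topology
open scoped ENNReal

/-! ### Continuity and equicontinuity on the inductive limit -/

section LimitTopology

variable {p α : ℝ} [Fact (1 < p)] [Fact (0 < α)]

instance (p μ : ℝ) [Fact (1 < p)] : NormedSpace ℂ (Bergman p μ) :=
  NormedSpace.induced ℂ (Bergman p μ) (Lp ℂ (ENNReal.ofReal p) (bergmanMeasure μ))
    (bergmanToLp p μ)

/-- A seminorm on `A^p_{α-}` that is bounded on each step is continuous: the topology it generates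
is one of those whose supremum is the inductive limit topology. -/
theorem continuous_seminorm_of_bounded_on_steps (q : Seminorm ℂ (BergmanMinus p α))
    (hq : ∀ (μ : ℝ) (h0 : 0 < μ) (h1 : μ < α), ∃ K : ℝ, ∀ f : Bergman p μ,
      q (stepInclusion p α μ h0 h1 f) ≤ K * ‖f‖) : Continuous q := by
  let Q : SeminormFamily ℂ (BergmanMinus p α) Unit := fun _ => q
  let t : TopologicalSpace (BergmanMinus p α) := Q.moduleFilterBasis.topology
  have hQ : @WithSeminorms ℂ _ _ _ _ _ Q t := @WithSeminorms.mk _ _ _ _ _ _ _ t rfl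
  have hst : IsStepTopology p α t :=
    { isTopologicalAddGroup := hQ.topologicalAddGroup
      continuousSMul := hQ.continuousSMul
      locallyConvexSpace := hQ.toLocallyConvexSpace
      continuous_inclusion := fun μ h0 h1 => by
        let := t
        obtain ⟨K, hK⟩ := hq μ h0 h1
        have := hQ.topologicalAddGroup
        refine hQ.continuous_normedSpace_dom (Bergman p μ) (stepInclusion p α μ h0 h1) ?_
        intro _
        refine ⟨K.toNNReal, fun f => (hK f).trans ?_⟩
        exact mul_le_mul_of_nonneg_right (Real.le_coe_toNNReal K) (norm_nonneg f) }
  have hle : sInf {t | IsStepTopology p α t} ≤ t :=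
    sInf_le (show t ∈ {t | IsStepTopology p α t} from hst)
  have : @Continuous _ _ t _ q := by
    let := t
    have := hQ.topologicalAddGroup
    exact hQ.continuous_seminorm ()
  exact continuous_le_dom hle this

instance : LocallyConvexSpace ℝ (BergmanMinus p α) := (isStepTopology p α).locallyConvexSpace

open scoped ComplexOrder in
theorem exists_withSeminorms :
    ∃ (ι : Type) (Q : SeminormFamily ℂ (BergmanMinus p α) ι), WithSeminorms Q := by
  have : ContinuousSMul ℝ (BergmanMinus p α) := IsScalarTower.continuousSMul ℂ
  have : LocallyConvexSpace ℂ (BergmanMinus p α) := by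
    refine ⟨fun x => ?_⟩
    have := LocallyConvexSpace.convex_basis (𝕜 := ℝ) x
    simpa only [convex_RCLike_iff_convex_real] using this
  exact ⟨_, _, with_gaugeSeminormFamily (𝕜 := ℂ) (E := BergmanMinus p α)⟩

/-- Each linear map of the family maps `A^p_μ` into some `A^p_γ`, with a bound that is the same
for all of them. -/
def UniformlyStepBounded {ι : Type*} (T : ι → BergmanMinus p α →ₗ[ℂ] BergmanMinus p α) : Prop :=
  ∀ (μ : ℝ) (h0 : 0 < μ) (h1 : μ < α), ∃ (γ : ℝ) (h2 : 0 < γ) (h3 : γ < α) (K : ℝ),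
    ∀ (i : ι) (f : Bergman p μ), ∃ g : Bergman p γ,
      T i (stepInclusion p α μ h0 h1 f) = stepInclusion p α γ h2 h3 g ∧ ‖g‖ ≤ K * ‖f‖

theorem UniformlyStepBounded.exists_continuous_seminorm {ι : Type*}
    {T : ι → BergmanMinus p α →ₗ[ℂ] BergmanMinus p α} (hT : UniformlyStepBounded T)
    (q : Seminorm ℂ (BergmanMinus p α)) (hq : Continuous q) :
    ∃ s : Seminorm ℂ (BergmanMinus p α), Continuous s ∧ ∀ i, q.comp (T i) ≤ s := by
  have key : ∀ (μ : ℝ) (h0 : 0 < μ) (h1 : μ < α), ∃ K : ℝ, 0 ≤ K ∧ ∀ (i : ι) (f : Bergman p μ),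
      q (T i (stepInclusion p α μ h0 h1 f)) ≤ K * ‖f‖ := by
    intro μ h0 h1
    obtain ⟨γ, h2, h3, K, hK⟩ := hT μ h0 h1
    obtain ⟨c, hc, hcq⟩ := Seminorm.bound_of_continuous_normedSpace
      (q.comp (stepInclusion p α γ h2 h3))
      (hq.comp ((isStepTopology p α).continuous_inclusion γ h2 h3))
    refine ⟨c * max K 0, by positivity, fun i f => ?_⟩
    obtain ⟨g, hg, hgK⟩ := hK i f
    rw [hg, mul_assoc]
    refine (hcq g).trans (mul_le_mul_of_nonneg_left (hgK.trans ?_) hc.le)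
    exact mul_le_mul_of_nonneg_right (le_max_left _ _) (norm_nonneg f)
  have hbdd : BddAbove (Set.range fun i => q.comp (T i)) := by
    rw [Seminorm.bddAbove_range_iff]
    rintro ⟨x, μ, h0, h1, hx⟩
    obtain ⟨K, -, hK⟩ := key μ h0 h1
    let f : Bergman p μ := ⟨x, hx⟩
    refine ⟨K * ‖f‖, ?_⟩
    rintro _ ⟨i, rfl⟩
    exact hK i f
  refine ⟨⨆ i, q.comp (T i), continuous_seminorm_of_bounded_on_steps _ fun μ h0 h1 => ?_,
    le_ciSup hbdd⟩
  obtain ⟨K, hK0, hK⟩ := key μ h0 h1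
  refine ⟨K, fun f => ?_⟩
  rw [Seminorm.iSup_apply hbdd]
  exact Real.iSup_le (fun i => hK i f) (by positivity)

theorem UniformlyStepBounded.equicontinuous {ι : Type*}
    {T : ι → BergmanMinus p α →ₗ[ℂ] BergmanMinus p α} (hT : UniformlyStepBounded T) :
    let : UniformSpace (BergmanMinus p α) :=
      IsTopologicalAddGroup.rightUniformSpace (BergmanMinus p α)
    Equicontinuous fun (i : ι) (x : BergmanMinus p α) => T i x := by
  let : UniformSpace (BergmanMinus p α) :=
    IsTopologicalAddGroup.rightUniformSpace (BergmanMinus p α)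
  have : IsUniformAddGroup (BergmanMinus p α) := isUniformAddGroup_of_addCommGroup
  obtain ⟨κ, Q, hQ⟩ := exists_withSeminorms (p := p) (α := α)
  exact ((hQ.equicontinuous_TFAE T).out 1 3).2 fun k =>
    hT.exists_continuous_seminorm (Q k) (hQ.continuous_seminorm k)

theorem UniformlyStepBounded.continuous {ι : Type*}
    {T : ι → BergmanMinus p α →ₗ[ℂ] BergmanMinus p α} (hT : UniformlyStepBounded T) (i : ι) :
    Continuous (T i) :=
  let : UniformSpace (BergmanMinus p α) :=
    IsTopologicalAddGroup.rightUniformSpace (BergmanMinus p α)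
  hT.equicontinuous.continuous i

end LimitTopology

/-! ### The Cesàro operator on analytic functions -/

open Metric Set Filter Topology

theorem one_sub_mem_slitPlane {z : ℂ} (hz : ‖z‖ < 1) : 1 - z ∈ Complex.slitPlane :=
  Or.inl (by simpa using lt_of_le_of_lt (Complex.re_le_norm z) hz)

theorem one_sub_ne_zero_of_norm_lt {z : ℂ} (hz : ‖z‖ < 1) : 1 - z ≠ 0 :=
  Complex.slitPlane_ne_zero (one_sub_mem_slitPlane hz)

theorem holoDisc.differentiableAt {f : ℂ → ℂ} (hf : f ∈ holoDisc) {z : ℂ} (hz : ‖z‖ < 1) :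
    DifferentiableAt ℂ f z :=
  hf.1.differentiableAt (isOpen_ball.mem_nhds (by simpa using hz))

theorem indicator_mem_holoDisc {f : ℂ → ℂ} (hf : DifferentiableOn ℂ f (ball 0 1)) :
    (ball (0 : ℂ) 1).indicator f ∈ holoDisc :=
  ⟨hf.congr fun _ hz => indicator_of_mem hz f, fun _ hz => indicator_of_notMem hz f⟩

theorem indicator_disc_eventuallyEq (f : ℂ → ℂ) {z : ℂ} (hz : ‖z‖ < 1) :
    (ball (0 : ℂ) 1).indicator f =ᶠ[𝓝 z] f := by
  filter_upwards [isOpen_ball.mem_nhds (show z ∈ ball (0 : ℂ) 1 by simpa using hz)] with x hx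
  exact indicator_of_mem hx f

/-- The function `z ↦ ∫_0^z g` is a primitive of `g`. -/
theorem hasDerivAt_segment_integral {g : ℂ → ℂ} (hg : DifferentiableOn ℂ g (ball 0 1)) {z : ℂ}
    (hz : ‖z‖ < 1) :
    HasDerivAt (fun ζ : ℂ => ∫ t in (0 : ℝ)..1, g (t * ζ) * ζ) (g z) z := by
  obtain ⟨G, hG⟩ := hg.isExactOn_ball
  have hseg : ∀ ζ : ℂ, ‖ζ‖ < 1 → ∫ t in (0 : ℝ)..1, g (t * ζ) * ζ = G ζ - G 0 := by
    intro ζ hζ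
    have hmem : ∀ t ∈ uIcc (0 : ℝ) 1, (t : ℂ) * ζ ∈ ball (0 : ℂ) 1 := by
      intro t ht
      rw [uIcc_of_le zero_le_one] at ht
      simp only [mem_ball_zero_iff, norm_mul, Complex.norm_real, Real.norm_of_nonneg ht.1]
      nlinarith [norm_nonneg ζ, ht.2]
    have hlin : ∀ t : ℝ, HasDerivAt (fun t : ℝ => (t : ℂ) * ζ) ζ t := fun t => by
      simpa using (Complex.ofRealCLM.hasDerivAt (x := t)).mul_const ζ
    have := intervalIntegral.integral_eq_sub_of_hasDerivAt (a := 0) (b := 1)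
      (f := fun t : ℝ => G (t * ζ)) (f' := fun t : ℝ => g (t * ζ) * ζ)
      (fun t ht => (hG _ (hmem t ht)).comp t (hlin t)) (by
        refine ContinuousOn.intervalIntegrable ?_
        refine ContinuousOn.mul ?_ continuousOn_const
        exact hg.continuousOn.comp (by fun_prop) hmem)
    simpa using this
  refine ((hG z (by simpa using hz)).sub_const (G 0)).congr_of_eventuallyEq ?_
  filter_upwards [isOpen_ball.mem_nhds (show z ∈ ball (0 : ℂ) 1 by simpa using hz)] with ζ hζ
  exact hseg ζ (by simpa using hζ)

/-- `z ↦ z C f (z)` is the primitive of `f(z) / (1 - z)` that vanishes at `0`. -/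
theorem hasDerivAt_mul_cesaro {f : ℂ → ℂ} (hf : f ∈ holoDisc) {z : ℂ} (hz : ‖z‖ < 1) :
    HasDerivAt (fun ζ => ζ * cesaro f ζ) (f z / (1 - z)) z := by
  have hg : DifferentiableOn ℂ (fun ζ => f ζ / (1 - ζ)) (ball 0 1) :=
    hf.1.div (by fun_prop) fun ζ hζ => one_sub_ne_zero_of_norm_lt (by simpa using hζ)
  refine (hasDerivAt_segment_integral hg hz).congr_of_eventuallyEq ?_
  filter_upwards [isOpen_ball.mem_nhds (show z ∈ ball (0 : ℂ) 1 by simpa using hz)] with ζ hζ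
  have hζ' : ‖ζ‖ < 1 := by simpa using hζ
  by_cases h0 : ζ = 0
  · simp [h0]
  · simp only [cesaro, h0, hζ', if_true, if_false]
    rw [mul_inv_cancel_left₀ h0]

/-- `C f = G` as soon as `(z G)' = f / (1 - z)` on the disc. -/
theorem cesaro_eq_of_hasDerivAt {f G : ℂ → ℂ} (hf : f ∈ holoDisc) (hG : G ∈ holoDisc)
    (h : ∀ z : ℂ, ‖z‖ < 1 → HasDerivAt (fun ζ => ζ * G ζ) (f z / (1 - z)) z) :
    cesaro f = G := by
  have hd : ∀ z ∈ ball (0 : ℂ) 1,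
      HasDerivAt (fun ζ => ζ * cesaro f ζ - ζ * G ζ) 0 z := fun z hz => by
    have hz' : ‖z‖ < 1 := by simpa using hz
    simpa using (hasDerivAt_mul_cesaro hf hz').fun_sub (h z hz')
  have hconst : ∀ z ∈ ball (0 : ℂ) 1, z * cesaro f z - z * G z = 0 := fun z hz => by
    have := (convex_ball (0 : ℂ) 1).is_const_of_fderivWithin_eq_zero (𝕜 := ℂ)
      (f := fun ζ => ζ * cesaro f ζ - ζ * G ζ)
      (fun ζ hζ => (hd ζ hζ).differentiableAt.differentiableWithinAt)
      (fun ζ hζ => by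
        rw [fderivWithin_of_isOpen isOpen_ball hζ]
        ext
        simpa using (hd ζ hζ).deriv) hz (mem_ball_self one_pos)
    simpa using this
  funext z
  by_cases hz : ‖z‖ < 1
  · by_cases h0 : z = 0
    · subst h0
      have h1 : HasDerivAt (fun ζ => ζ * G ζ) (G 0) 0 := by
        simpa using (hasDerivAt_id' (0 : ℂ)).fun_mul (holoDisc.differentiableAt hG hz).hasDerivAt
      have h2 := (h 0 hz).unique h1
      simpa [cesaro] using h2
    · exact mul_left_cancel₀ h0 (sub_eq_zero.1 (hconst z (by simpa using hz)))
  · have h0 : z ≠ 0 := by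
      rintro rfl
      simp at hz
    rw [hG.2 z (by simpa using hz)]
    simp [cesaro, h0, hz]

/-- `SolvesOn w h f`: the function `f` solves `f - w C f = w h` on the disc, written as the
differential equation `(z (f - w h))' = w f / (1 - z)`. -/
def SolvesOn (w : ℂ) (h f : ℂ → ℂ) : Prop :=
  ∀ z : ℂ, ‖z‖ < 1 → HasDerivAt (fun ζ => ζ * (f ζ - w * h ζ)) (w * f z / (1 - z)) z

theorem SolvesOn.add {w : ℂ} {h₁ h₂ f₁ f₂ : ℂ → ℂ} (H₁ : SolvesOn w h₁ f₁)
    (H₂ : SolvesOn w h₂ f₂) : SolvesOn w (h₁ + h₂) (f₁ + f₂) := fun z hz => by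
  convert! (H₁ z hz).add (H₂ z hz) using 1
  · funext ζ
    simp only [Pi.add_apply]
    ring
  · simp only [Pi.add_apply]
    ring

theorem SolvesOn.const_smul {w : ℂ} {h f : ℂ → ℂ} (c : ℂ) (H : SolvesOn w h f) :
    SolvesOn w (c • h) (c • f) := fun z hz => by
  convert! (H z hz).const_mul c using 1
  · funext ζ
    simp only [Pi.smul_apply, smul_eq_mul]
    ring
  · simp only [Pi.smul_apply, smul_eq_mul]
    ring

theorem solvesOn_iff {l : ℂ} (hl : l ≠ 0) {h f : ℂ → ℂ} (hh : h ∈ holoDisc) (hf : f ∈ holoDisc) :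
    SolvesOn l⁻¹ h f ↔ l • f - cesaro f = h := by
  have hG : l • f - h ∈ holoDisc := holoDisc.sub_mem (holoDisc.smul_mem l hf) hh
  constructor
  · intro H
    rw [cesaro_eq_of_hasDerivAt hf hG]
    · simp
    intro z hz
    convert! (H z hz).const_mul l using 1
    · funext ζ
      simp only [Pi.sub_apply, Pi.smul_apply, smul_eq_mul]
      field_simp
    · field_simp
  · intro H z hz
    have hC : cesaro f = l • f - h := by rw [← H]; simp
    convert! (hasDerivAt_mul_cesaro hf hz).const_mul l⁻¹ using 1
    · funext ζ
      simp only [hC, Pi.sub_apply, Pi.smul_apply, smul_eq_mul]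
      field_simp
    · ring

/-- Comparing the coefficients of `z ^ k` in the differential equation. -/
theorem SolvesOn.leading_coeff {w : ℂ} {h f g u : ℂ → ℂ} (H : SolvesOn w h f) (k : ℕ)
    (hg : AnalyticAt ℂ g 0) (hu : AnalyticAt ℂ u 0)
    (hfg : ∀ᶠ z in 𝓝 0, f z = z ^ k * g z)
    (hfu : ∀ᶠ z in 𝓝 0, f z - w * h z = z ^ k * u z) : (k + 1) * u 0 = w * g 0 := by
  have hball : ∀ᶠ z : ℂ in 𝓝 0, ‖z‖ < 1 := by
    filter_upwards [ball_mem_nhds (0 : ℂ) one_pos] with z hz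
    simpa using hz
  have hev : ∀ᶠ z in 𝓝[≠] (0 : ℂ), (k + 1) * u z + z * deriv u z = w * g z / (1 - z) := by
    filter_upwards [hball.filter_mono nhdsWithin_le_nhds, hfg.filter_mono nhdsWithin_le_nhds,
      hfu.eventually_nhds.filter_mono nhdsWithin_le_nhds,
      hu.eventually_analyticAt.filter_mono nhdsWithin_le_nhds, self_mem_nhdsWithin]
      with z hz hfz hfuz huz hz0
    have hz0 : z ≠ 0 := hz0
    have h1 : HasDerivAt (fun ζ => ζ ^ (k + 1) * u ζ)
        (((k + 1 : ℕ) : ℂ) * z ^ k * u z + z ^ (k + 1) * deriv u z) z := by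
      simpa using (hasDerivAt_pow (k + 1) z).fun_mul huz.differentiableAt.hasDerivAt
    have h2 : HasDerivAt (fun ζ => ζ ^ (k + 1) * u ζ) (w * f z / (1 - z)) z := by
      refine (H z hz).congr_of_eventuallyEq ?_
      filter_upwards [hfuz] with ζ hζ
      rw [hζ]
      ring
    have h3 := h1.unique h2
    have h4 := one_sub_ne_zero_of_norm_lt hz
    rw [hfz] at h3
    have h5 : z ^ k ≠ 0 := pow_ne_zero k hz0
    apply mul_left_cancel₀ h5
    push_cast at h3
    linear_combination h3
  have hl : Tendsto (fun z => (k + 1) * u z + z * deriv u z) (𝓝[≠] (0 : ℂ))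
      (𝓝 ((k + 1) * u 0 + 0 * deriv u 0)) := by
    refine Tendsto.mono_left ?_ nhdsWithin_le_nhds
    have h1 := hu.continuousAt
    have h2 := hu.deriv.continuousAt
    exact ((h1.const_mul _).add (continuousAt_id.mul h2)).tendsto
  have hr : Tendsto (fun z => w * g z / (1 - z)) (𝓝[≠] (0 : ℂ)) (𝓝 (w * g 0 / (1 - 0))) := by
    refine Tendsto.mono_left ?_ nhdsWithin_le_nhds
    exact ((hg.continuousAt.const_mul w).div
      (continuousAt_const.sub continuousAt_id) (by simp)).tendsto
  have := tendsto_nhds_unique (hl.congr' hev) hr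
  simpa using this

theorem holoDisc.analyticAt_zero {f : ℂ → ℂ} (hf : f ∈ holoDisc) : AnalyticAt ℂ f 0 :=
  hf.1.analyticAt (ball_mem_nhds 0 one_pos)

theorem holoDisc.eq_zero_of_eventually {f : ℂ → ℂ} (hf : f ∈ holoDisc)
    (h : ∀ᶠ z in 𝓝 0, f z = 0) : f = 0 := by
  have h1 : AnalyticOnNhd ℂ f (ball 0 1) := hf.1.analyticOnNhd isOpen_ball
  have h2 := h1.eqOn_zero_of_preconnected_of_eventuallyEq_zero
    (convex_ball (0 : ℂ) 1).isPreconnected (mem_ball_self one_pos) h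
  funext z
  by_cases hz : z ∈ ball (0 : ℂ) 1
  · exact h2 hz
  · exact hf.2 z hz

/-- A nonzero solution of the homogeneous equation forces `w` to be a positive integer. -/
theorem SolvesOn.exists_eq_natCast {w : ℂ} {f : ℂ → ℂ} (H : SolvesOn w 0 f) (hf : f ∈ holoDisc)
    (hne : f ≠ 0) : ∃ (k : ℕ) (g : ℂ → ℂ), w = k + 1 ∧ AnalyticAt ℂ g 0 ∧ g 0 ≠ 0 ∧
      ∀ᶠ z in 𝓝 0, f z = z ^ k * g z := by
  have h1 : ¬ ∀ᶠ z in 𝓝 0, f z = 0 := fun h => hne (holoDisc.eq_zero_of_eventually hf h)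
  obtain ⟨k, g, hg, hg0, hfg⟩ :=
    (holoDisc.analyticAt_zero hf).exists_eventuallyEq_pow_smul_nonzero_iff.2 h1
  simp only [sub_zero, smul_eq_mul] at hfg
  refine ⟨k, g, ?_, hg, hg0, hfg⟩
  have := H.leading_coeff k hg hg hfg (by simpa using hfg)
  exact (mul_right_cancel₀ hg0 this).symm

/-- For `w = m` a positive integer the equation has no solution with right-hand side `z ^ (m - 1)`,
because of a resonance at the coefficient of `z ^ (m - 1)`. -/
theorem not_solvesOn_pow {m : ℕ} {h f : ℂ → ℂ} (hf : f ∈ holoDisc)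
    (hh : ∀ z : ℂ, ‖z‖ < 1 → h z = z ^ m) : ¬ SolvesOn ((m : ℂ) + 1) h f := by
  intro H
  have hm : (m : ℂ) + 1 ≠ 0 := Nat.cast_add_one_ne_zero m
  have hhev : ∀ᶠ z in 𝓝 0, h z = z ^ m := by
    filter_upwards [ball_mem_nhds (0 : ℂ) one_pos] with z hz
    exact hh z (by simpa using hz)
  -- it suffices to treat solutions of order at least `m` at the origin
  have key : ∀ g : ℂ → ℂ, AnalyticAt ℂ g 0 → ¬ ∀ᶠ z in 𝓝 0, f z = z ^ m * g z := by
    intro g hg hfg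
    have := H.leading_coeff m hg (u := fun z => g z - (m + 1)) (hg.sub analyticAt_const) hfg (by
      filter_upwards [hfg, hhev] with z h1 h2
      rw [h1, h2]
      ring)
    have h2 : ((m : ℂ) + 1) * (m + 1) = 0 := by linear_combination -this
    exact hm (mul_self_eq_zero.1 h2)
  by_cases h0 : ∀ᶠ z in 𝓝 0, f z = 0
  · exact key 0 analyticAt_const (by simpa using h0)
  obtain ⟨k, g, hg, hg0, hfg⟩ :=
    (holoDisc.analyticAt_zero hf).exists_eventuallyEq_pow_smul_nonzero_iff.2 h0
  simp only [sub_zero, smul_eq_mul] at hfg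
  rcases lt_or_ge k m with hkm | hkm
  · obtain ⟨d, rfl⟩ := Nat.exists_eq_add_of_lt hkm
    have := H.leading_coeff k hg
      (u := fun z => g z - (((k + d + 1 : ℕ) : ℂ) + 1) * z ^ (d + 1))
      (hg.sub (by fun_prop)) hfg (by
        filter_upwards [hfg, hhev] with z h1 h2
        rw [h1, h2]
        ring)
    simp only [ne_eq, Nat.add_eq_zero_iff, one_ne_zero, and_false, not_false_eq_true, zero_pow,
      mul_zero, sub_zero] at this
    have h2 : (k : ℂ) + 1 = ((k + d + 1 : ℕ) : ℂ) + 1 := mul_right_cancel₀ hg0 this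
    norm_cast at h2
    omega
  · obtain ⟨d, rfl⟩ := Nat.exists_eq_add_of_le hkm
    refine key (fun z => z ^ d * g z) (by fun_prop) ?_
    filter_upwards [hfg] with z h1
    rw [h1]
    ring

/-- The eigenfunction `z ^ j / (1 - z) ^ (j + 1)` of `C`, extended by zero. -/
def cesaroEigenfun (j : ℕ) : ℂ → ℂ :=
  (ball (0 : ℂ) 1).indicator fun z => z ^ j * ((1 - z) ^ (j + 1))⁻¹

theorem cesaroEigenfun_mem (j : ℕ) : cesaroEigenfun j ∈ holoDisc := by
  refine indicator_mem_holoDisc ?_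
  refine DifferentiableOn.mul (by fun_prop) (DifferentiableOn.inv (by fun_prop) fun z hz => ?_)
  exact pow_ne_zero _ (one_sub_ne_zero_of_norm_lt (by simpa using hz))

theorem cesaroEigenfun_apply (j : ℕ) {z : ℂ} (hz : ‖z‖ < 1) :
    cesaroEigenfun j z = z ^ j * ((1 - z) ^ (j + 1))⁻¹ :=
  indicator_of_mem (by simpa using hz) _

theorem hasDerivAt_mul_cesaroEigenfun (j : ℕ) {z : ℂ} (hz : ‖z‖ < 1) :
    HasDerivAt (fun ζ => ζ * cesaroEigenfun j ζ)
      ((j + 1) * cesaroEigenfun j z / (1 - z)) z := by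
  have h1 := one_sub_ne_zero_of_norm_lt hz
  have h2 : HasDerivAt (fun ζ : ℂ => (ζ / (1 - ζ)) ^ (j + 1))
      (((j + 1 : ℕ) : ℂ) * (z / (1 - z)) ^ j * ((1 * (1 - z) - z * (0 - 1)) / (1 - z) ^ 2)) z := by
    simpa using (((hasDerivAt_id' z).fun_div
      ((hasDerivAt_const z (1 : ℂ)).fun_sub (hasDerivAt_id' z)) h1).fun_pow (j + 1))
  have h3 : HasDerivAt (fun ζ => ζ * cesaroEigenfun j ζ)
      (((j + 1 : ℕ) : ℂ) * (z / (1 - z)) ^ j * ((1 * (1 - z) - z * (0 - 1)) / (1 - z) ^ 2)) z := by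
    refine h2.congr_of_eventuallyEq ?_
    filter_upwards [indicator_disc_eventuallyEq (fun z => z ^ j * ((1 - z) ^ (j + 1))⁻¹) hz]
      with ζ hζ
    rw [cesaroEigenfun, hζ, div_pow]
    ring
  convert! h3 using 1
  rw [cesaroEigenfun_apply j hz, div_pow]
  push_cast
  field_simp
  ring

/-- `C` acts on the line of `cesaroEigenfun j` as multiplication by `1 / (j + 1)`. -/
theorem solvesOn_cesaroEigenfun (j : ℕ) {w : ℂ} (hw : (j : ℂ) + 1 - w ≠ 0) :
    SolvesOn w (cesaroEigenfun j) ((w * (j + 1) / (j + 1 - w)) • cesaroEigenfun j) :=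
  fun z hz => by
  convert! (hasDerivAt_mul_cesaroEigenfun j hz).const_mul (w ^ 2 / (j + 1 - w)) using 1
  · funext ζ
    simp only [Pi.smul_apply, smul_eq_mul]
    field_simp
    ring
  · simp only [Pi.smul_apply, smul_eq_mul]
    field_simp

theorem solvesOn_zero_cesaroEigenfun (j : ℕ) :
    SolvesOn ((j : ℂ) + 1) 0 (cesaroEigenfun j) := fun z hz => by
  simpa using hasDerivAt_mul_cesaroEigenfun j hz

theorem SolvesOn.exists_eq_smul_eigenfun {w : ℂ} {f : ℂ → ℂ} (H : SolvesOn w 0 f)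
    (hf : f ∈ holoDisc) (hne : f ≠ 0) :
    ∃ (j : ℕ) (c : ℂ), w = j + 1 ∧ c ≠ 0 ∧ f = c • cesaroEigenfun j := by
  obtain ⟨k, g, rfl, hg, hg0, hfg⟩ := H.exists_eq_natCast hf hne
  refine ⟨k, g 0, rfl, hg0, ?_⟩
  by_contra hcon
  -- the difference has order larger than `k`, but must be of order `k` by the same token
  have hdiff : f + (-g 0) • cesaroEigenfun k ≠ 0 := fun h => hcon (by
    rw [neg_smul, ← sub_eq_add_neg] at h
    exact sub_eq_zero.1 h)
  have H' : SolvesOn ((k : ℂ) + 1) 0 (f + (-g 0) • cesaroEigenfun k) := by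
    simpa using H.add ((solvesOn_zero_cesaroEigenfun k).const_smul (-g 0))
  obtain ⟨k', g', hk', hg', hg'0, hfg'⟩ := H'.exists_eq_natCast
    (holoDisc.add_mem hf (holoDisc.smul_mem _ (cesaroEigenfun_mem k))) hdiff
  have hkk : k' = k := by
    have : (k : ℂ) = k' := add_right_cancel hk'
    exact_mod_cast this.symm
  subst hkk
  have hev : ∀ᶠ z in 𝓝[≠] (0 : ℂ), g z + -g 0 * ((1 - z) ^ (k' + 1))⁻¹ = g' z := by
    filter_upwards [hfg.filter_mono nhdsWithin_le_nhds, hfg'.filter_mono nhdsWithin_le_nhds,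
      nhdsWithin_le_nhds (ball_mem_nhds (0 : ℂ) one_pos), self_mem_nhdsWithin]
      with z h1 h2 hz hz0
    have hz0 : z ≠ 0 := hz0
    have hz : ‖z‖ < 1 := by simpa using hz
    apply mul_left_cancel₀ (pow_ne_zero k' hz0)
    rw [← h2]
    simp only [Pi.add_apply, Pi.smul_apply, smul_eq_mul, h1, cesaroEigenfun_apply k' hz]
    ring
  have hl : Tendsto (fun z => g z + -g 0 * ((1 - z) ^ (k' + 1))⁻¹) (𝓝[≠] (0 : ℂ))
      (𝓝 (g 0 + -g 0 * ((1 - 0) ^ (k' + 1))⁻¹)) := by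
    refine Tendsto.mono_left ?_ nhdsWithin_le_nhds
    refine (hg.continuousAt.add (continuousAt_const.mul (ContinuousAt.inv₀ ?_ (by simp)))).tendsto
    fun_prop
  have := tendsto_nhds_unique (hl.congr' hev)
    (hg'.continuousAt.tendsto.mono_left nhdsWithin_le_nhds)
  apply hg'0
  rw [← this]
  simp

/-! ### An integral formula for the resolvent -/

/-- The function `J(z) = ∫_0^1 t ^ c g(tz) dt` solves `z J' + (c + 1) J = g`. -/
theorem exists_hasDerivAt_moment_integral {c : ℂ} (hc : -1 < c.re) {g : ℂ → ℂ}
    (hg : DifferentiableOn ℂ g (ball 0 1)) {z : ℂ} (hz : ‖z‖ < 1) :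
    ∃ J' : ℂ, HasDerivAt (fun ζ : ℂ => ∫ t in (0 : ℝ)..1, (t : ℂ) ^ c * g (t * ζ)) J' z ∧
      z * J' + (c + 1) * ∫ t in (0 : ℝ)..1, (t : ℂ) ^ c * g (t * z) = g z := by
  have hg' : ContinuousOn (deriv g) (ball 0 1) := (hg.deriv isOpen_ball).continuousOn
  have hmem : ∀ ζ : ℂ, ‖ζ‖ < 1 → ∀ t ∈ Icc (0 : ℝ) 1, (t : ℂ) * ζ ∈ ball (0 : ℂ) 1 := by
    intro ζ hζ t ht
    simp only [mem_ball_zero_iff, norm_mul, Complex.norm_real, Real.norm_of_nonneg ht.1]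
    nlinarith [norm_nonneg ζ, ht.2]
  have hu : uIcc (0 : ℝ) 1 = Icc 0 1 := uIcc_of_le zero_le_one
  have hint : ∀ u : ℝ → ℂ, ContinuousOn u (Icc 0 1) →
      IntervalIntegrable (fun t : ℝ => (t : ℂ) ^ c * u t) volume 0 1 := fun u hu' =>
    (intervalIntegral.intervalIntegrable_cpow' hc).mul_continuousOn (by rwa [hu])
  have hcg : ∀ ζ : ℂ, ‖ζ‖ < 1 → ContinuousOn (fun t : ℝ => g (t * ζ)) (Icc 0 1) := fun ζ hζ =>
    hg.continuousOn.comp (by fun_prop) (hmem ζ hζ)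
  have hcg' : ContinuousOn (fun t : ℝ => (t : ℂ) * deriv g (t * z)) (Icc 0 1) :=
    ContinuousOn.mul (by fun_prop) (hg'.comp (by fun_prop) (hmem z hz))
  set ρ : ℝ := (1 + ‖z‖) / 2 with hρ
  have hρ1 : ρ < 1 := by rw [hρ]; linarith
  have hzρ : ‖z‖ < ρ := by rw [hρ]; linarith
  obtain ⟨M, hM⟩ := (isCompact_closedBall (0 : ℂ) ρ).exists_bound_of_continuousOn
    (hg'.mono (closedBall_subset_ball hρ1))
  have hder : ∀ t ∈ Icc (0 : ℝ) 1, ∀ x : ℂ, ‖x‖ < 1 →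
      HasDerivAt (fun ζ : ℂ => g (t * ζ)) (t * deriv g (t * x)) x := by
    intro t ht x hx
    have h1 := (hg.differentiableAt (isOpen_ball.mem_nhds (hmem x hx t ht))).hasDerivAt
    have h2 : HasDerivAt (fun ζ : ℂ => (t : ℂ) * ζ) t x := by
      simpa using (hasDerivAt_id' x).const_mul (t : ℂ)
    simpa [mul_comm, Function.comp_def] using h1.comp x h2
  have hball : ball (0 : ℂ) ρ ∈ 𝓝 z := isOpen_ball.mem_nhds (by simpa using hzρ)
  have main := intervalIntegral.hasDerivAt_integral_of_dominated_loc_of_deriv_le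
    (μ := volume) (a := 0) (b := 1) (F := fun (ζ : ℂ) (t : ℝ) => (t : ℂ) ^ c * g (t * ζ))
    (F' := fun (ζ : ℂ) (t : ℝ) => (t : ℂ) ^ c * (t * deriv g (t * ζ))) (x₀ := z)
    (bound := fun t => t ^ c.re * M) hball ?_ (hint _ (hcg z hz)) ?_ ?_ ?_ ?_
  · refine ⟨_, main.2, ?_⟩
    have hc1 : c + 1 ≠ 0 := fun h => by
      have : (c + 1).re = 0 := by rw [h]; simp
      simp at this
      linarith
    have hparts := intervalIntegral.integral_eq_sub_of_hasDerivAt_of_le (a := 0) (b := 1)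
      (f := fun t : ℝ => (t : ℂ) ^ (c + 1) * g (t * z))
      (f' := fun t : ℝ => z * ((t : ℂ) ^ c * (t * deriv g (t * z))) +
        (c + 1) * ((t : ℂ) ^ c * g (t * z))) zero_le_one ?_ ?_ ?_
    · rw [intervalIntegral.integral_add (main.1.const_mul z) ((hint _ (hcg z hz)).const_mul _),
        intervalIntegral.integral_const_mul, intervalIntegral.integral_const_mul] at hparts
      rw [hparts]
      simp [Complex.zero_cpow hc1]
    · refine ContinuousOn.mul ?_ (hcg z hz)
      intro t _
      exact (Complex.continuousAt_ofReal_cpow_const t (c + 1)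
        (Or.inl (by simp; linarith))).continuousWithinAt
    · intro t ht
      have h1 : HasDerivAt (fun y : ℝ => (y : ℂ) ^ (c + 1)) ((c + 1) * (t : ℂ) ^ c) t := by
        have := (hasDerivAt_ofReal_cpow_const' ht.1.ne'
          (show c ≠ -1 from fun h => hc1 (by rw [h]; simp))).const_mul (c + 1)
        simpa [mul_div_cancel₀ _ hc1] using this
      have h2 : HasDerivAt (fun y : ℝ => g (y * z)) (z * deriv g (t * z)) t := by
        have h3 := (hg.differentiableAt (isOpen_ball.mem_nhds
          (hmem z hz t (Ioo_subset_Icc_self ht)))).hasDerivAt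
        have h4 : HasDerivAt (fun y : ℝ => (y : ℂ) * z) z t := by
          simpa using (Complex.ofRealCLM.hasDerivAt (x := t)).mul_const z
        simpa [mul_comm, Function.comp_def] using h3.comp t h4
      convert! h1.fun_mul h2 using 1
      rw [Complex.cpow_add _ _ (by exact_mod_cast ht.1.ne'), Complex.cpow_one]
      ring
    · exact (main.1.const_mul z).add ((hint _ (hcg z hz)).const_mul _)
  · filter_upwards [hball] with x hx
    have hx1 : ‖x‖ < 1 := (by simpa using hx : ‖x‖ < ρ).trans hρ1
    have := (hint _ (hcg x hx1)).aestronglyMeasurable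
    rwa [uIoc_of_le zero_le_one]
  · have := (hint _ hcg').aestronglyMeasurable
    rwa [uIoc_of_le zero_le_one]
  · refine Eventually.of_forall fun t ht x hx => ?_
    rw [uIoc_of_le zero_le_one] at ht
    have hx1 : ‖x‖ < ρ := by simpa using hx
    rw [norm_mul, norm_mul, Complex.norm_cpow_eq_rpow_re_of_pos ht.1, Complex.norm_real,
      Real.norm_of_nonneg ht.1.le]
    have hle : ‖(t : ℂ) * x‖ ≤ ρ := by
      rw [norm_mul, Complex.norm_real, Real.norm_of_nonneg ht.1.le]
      nlinarith [norm_nonneg x, ht.2]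
    have := hM (t * x) (by simpa using hle)
    refine mul_le_mul_of_nonneg_left ?_ (Real.rpow_nonneg ht.1.le _)
    nlinarith [norm_nonneg (deriv g (t * x)), ht.2, ht.1]
  · exact (intervalIntegral.intervalIntegrable_rpow' hc).mul_const M
  · refine Eventually.of_forall fun t ht x hx => ?_
    rw [uIoc_of_le zero_le_one] at ht
    have hx1 : ‖x‖ < 1 := (by simpa using hx : ‖x‖ < ρ).trans hρ1
    exact (hder t (Ioc_subset_Icc_self ht) x hx1).const_mul _

/-- For `h = z ^ N k`, the function
`T_w h (z) = (1 - z) ^ (-w) ∫_0^1 t ^ (-w) (1 - tz) ^ (w - 1) h(tz) dt`, extended by zero. The power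
`z ^ N` is pulled out of the integral, which then converges for `Re w < N + 1`. It is `C h` for
`w = 0`, and in general `w + w ^ 2 T_w` is the inverse of `1 / w - C`. -/
def resolventKernel (w : ℂ) (N : ℕ) (k : ℂ → ℂ) : ℂ → ℂ :=
  (ball (0 : ℂ) 1).indicator fun z => (1 - z) ^ (-w) * z ^ N *
    ∫ t in (0 : ℝ)..1, (t : ℂ) ^ ((N : ℂ) - w) * ((1 - t * z) ^ (w - 1) * k (t * z))

theorem hasDerivAt_one_sub_cpow (w : ℂ) {z : ℂ} (hz : ‖z‖ < 1) :
    HasDerivAt (fun ζ : ℂ => (1 - ζ) ^ w) (-w * (1 - z) ^ (w - 1)) z := by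
  have h1 : HasDerivAt (fun ζ : ℂ => 1 - ζ) (-1) z := by
    simpa using (hasDerivAt_id' z).const_sub 1
  convert! h1.cpow_const (c := w) (one_sub_mem_slitPlane hz) using 1
  ring

section

variable {w : ℂ} {N : ℕ} {k : ℂ → ℂ}

theorem exists_hasDerivAt_resolventKernel (hw : w.re < N + 1) (hk : DifferentiableOn ℂ k (ball 0 1))
    {z : ℂ} (hz : ‖z‖ < 1) : DifferentiableAt ℂ (resolventKernel w N k) z ∧
      HasDerivAt (fun ζ => ζ * resolventKernel w N k ζ)
        ((z ^ N * k z + w * resolventKernel w N k z) / (1 - z)) z := by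
  have hc : -1 < ((N : ℂ) - w).re := by simp; linarith
  have hg : DifferentiableOn ℂ (fun ζ => (1 - ζ) ^ (w - 1) * k ζ) (ball 0 1) := by
    refine DifferentiableOn.mul (fun ζ hζ => ?_) hk
    exact (hasDerivAt_one_sub_cpow (w - 1)
      (by simpa using hζ)).differentiableAt.differentiableWithinAt
  obtain ⟨J', hJ', hode⟩ := exists_hasDerivAt_moment_integral hc hg hz
  set J : ℂ → ℂ := fun ζ =>
    ∫ t in (0 : ℝ)..1, (t : ℂ) ^ ((N : ℂ) - w) * ((1 - t * ζ) ^ (w - 1) * k (t * ζ)) with hJ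
  have hJz : z * J' + ((N : ℂ) - w + 1) * J z = (1 - z) ^ (w - 1) * k z := hode
  have hev : resolventKernel w N k =ᶠ[𝓝 z] fun ζ => (1 - ζ) ^ (-w) * ζ ^ N * J ζ :=
    indicator_disc_eventuallyEq _ hz
  have h1 := hasDerivAt_one_sub_cpow (-w) hz
  have h2 : DifferentiableAt ℂ (fun ζ : ℂ => (1 - ζ) ^ (-w) * ζ ^ N * J ζ) z :=
    (h1.differentiableAt.fun_mul (by fun_prop)).fun_mul hJ'.differentiableAt
  refine ⟨h2.congr_of_eventuallyEq hev, ?_⟩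
  have h3 : HasDerivAt (fun ζ : ℂ => (1 - ζ) ^ (-w) * ζ ^ (N + 1) * J ζ)
      ((-(-w) * (1 - z) ^ (-w - 1) * z ^ (N + 1) + (1 - z) ^ (-w) * ((N + 1 : ℕ) * z ^ N)) * J z +
        (1 - z) ^ (-w) * z ^ (N + 1) * J') z := by
    simpa using (h1.fun_mul (hasDerivAt_pow (N + 1) z)).fun_mul hJ'
  have h4 : HasDerivAt (fun ζ => ζ * resolventKernel w N k ζ)
      ((-(-w) * (1 - z) ^ (-w - 1) * z ^ (N + 1) + (1 - z) ^ (-w) * ((N + 1 : ℕ) * z ^ N)) * J z +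
        (1 - z) ^ (-w) * z ^ (N + 1) * J') z := by
    refine h3.congr_of_eventuallyEq ?_
    filter_upwards [hev] with ζ hζ
    rw [hζ]
    ring
  convert! h4 using 1
  have hne := one_sub_ne_zero_of_norm_lt hz
  rw [hev.eq_of_nhds, Complex.cpow_sub _ _ hne, Complex.cpow_one]
  have h5 : (1 - z) ^ (-w) * ((1 - z) ^ (w - 1) * (1 - z)) = 1 := by
    rw [Complex.cpow_sub _ _ hne, Complex.cpow_one, div_mul_cancel₀ _ hne,
      ← Complex.cpow_add _ _ hne]
    simp
  field_simp
  push_cast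
  linear_combination (-z ^ N * k z) * h5 - (1 - z) ^ (-w) * z ^ N * (1 - z) * hJz

theorem resolventKernel_mem (hw : w.re < N + 1) (hk : DifferentiableOn ℂ k (ball 0 1)) :
    resolventKernel w N k ∈ holoDisc :=
  ⟨fun z hz => (exists_hasDerivAt_resolventKernel hw hk
      (by simpa using hz)).1.differentiableWithinAt,
    fun _ hz => indicator_of_notMem hz _⟩

theorem solvesOn_resolventKernel (hw : w.re < N + 1) (hk : DifferentiableOn ℂ k (ball 0 1))
    {h : ℂ → ℂ} (hh : ∀ z : ℂ, ‖z‖ < 1 → h z = z ^ N * k z) :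
    SolvesOn w h (w • h + w ^ 2 • resolventKernel w N k) := fun z hz => by
  convert! (exists_hasDerivAt_resolventKernel hw hk hz).2.const_mul (w ^ 2) using 1
  · funext ζ
    simp only [Pi.add_apply, Pi.smul_apply, smul_eq_mul]
    ring
  · simp only [Pi.add_apply, Pi.smul_apply, smul_eq_mul, hh z hz]
    ring

theorem cesaro_eq_resolventKernel {h : ℂ → ℂ} (hh : h ∈ holoDisc) :
    cesaro h = resolventKernel 0 0 h := by
  refine cesaro_eq_of_hasDerivAt hh (resolventKernel_mem (by simp) hh.1) fun z hz => ?_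
  simpa using (exists_hasDerivAt_resolventKernel (w := 0) (N := 0) (by simp) hh.1 hz).2

end

/-! ### Integral estimates in the weighted Bergman spaces -/

open scoped ENNReal

theorem holoDisc.measurable {f : ℂ → ℂ} (hf : f ∈ holoDisc) : Measurable f := by
  classical
  have h : f = (ball (0 : ℂ) 1).piecewise f (fun _ => 0) := by
    funext z
    by_cases hz : z ∈ ball (0 : ℂ) 1
    · simp only [hz, piecewise_eq_of_mem]
    · simp only [hz, not_false_eq_true, piecewise_eq_of_notMem, hf.2 z hz]
  rw [h]
  exact hf.1.continuousOn.measurable_piecewise continuousOn_const isOpen_ball.measurableSet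

theorem lintegral_bergmanMeasure (μ : ℝ) (F : ℂ → ℝ≥0∞) :
    ∫⁻ z, F z ∂(bergmanMeasure μ) =
      ∫⁻ z in ball 0 1, ENNReal.ofReal ((1 - ‖z‖) ^ μ / Real.pi) * F z := by
  rw [bergmanMeasure, lintegral_withDensity_eq_lintegral_mul_non_measurable]
  · rfl
  · fun_prop
  · exact Eventually.of_forall fun _ => ENNReal.ofReal_lt_top

instance (μ : ℝ) : SFinite (bergmanMeasure μ) := by
  unfold bergmanMeasure
  infer_instance

theorem ae_bergmanMeasure_mem (μ : ℝ) : ∀ᵐ z ∂(bergmanMeasure μ), ‖z‖ < 1 := by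
  have h1 : ∀ᵐ z ∂(volume.restrict (ball (0 : ℂ) 1)), ‖z‖ < 1 := by
    filter_upwards [ae_restrict_mem isOpen_ball.measurableSet] with z hz
    simpa using hz
  exact (withDensity_absolutelyContinuous _ _).ae_le h1

/-- The area mean value inequality for analytic functions. -/
theorem enorm_mul_volume_ball_le {f : ℂ → ℂ} (hf : Measurable f) {c : ℂ} {R : ℝ}
    (hd : DifferentiableOn ℂ f (ball c R)) :
    ‖f c‖ₑ * volume (ball c R) ≤ ∫⁻ z in ball c R, ‖f z‖ₑ := by
  -- integration over discs centred at `c`, in polar coordinates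
  have polar : ∀ F : ℂ → ℝ≥0∞, Measurable F → ∫⁻ z in ball c R, F z =
      ∫⁻ r in Ioi (0 : ℝ), ∫⁻ θ in Ioo (-Real.pi) Real.pi,
        ENNReal.ofReal r * (Iio R).indicator (fun _ => F (circleMap c r θ)) r := by
    intro F hF
    rw [← lintegral_indicator isOpen_ball.measurableSet,
      ← lintegral_add_left_eq_self _ c, ← Complex.lintegral_comp_polarCoord_symm,
      polarCoord_target, Measure.volume_eq_prod, ← Measure.prod_restrict, lintegral_prod]
    · refine setLIntegral_congr_fun measurableSet_Ioi fun r hr => ?_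
      refine lintegral_congr fun θ => ?_
      have hr : 0 < r := hr
      simp only [smul_eq_mul]
      congr 1
      have h1 : Complex.polarCoord.symm (r, θ) = circleMap 0 r θ := by
        rw [Complex.polarCoord_symm_apply, circleMap, Complex.exp_mul_I]
        simp
      have h2 : c + circleMap 0 r θ = circleMap c r θ := by simp [circleMap]
      have h3 : dist (circleMap c r θ) c = r := by
        rw [← mem_sphere]
        exact circleMap_mem_sphere c hr.le θ
      rw [h1, h2]
      by_cases hrR : r < R
      · rw [indicator_of_mem (by rwa [mem_ball, h3]),
          indicator_of_mem (by simpa using hrR)]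
      · rw [indicator_of_notMem (by rwa [mem_ball, h3]),
          indicator_of_notMem (by simpa using hrR)]
    · refine Measurable.aemeasurable ?_
      refine Measurable.mul (by fun_prop) ?_
      refine (hF.indicator isOpen_ball.measurableSet).comp ?_
      refine Measurable.const_add ?_ c
      have h1 : (Complex.polarCoord.symm : ℝ × ℝ → ℂ) =
          fun q => q.1 * (Real.cos q.2 + Real.sin q.2 * Complex.I) :=
        funext Complex.polarCoord_symm_apply
      rw [h1]
      fun_prop
  rw [← setLIntegral_const, polar _ measurable_const, polar _ hf.enorm]
  refine setLIntegral_mono' measurableSet_Ioi fun r hr => ?_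
  have hr : 0 < r := hr
  by_cases hrR : r < R
  swap
  · simp [hrR]
  simp only [mem_Iio, hrR, indicator_of_mem]
  rw [lintegral_const_mul' _ _ ENNReal.ofReal_ne_top,
    lintegral_const_mul' _ _ ENNReal.ofReal_ne_top]
  refine mul_le_mul_right ?_ _
  have hmv : Real.circleAverage f c r = f c := by
    refine DiffContOnCl.circleAverage ?_
    rw [abs_of_pos hr]
    exact hd.diffContOnCl_ball (closedBall_subset_ball hrR)
  have hper : Function.Periodic (fun θ => f (circleMap c r θ)) (2 * Real.pi) := fun θ => by
    simp [periodic_circleMap c r θ]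
  have h1 : ∫ θ in (-Real.pi)..Real.pi, f (circleMap c r θ) = (2 * Real.pi : ℝ) • f c := by
    have h2 := hper.intervalIntegral_add_eq (-Real.pi) 0
    rw [zero_add, show -Real.pi + 2 * Real.pi = Real.pi by ring] at h2
    rw [h2, ← hmv, Real.circleAverage_def, smul_smul, mul_inv_cancel₀ (by positivity), one_smul]
  rw [intervalIntegral.integral_of_le (by linarith [Real.pi_pos]), integral_Ioc_eq_integral_Ioo]
    at h1
  calc ∫⁻ _ in Ioo (-Real.pi) Real.pi, ‖f c‖ₑ = ‖(2 * Real.pi : ℝ) • f c‖ₑ := by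
        rw [setLIntegral_const, Real.volume_Ioo, enorm_smul, mul_comm,
          Real.enorm_of_nonneg (by positivity)]
        congr 2
        ring
    _ ≤ _ := by
        rw [← h1]
        exact enorm_integral_le_lintegral_enorm _

/-- The `p`-th power of an average is at most the average of the `p`-th power. -/
theorem lintegral_rpow_le_of_one_lt {X : Type*} [MeasurableSpace X] (ν : Measure X) {p : ℝ}
    (hp : 1 < p) {F : X → ℝ≥0∞} (hF : Measurable F) :
    (∫⁻ x, F x ∂ν) ^ p ≤ (∫⁻ x, F x ^ p ∂ν) * ν univ ^ (p - 1) := by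
  have hp0 : 0 < p := one_pos.trans hp
  have h := eLpNorm_le_eLpNorm_mul_rpow_measure_univ (p := 1) (q := ENNReal.ofReal p) (μ := ν)
    (f := F) (ENNReal.one_le_ofReal.2 hp.le) hF.aestronglyMeasurable
  rw [eLpNorm_one_eq_lintegral_enorm, eLpNorm_eq_lintegral_rpow_enorm_toReal (by simpa using hp0)
    (by simp), ENNReal.toReal_ofReal hp0.le] at h
  simp only [enorm_eq_self, ENNReal.toReal_one] at h
  refine (ENNReal.rpow_le_rpow h hp0.le).trans_eq ?_
  rw [ENNReal.mul_rpow_of_nonneg _ _ hp0.le, ← ENNReal.rpow_mul, ← ENNReal.rpow_mul]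
  congr 1
  · rw [one_div_mul_cancel hp0.ne', ENNReal.rpow_one]
  · congr 1
    field_simp

/-- Functions in `A^p_μ` grow at most like `(1 - |z|) ^ (-(2 + μ) / p)`. -/
theorem exists_growth_bound {p μ : ℝ} (hp : 1 < p) (hμ : 0 < μ) : ∃ K : ℝ≥0∞, K ≠ ∞ ∧
    ∀ f ∈ holoDisc, ∀ z : ℂ, ‖z‖ < 1 →
      ‖f z‖ₑ ≤ K * eLpNorm f (ENNReal.ofReal p) (bergmanMeasure μ) *
        ENNReal.ofReal ((1 - ‖z‖) ^ (-((2 + μ) / p))) := by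
  have hp0 : 0 < p := one_pos.trans hp
  refine ⟨ENNReal.ofReal (2 ^ ((2 + μ) / p)), ENNReal.ofReal_ne_top, fun f hf z hz => ?_⟩
  set R : ℝ := (1 - ‖z‖) / 2 with hR
  have hR0 : 0 < R := by rw [hR]; linarith
  have hsub : ball z R ⊆ ball (0 : ℂ) 1 := by
    intro x hx
    have h1 : ‖x - z‖ < R := by simpa [dist_eq_norm] using hx
    have h2 : ‖x‖ ≤ ‖x - z‖ + ‖z‖ := by simpa using norm_add_le (x - z) z
    simp only [mem_ball_zero_iff]
    linarith
  have hdens : ∀ x ∈ ball z R, R ≤ 1 - ‖x‖ := by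
    intro x hx
    have h1 : ‖x - z‖ < R := by simpa [dist_eq_norm] using hx
    have h2 : ‖x‖ ≤ ‖x - z‖ + ‖z‖ := by simpa using norm_add_le (x - z) z
    linarith
  have hmeas := holoDisc.measurable hf
  set V := volume (ball z R) with hV
  have hV' : V = ENNReal.ofReal (R ^ 2 * Real.pi) := by
    rw [hV, Complex.volume_ball, ENNReal.ofReal_mul (by positivity), ENNReal.ofReal_pow hR0.le]
    congr 1
    exact (ENNReal.ofReal_coe_nnreal (p := NNReal.pi)).symm
  have hV0 : V ≠ 0 := by rw [hV']; simpa using by positivity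
  have hVt : V ≠ ∞ := by rw [hV']; exact ENNReal.ofReal_ne_top
  set I := ∫⁻ x, ‖f x‖ₑ ^ p ∂(bergmanMeasure μ) with hI
  have h1 : ∫⁻ x in ball z R, ‖f x‖ₑ ^ p ≤ ENNReal.ofReal (Real.pi * R ^ (-μ)) * I := by
    rw [hI, lintegral_bergmanMeasure, ← lintegral_const_mul' _ _ ENNReal.ofReal_ne_top]
    refine le_trans ?_ (lintegral_mono_set hsub)
    refine setLIntegral_mono' isOpen_ball.measurableSet fun x hx => ?_
    rw [← mul_assoc, ← ENNReal.ofReal_mul (by positivity)]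
    refine le_mul_of_one_le_left' (ENNReal.one_le_ofReal.2 ?_)
    have h2 : R ^ μ ≤ (1 - ‖x‖) ^ μ := Real.rpow_le_rpow hR0.le (hdens x hx) hμ.le
    have h3 : 0 < R ^ μ := Real.rpow_pos_of_pos hR0 _
    rw [Real.rpow_neg hR0.le]
    have h4 : Real.pi * (R ^ μ)⁻¹ * ((1 - ‖x‖) ^ μ / Real.pi) = (1 - ‖x‖) ^ μ / R ^ μ := by
      field_simp
    rw [h4]
    exact (one_le_div h3).2 h2
  have h2 : (‖f z‖ₑ * V) ^ p ≤ ENNReal.ofReal (Real.pi * R ^ (-μ)) * I * V ^ (p - 1) := by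
    refine (ENNReal.rpow_le_rpow (enorm_mul_volume_ball_le hmeas (hf.1.mono hsub)) hp0.le).trans ?_
    refine (lintegral_rpow_le_of_one_lt _ hp hmeas.enorm).trans ?_
    rw [Measure.restrict_apply_univ]
    exact mul_le_mul_left h1 _
  have h3 : ‖f z‖ₑ ^ p ≤ ENNReal.ofReal (R ^ (-(2 + μ))) * I := by
    have h4 : V ^ p = V * V ^ (p - 1) := by
      have h5 := ENNReal.rpow_add_of_nonneg (x := V) 1 (p - 1) zero_le_one (by linarith)
      rwa [add_sub_cancel, ENNReal.rpow_one] at h5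
    rw [ENNReal.mul_rpow_of_nonneg _ _ hp0.le, h4, ← mul_assoc] at h2
    have h5 : V ^ (p - 1) ≠ 0 := by simp [ENNReal.rpow_eq_zero_iff, hV0, hVt]
    have h6 : V ^ (p - 1) ≠ ∞ := by
      simp [ENNReal.rpow_eq_top_iff, hV0, hVt]
    have h7 := (ENNReal.mul_le_mul_iff_left h5 h6).1 h2
    have h8 : ENNReal.ofReal (Real.pi * R ^ (-μ)) * I =
        ENNReal.ofReal (R ^ (-(2 + μ))) * I * V := by
      rw [hV', mul_right_comm, ← ENNReal.ofReal_mul (by positivity)]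
      congr 2
      rw [neg_add, Real.rpow_add hR0, Real.rpow_neg hR0.le 2, Real.rpow_two]
      field_simp
    rw [h8] at h7
    exact (ENNReal.mul_le_mul_iff_left hV0 hVt).1 h7
  have h4 : ‖f z‖ₑ ≤ (ENNReal.ofReal (R ^ (-(2 + μ))) * I) ^ (1 / p) := by
    have := ENNReal.rpow_le_rpow h3 (show 0 ≤ 1 / p by positivity)
    rwa [← ENNReal.rpow_mul, mul_one_div_cancel hp0.ne', ENNReal.rpow_one] at this
  refine h4.trans_eq ?_
  rw [eLpNorm_eq_lintegral_rpow_enorm_toReal (by simpa using hp0) (by simp),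
    ENNReal.toReal_ofReal hp0.le, ENNReal.mul_rpow_of_nonneg _ _ (by positivity), mul_right_comm,
    ← ENNReal.ofReal_mul (by positivity), ENNReal.ofReal_rpow_of_nonneg (by positivity)
    (by positivity)]
  congr 2
  have h5 : 1 - ‖z‖ = 2 * R := by rw [hR]; ring
  rw [h5, ← Real.rpow_mul hR0.le, Real.mul_rpow (by norm_num) hR0.le, ← mul_assoc,
    ← Real.rpow_add (by norm_num), add_neg_cancel, Real.rpow_zero, one_mul]
  congr 1
  field_simp

theorem norm_one_sub_pos {z : ℂ} (hz : ‖z‖ < 1) : 0 < ‖1 - z‖ :=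
  norm_pos_iff.2 (one_sub_ne_zero_of_norm_lt hz)

theorem one_sub_norm_le (z : ℂ) : 1 - ‖z‖ ≤ ‖1 - z‖ := by
  simpa using norm_sub_norm_le (1 : ℂ) z

/-- The function `|1 - z| ^ (-A)` lies in `L^p(dA_γ)` for `A p < γ + 2`. -/
theorem lintegral_one_sub_rpow_lt_top {p γ A : ℝ} (hp : 0 < p) (hγ : 0 < γ)
    (hA : A < (2 + γ) / p) :
    ∫⁻ z, ENNReal.ofReal (‖1 - z‖ ^ (-A)) ^ p ∂(bergmanMeasure γ) < ∞ := by
  rw [lintegral_bergmanMeasure]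
  have hAp : A * p < 2 + γ := (lt_div_iff₀ hp).1 hA
  have hint : IntegrableOn (fun x : ℂ => ‖x‖ ^ (-(A * p - γ))) (ball 0 2) volume := by
    refine integrableOn_ball_of_norm_le_rpow (C := 1) (α := A * p - γ) (by simp) ?_ ?_ ?_
    · simp
      linarith
    · refine Eventually.of_forall fun x => ?_
      rw [Real.norm_of_nonneg (by positivity), one_mul]
    · exact Measurable.aestronglyMeasurable (by fun_prop)
  have hfin := hint.hasFiniteIntegral
  rw [hasFiniteIntegral_iff_enorm] at hfin
  refine lt_of_le_of_lt ?_ hfin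
  rw [← lintegral_indicator isOpen_ball.measurableSet, ← lintegral_indicator
    isOpen_ball.measurableSet]
  refine le_trans (lintegral_mono fun z => ?_) (lintegral_sub_left_eq_self _ (1 : ℂ)).le
  by_cases hz : ‖z‖ < 1
  swap
  · rw [indicator_of_notMem (by simpa using hz)]
    exact zero_le
  have h2 : ‖1 - z‖ < 2 := by
    have := norm_sub_le (1 : ℂ) z
    rw [norm_one] at this
    linarith
  rw [indicator_of_mem (by simpa using hz), indicator_of_mem (by simpa using h2)]
  have h0 := norm_one_sub_pos hz
  rw [ENNReal.ofReal_rpow_of_nonneg (by positivity) hp.le,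
    ← ENNReal.ofReal_mul (div_nonneg (Real.rpow_nonneg (by linarith) _) Real.pi_pos.le),
    Real.enorm_of_nonneg (by positivity)]
  refine ENNReal.ofReal_le_ofReal ?_
  have h3 : (1 - ‖z‖) ^ γ / Real.pi ≤ ‖1 - z‖ ^ γ := by
    have h4 : (1 - ‖z‖) ^ γ ≤ ‖1 - z‖ ^ γ :=
      Real.rpow_le_rpow (by linarith) (one_sub_norm_le z) hγ.le
    exact (div_le_self (Real.rpow_nonneg (by linarith) _)
      (by linarith [Real.pi_gt_three])).trans h4
  rw [neg_sub, show γ - A * p = γ + -A * p by ring, Real.rpow_add h0, Real.rpow_mul h0.le]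
  exact mul_le_mul_of_nonneg_right h3 (by positivity)

/-- Dilations by `t ≥ 1/2` are bounded on `L^p(dA_μ)`. -/
theorem lintegral_dilation_le {μ : ℝ} (hμ : 0 < μ) {t : ℝ} (ht : 1 / 2 ≤ t) (ht1 : t ≤ 1)
    {F : ℂ → ℝ≥0∞} (hF : Measurable F) :
    ∫⁻ z, F (t * z) ∂(bergmanMeasure μ) ≤ 4 * ∫⁻ z, F z ∂(bergmanMeasure μ) := by
  have ht0 : 0 < t := by linarith
  rw [lintegral_bergmanMeasure, lintegral_bergmanMeasure,
    ← lintegral_indicator isOpen_ball.measurableSet,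
    ← lintegral_indicator isOpen_ball.measurableSet]
  set G : ℂ → ℝ≥0∞ := (ball (0 : ℂ) 1).indicator
    fun z => ENNReal.ofReal ((1 - ‖z‖) ^ μ / Real.pi) * F z with hG
  have hGm : Measurable G := Measurable.indicator (by fun_prop) isOpen_ball.measurableSet
  have hmap : ∫⁻ z, G (t • z) = ENNReal.ofReal |(t ^ 2)⁻¹| * ∫⁻ z, G z := by
    have h1 := Measure.map_addHaar_smul (volume : Measure ℂ) ht0.ne'
    rw [← lintegral_map hGm (measurable_const_smul t), h1, lintegral_smul_measure]
    simp
  refine le_trans ?_ (hmap.le.trans ?_)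
  · refine lintegral_mono fun z => ?_
    by_cases hz : ‖z‖ < 1
    swap
    · rw [indicator_of_notMem (by simpa using hz)]
      exact zero_le
    have htz : ‖t • z‖ ≤ ‖z‖ := by
      rw [norm_smul, Real.norm_of_nonneg ht0.le]
      exact mul_le_of_le_one_left (norm_nonneg z) ht1
    rw [indicator_of_mem (by simpa using hz), hG,
      indicator_of_mem (by simpa using htz.trans_lt hz), Complex.real_smul]
    refine mul_le_mul_left (ENNReal.ofReal_le_ofReal ?_) _
    refine div_le_div_of_nonneg_right ?_ Real.pi_pos.le
    refine Real.rpow_le_rpow (by linarith) ?_ hμ.le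
    rw [← Complex.real_smul]
    linarith
  · refine mul_le_mul_left ?_ _
    rw [abs_of_pos (by positivity)]
    have h4 : (t ^ 2)⁻¹ ≤ 4 := by
      rw [inv_le_comm₀ (by positivity) (by norm_num)]
      nlinarith
    calc ENNReal.ofReal (t ^ 2)⁻¹ ≤ ENNReal.ofReal 4 := ENNReal.ofReal_le_ofReal h4
      _ = 4 := by norm_num

/-- The measure `(1 - t) ^ (ε - 1) dt` on `(1/2, 1)`. -/
def radialMeasure (ε : ℝ) : Measure ℝ :=
  (volume.restrict (Ioo (1 / 2 : ℝ) 1)).withDensity fun t => ENNReal.ofReal ((1 - t) ^ (ε - 1))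

theorem lintegral_one_sub_rpow_lt_top_real {ε : ℝ} (hε : 0 < ε) :
    ∫⁻ t in Ioo (0 : ℝ) 1, ENNReal.ofReal ((1 - t) ^ (ε - 1)) < ∞ := by
  have h1 : IntervalIntegrable (fun t : ℝ => (1 - t) ^ (ε - 1)) volume (1 - 0) (1 - 1) :=
    (intervalIntegral.intervalIntegrable_rpow' (by linarith : -1 < ε - 1)).comp_sub_left 1
  have h2 : IntegrableOn (fun t : ℝ => (1 - t) ^ (ε - 1)) (Ioo 0 1) := by
    have := h1.symm
    rw [sub_zero, sub_self, intervalIntegrable_iff_integrableOn_Ioo_of_le zero_le_one] at this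
    exact this
  exact h2.lintegral_lt_top

theorem lintegral_rpow_lt_top_real {ε : ℝ} (hε : 0 < ε) :
    ∫⁻ t in Ioo (0 : ℝ) 1, ENNReal.ofReal (t ^ (ε - 1)) < ∞ := by
  have h1 : IntervalIntegrable (fun t : ℝ => t ^ (ε - 1)) volume 0 1 :=
    intervalIntegral.intervalIntegrable_rpow' (by linarith : -1 < ε - 1)
  rw [intervalIntegrable_iff_integrableOn_Ioo_of_le zero_le_one] at h1
  exact h1.lintegral_lt_top

theorem radialMeasure_univ_lt_top {ε : ℝ} (hε : 0 < ε) : radialMeasure ε univ < ∞ := by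
  rw [radialMeasure, withDensity_apply _ MeasurableSet.univ, Measure.restrict_univ]
  exact (lintegral_mono_set (Ioo_subset_Ioo_left (by norm_num))).trans_lt
    (lintegral_one_sub_rpow_lt_top_real hε)

instance (ε : ℝ) : SFinite (radialMeasure ε) := by
  unfold radialMeasure
  infer_instance

/-- The averages of `f` over its dilations are bounded from `L^p(dA_μ)` to `L^p(dA_{μ + ε p})`, with
a factor `(1 - |z|) ^ (-ε)` to spare. -/
theorem lintegral_radial_average_le {p μ ε : ℝ} (hp : 1 < p) (hμ : 0 < μ)
    {f : ℂ → ℂ} (hf : Measurable f) :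
    ∫⁻ z, (ENNReal.ofReal ((1 - ‖z‖) ^ (-ε)) *
        ∫⁻ t, ‖f (t * z)‖ₑ ∂(radialMeasure ε)) ^ p ∂(bergmanMeasure (μ + ε * p)) ≤
      4 * radialMeasure ε univ ^ p * ∫⁻ z, ‖f z‖ₑ ^ p ∂(bergmanMeasure μ) := by
  have hp0 : 0 < p := one_pos.trans hp
  set S := radialMeasure ε univ with hS
  have hm : Measurable fun q : ℂ × ℝ => ‖f (q.2 * q.1)‖ₑ :=
    (hf.comp (by fun_prop)).enorm
  calc _ = ∫⁻ z, (∫⁻ t, ‖f (t * z)‖ₑ ∂(radialMeasure ε)) ^ p ∂(bergmanMeasure μ) := by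
        rw [lintegral_bergmanMeasure, lintegral_bergmanMeasure]
        refine setLIntegral_congr_fun isOpen_ball.measurableSet fun z hz => ?_
        have hz : 0 < 1 - ‖z‖ := by
          have : ‖z‖ < 1 := by simpa using hz
          linarith
        rw [ENNReal.mul_rpow_of_nonneg _ _ hp0.le, ← mul_assoc, ENNReal.ofReal_rpow_of_nonneg
          (by positivity) hp0.le, ← ENNReal.ofReal_mul (by positivity)]
        congr 2
        rw [← Real.rpow_mul hz.le, div_mul_eq_mul_div, ← Real.rpow_add hz]
        congr 2
        ring
    _ ≤ ∫⁻ z, (∫⁻ t, ‖f (t * z)‖ₑ ^ p ∂(radialMeasure ε)) * S ^ (p - 1) ∂(bergmanMeasure μ) := by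
        refine lintegral_mono fun z => lintegral_rpow_le_of_one_lt _ hp ?_
        exact (hf.comp (by fun_prop)).enorm
    _ = (∫⁻ t, ∫⁻ z, ‖f (t * z)‖ₑ ^ p ∂(bergmanMeasure μ) ∂(radialMeasure ε)) * S ^ (p - 1) := by
        rw [lintegral_mul_const, lintegral_lintegral_swap]
        · exact (hm.pow_const p).aemeasurable
        · exact (hm.pow_const p).lintegral_prod_right'
    _ ≤ (∫⁻ _, 4 * ∫⁻ z, ‖f z‖ₑ ^ p ∂(bergmanMeasure μ) ∂(radialMeasure ε)) * S ^ (p - 1) := by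
        refine mul_le_mul_left (lintegral_mono_ae ?_) _
        have h1 : ∀ᵐ t ∂(volume.restrict (Ioo (1 / 2 : ℝ) 1)), t ∈ Ioo (1 / 2 : ℝ) 1 :=
          ae_restrict_mem measurableSet_Ioo
        filter_upwards [(withDensity_absolutelyContinuous _ _).ae_le h1] with t ht
        exact lintegral_dilation_le hμ ht.1.le ht.2.le (F := fun z => ‖f z‖ₑ ^ p)
          (hf.enorm.pow_const p)
    _ = _ := by
        rw [lintegral_const, ← hS]
        have h4 : S * S ^ (p - 1) = S ^ p := by
          have h5 := ENNReal.rpow_add_of_nonneg (x := S) 1 (p - 1) zero_le_one (by linarith)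
          rw [add_sub_cancel, ENNReal.rpow_one] at h5
          exact h5.symm
        rw [← h4]
        ring

/-! ### Boundedness of the resolvent kernel -/

theorem norm_cpow_le_exp_mul {z w : ℂ} (hz : z ≠ 0) {M : ℝ} (hw : |w.im| ≤ M) :
    ‖z ^ w‖ ≤ Real.exp (Real.pi * M) * ‖z‖ ^ w.re := by
  rw [Complex.norm_cpow_of_ne_zero hz, div_eq_inv_mul, ← Real.exp_neg]
  refine mul_le_mul_of_nonneg_right (Real.exp_le_exp.2 ?_) (by positivity)
  calc -(z.arg * w.im) ≤ |z.arg * w.im| := neg_le_abs _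
    _ = |z.arg| * |w.im| := abs_mul _ _
    _ ≤ Real.pi * M := mul_le_mul (Complex.abs_arg_le_pi z) hw (abs_nonneg _) Real.pi_pos.le

/-- The product `x ^ (-a) y ^ (a - 1)` as a function of the exponent `a`, for `x ≤ 2 y`. -/
theorem rpow_neg_mul_rpow_sub_one_le {x y a A M : ℝ} (hx : 0 < x) (hy : 0 < y) (hxy : x ≤ 2 * y)
    (haA : a ≤ A) (ha : -M ≤ a) :
    x ^ (-a) * y ^ (a - 1) ≤ 2 ^ (A + M) * ((y / x) ^ A * y⁻¹) := by
  have h1 : 1 ≤ 2 * (y / x) := by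
    rw [← mul_div_assoc, one_le_div hx]
    exact hxy
  have h2 : (2 * (y / x)) ^ a ≤ (2 * (y / x)) ^ A := Real.rpow_le_rpow_of_exponent_le h1 haA
  rw [Real.mul_rpow (by norm_num) (by positivity), Real.mul_rpow (by norm_num) (by positivity)]
    at h2
  have h3 : x ^ (-a) * y ^ (a - 1) = (y / x) ^ a * y⁻¹ := by
    rw [Real.rpow_neg hx.le, Real.rpow_sub_one hy.ne', Real.div_rpow hy.le hx.le]
    field_simp
  rw [h3, ← mul_assoc]
  refine mul_le_mul_of_nonneg_right ?_ (by positivity)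
  have h4 : (y / x) ^ a ≤ 2 ^ (-a) * (2 ^ A * (y / x) ^ A) := by
    have := mul_le_mul_of_nonneg_left h2 (show (0 : ℝ) ≤ 2 ^ (-a) by positivity)
    rwa [← mul_assoc, ← Real.rpow_add two_pos, neg_add_cancel, Real.rpow_zero, one_mul] at this
  refine h4.trans ?_
  rw [← mul_assoc, ← Real.rpow_add two_pos]
  refine mul_le_mul_of_nonneg_right ?_ (by positivity)
  exact Real.rpow_le_rpow_of_exponent_le one_le_two (by linarith)

/-- The size of the kernel for `t ≤ 1/2`. -/
theorem kernel_le_of_le_half {x y t a A ε B H M n : ℝ} (hx : 0 < x) (ht : 0 < t) (ht2 : t ≤ 1 / 2)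
    (hyt : 1 - t ≤ y) (hy2 : y ≤ 2) (hA : 0 ≤ A) (hM : 0 ≤ M) (hB : 0 ≤ B) (hH : 0 ≤ H)
    (hHB : H ≤ t ^ n * B) (ha : a ≤ n + 1 - ε) :
    (y / x) ^ A * y⁻¹ * (t ^ (-a) * H) ≤
      2 ^ (M + A + 1) * (B * x ^ (-A) * (t ^ (ε - 1) + (1 - t) ^ (ε - 1))) := by
  have hy : 0 < y := by linarith
  have h2M : (1 : ℝ) ≤ 2 ^ M := Real.one_le_rpow one_le_two hM
  have h1 : (y / x) ^ A ≤ 2 ^ A * x ^ (-A) := by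
    rw [Real.div_rpow hy.le hx.le, Real.rpow_neg hx.le, ← div_eq_mul_inv]
    gcongr
  have h2 : y⁻¹ ≤ 2 := by
    rw [inv_le_comm₀ hy two_pos]
    linarith
  have h4 : t ^ (-a) * H ≤ t ^ (ε - 1) * B := by
    calc t ^ (-a) * H ≤ t ^ (-a) * (t ^ n * B) := by gcongr
      _ = t ^ (-a + n) * B := by rw [Real.rpow_add ht]; ring
      _ ≤ t ^ (ε - 1) * B := by
        refine mul_le_mul_of_nonneg_right ?_ hB
        exact Real.rpow_le_rpow_of_exponent_ge ht (by linarith) (by linarith)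
  calc (y / x) ^ A * y⁻¹ * (t ^ (-a) * H)
      ≤ (2 ^ A * x ^ (-A)) * 2 * (t ^ (ε - 1) * B) := by gcongr
    _ = 1 * (2 ^ A * 2 * (B * x ^ (-A) * t ^ (ε - 1))) := by ring
    _ ≤ 2 ^ M * (2 ^ A * 2 * (B * x ^ (-A) * (t ^ (ε - 1) + (1 - t) ^ (ε - 1)))) := by
      have : 0 ≤ (1 - t) ^ (ε - 1) := Real.rpow_nonneg (by linarith) _
      have h5 : 0 ≤ t ^ (ε - 1) := by positivity
      refine mul_le_mul h2M ?_ (by positivity) (by positivity)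
      gcongr
      linarith
    _ = _ := by
      rw [Real.rpow_add two_pos, Real.rpow_add two_pos, Real.rpow_one]
      ring

/-- The size of the kernel for `t ≥ 1/2`, where `d` stands for `1 - |z|`. -/
theorem kernel_le_of_half_le {x y d t a b ε B H M : ℝ} (hx : 0 < x) (hd : 0 < d)
    (ht : t < 1) (ht2 : 1 / 2 ≤ t) (hyt : 1 - t ≤ y) (hyd : d ≤ y) (hyx : y ≤ x + (1 - t))
    (hb : 0 ≤ b) (hε : 0 < ε) (hε1 : ε ≤ 1) (hM : 0 ≤ M) (hB : 0 ≤ B) (hH : 0 ≤ H)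
    (hHB : H ≤ B * (1 - t) ^ (-b)) (ha : a ≤ M) :
    (y / x) ^ (b + ε) * y⁻¹ * (t ^ (-a) * H) ≤
      2 ^ (M + (b + ε) + 1) * (B * x ^ (-(b + ε)) * (t ^ (ε - 1) + (1 - t) ^ (ε - 1)) +
        (1 - t) ^ (ε - 1) * (d ^ (-ε) * H)) := by
  obtain ⟨s, hs⟩ : ∃ s, s = 1 - t := ⟨_, rfl⟩
  obtain ⟨A, hA⟩ : ∃ A, A = b + ε := ⟨_, rfl⟩
  rw [← hs] at hyt hyx hHB ⊢
  rw [← hA]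
  have hs0 : 0 < s := by linarith
  have ht0 : 0 < t := by linarith
  have hy : 0 < y := by linarith
  have hA0 : 0 ≤ A := by linarith
  have h1 : (y / x) ^ A ≤ 2 ^ A * (1 + s ^ A * x ^ (-A)) := by
    have hratio : y / x ≤ 1 + s / x := by
      rw [div_le_iff₀ hx, add_mul, div_mul_cancel₀ _ hx.ne']
      linarith
    have h2 : y / x ≤ 2 * max 1 (s / x) := by
      linarith [le_max_left 1 (s / x), le_max_right 1 (s / x)]
    have h3 : (max 1 (s / x)) ^ A ≤ 1 + s ^ A * x ^ (-A) := by
      have h4 : 0 ≤ s ^ A * x ^ (-A) := by positivity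
      rcases max_choice 1 (s / x) with h | h <;> rw [h]
      · rw [Real.one_rpow]
        linarith
      · rw [Real.div_rpow hs0.le hx.le, Real.rpow_neg hx.le, ← div_eq_mul_inv]
        linarith
    calc (y / x) ^ A ≤ (2 * max 1 (s / x)) ^ A := Real.rpow_le_rpow (by positivity) h2 hA0
      _ = 2 ^ A * (max 1 (s / x)) ^ A := Real.mul_rpow (by norm_num) (by positivity)
      _ ≤ _ := mul_le_mul_of_nonneg_left h3 (by positivity)
  have h2 : t ^ (-a) ≤ 2 ^ M := by
    calc t ^ (-a) ≤ t ^ (-M) :=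
          Real.rpow_le_rpow_of_exponent_ge ht0 ht.le (neg_le_neg ha)
      _ = (t⁻¹) ^ M := by rw [Real.rpow_neg ht0.le, Real.inv_rpow ht0.le]
      _ ≤ 2 ^ M := by
        refine Real.rpow_le_rpow (by positivity) ?_ hM
        rw [inv_le_comm₀ ht0 two_pos]
        linarith
  have h3 : y⁻¹ ≤ s ^ (ε - 1) * d ^ (-ε) := by
    have h4 : s ^ (1 - ε) * d ^ ε ≤ y := by
      calc s ^ (1 - ε) * d ^ ε ≤ y ^ (1 - ε) * y ^ ε :=
            mul_le_mul (Real.rpow_le_rpow hs0.le hyt (by linarith))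
              (Real.rpow_le_rpow hd.le hyd hε.le) (by positivity) (by positivity)
        _ = y := by rw [← Real.rpow_add hy]; simp
    have h5 := inv_anti₀ (by positivity) h4
    rwa [mul_inv, ← Real.rpow_neg hs0.le, ← Real.rpow_neg hd.le, neg_sub] at h5
  have h4 : s ^ A * x ^ (-A) * y⁻¹ * H ≤ B * x ^ (-A) * s ^ (ε - 1) := by
    have h5 : y⁻¹ ≤ s⁻¹ := inv_anti₀ hs0 hyt
    calc s ^ A * x ^ (-A) * y⁻¹ * H
        ≤ s ^ A * x ^ (-A) * s⁻¹ * (B * s ^ (-b)) := by gcongr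
      _ = B * x ^ (-A) * (s ^ A * s⁻¹ * s ^ (-b)) := by ring
      _ = B * x ^ (-A) * s ^ (ε - 1) := by
        congr 1
        rw [← Real.rpow_neg_one s, ← Real.rpow_add hs0, ← Real.rpow_add hs0, hA]
        congr 1
        ring
  have h5 : y⁻¹ * H ≤ s ^ (ε - 1) * (d ^ (-ε) * H) := by
    rw [← mul_assoc]
    exact mul_le_mul_of_nonneg_right h3 hH
  calc (y / x) ^ A * y⁻¹ * (t ^ (-a) * H)
      ≤ 2 ^ A * (1 + s ^ A * x ^ (-A)) * y⁻¹ * (2 ^ M * H) := by gcongr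
    _ = 2 ^ M * 2 ^ A * (y⁻¹ * H + s ^ A * x ^ (-A) * y⁻¹ * H) := by ring
    _ ≤ 2 ^ M * 2 ^ A * (2 * (B * x ^ (-A) * (t ^ (ε - 1) + s ^ (ε - 1)) +
          s ^ (ε - 1) * (d ^ (-ε) * H))) := by
      refine mul_le_mul_of_nonneg_left ?_ (by positivity)
      have h7 : 0 ≤ B * x ^ (-A) * s ^ (ε - 1) := by positivity
      have h8 : 0 ≤ B * x ^ (-A) * t ^ (ε - 1) := by positivity
      have h9 : 0 ≤ s ^ (ε - 1) * (d ^ (-ε) * H) := by positivity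
      rw [mul_add (B * x ^ (-A))]
      linarith
    _ = _ := by
      rw [Real.rpow_add two_pos, Real.rpow_add two_pos, Real.rpow_one]
      ring

/-- A bound for the integrand of the resolvent kernel that is uniform in `w`. With `s = 1 - t` it
uses `|1 - z| / 2 ≤ |1 - tz| ≤ |1 - z| + s` and `max (s, 1 - |z|) ≤ |1 - tz|`; `B` bounds
the factor `k` near the origin and the growth of `z ^ N k` at the boundary. -/
theorem exists_integrand_bound (M : ℝ) {b ε : ℝ} (hb : 0 ≤ b) (hε : 0 < ε) (hε1 : ε ≤ 1) (N : ℕ) :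
    ∃ C : ℝ, 0 ≤ C ∧ ∀ w : ℂ, ‖w‖ ≤ M → w.re ≤ b + ε → w.re ≤ N + 1 - ε →
      ∀ (B : ℝ) (k : ℂ → ℂ), 0 ≤ B → (∀ ζ : ℂ, ‖ζ‖ ≤ 1 / 2 → ‖k ζ‖ ≤ B) →
      (∀ ζ : ℂ, ‖ζ‖ < 1 → ‖ζ ^ N * k ζ‖ ≤ B * (1 - ‖ζ‖) ^ (-b)) →
      ∀ z : ℂ, ‖z‖ < 1 → ∀ t ∈ Ioo (0 : ℝ) 1,
      ‖(1 - z) ^ (-w) * z ^ N * ((t : ℂ) ^ ((N : ℂ) - w) * ((1 - t * z) ^ (w - 1) * k (t * z)))‖ ≤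
        C * (B * ‖1 - z‖ ^ (-(b + ε)) * (t ^ (ε - 1) + (1 - t) ^ (ε - 1)) +
          (Ioo (1 / 2 : ℝ) 1).indicator (fun t => (1 - t) ^ (ε - 1) *
            ((1 - ‖z‖) ^ (-ε) * ‖(t * z) ^ N * k (t * z)‖)) t) := by
  set E := Real.exp (Real.pi * M) with hE
  set A := b + ε with hA
  have hA0 : 0 < A := by positivity
  refine ⟨E ^ 2 * 2 ^ (A + M) * 2 ^ (M + A + 1), by positivity, ?_⟩
  intro w hwM hwA hwN B k hB hk1 hk2 z hz t ht
  have ht0 : 0 < t := ht.1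
  have ht1 : 0 < 1 - t := by linarith [ht.2]
  have hM0 : 0 ≤ M := (norm_nonneg w).trans hwM
  set a := w.re with ha
  have haM : |a| ≤ M := (Complex.abs_re_le_norm w).trans hwM
  have himM : |w.im| ≤ M := (Complex.abs_im_le_norm w).trans hwM
  have hntz : ‖(t : ℂ) * z‖ = t * ‖z‖ := by
    rw [norm_mul, Complex.norm_real, Real.norm_of_nonneg ht0.le]
  have htz : ‖(t : ℂ) * z‖ < 1 := by
    rw [hntz]
    nlinarith [norm_nonneg z]
  set x := ‖1 - z‖ with hx
  set y := ‖1 - (t : ℂ) * z‖ with hy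
  have hx0 : 0 < x := norm_one_sub_pos hz
  have hy0 : 0 < y := norm_one_sub_pos htz
  have hyt : 1 - t * ‖z‖ ≤ y := by
    rw [← hntz]
    exact one_sub_norm_le _
  have hys : 1 - t ≤ y := by nlinarith [norm_nonneg z]
  have hyz : 1 - ‖z‖ ≤ y := by nlinarith [norm_nonneg z]
  have hdiff : ‖(1 - t : ℂ) * z‖ ≤ 1 - t := by
    rw [norm_mul]
    have : ‖(1 - t : ℂ)‖ = 1 - t := by
      rw [← Complex.ofReal_one, ← Complex.ofReal_sub, Complex.norm_real,
        Real.norm_of_nonneg ht1.le]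
    rw [this]
    nlinarith [norm_nonneg z]
  have hyx : y ≤ x + (1 - t) := by
    have h1 : (1 : ℂ) - t * z = (1 - z) + (1 - t) * z := by ring
    rw [hy, h1]
    exact (norm_add_le _ _).trans (by gcongr)
  have hxy : x ≤ 2 * y := by
    have h1 : (1 : ℂ) - z = (1 - t * z) - (1 - t) * z := by ring
    have h2 : x ≤ y + ‖(1 - t : ℂ) * z‖ := by
      rw [hx, h1]
      exact norm_sub_le _ _
    linarith
  have hy2 : y ≤ 2 := by
    have := norm_sub_le (1 : ℂ) (t * z)
    rw [norm_one] at this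
    linarith
  set H := ‖((t : ℂ) * z) ^ N * k (t * z)‖ with hH
  have hH0 : 0 ≤ H := norm_nonneg _
  -- reduce to a bound for the absolute values of the powers
  have hpow : ‖(1 - z) ^ (-w) * z ^ N *
      ((t : ℂ) ^ ((N : ℂ) - w) * ((1 - t * z) ^ (w - 1) * k (t * z)))‖ ≤
      E ^ 2 * (x ^ (-a) * y ^ (a - 1)) * (t ^ (-a) * H) := by
    have h1 : ‖(1 - z) ^ (-w)‖ ≤ E * x ^ (-a) := by
      simpa using norm_cpow_le_exp_mul (one_sub_ne_zero_of_norm_lt hz) (w := -w) (M := M)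
        (by simpa using himM)
    have h2 : ‖(1 - (t : ℂ) * z) ^ (w - 1)‖ ≤ E * y ^ (a - 1) := by
      simpa using norm_cpow_le_exp_mul (one_sub_ne_zero_of_norm_lt htz) (w := w - 1) (M := M)
        (by simpa using himM)
    have h3 : ‖(t : ℂ) ^ ((N : ℂ) - w)‖ = t ^ (-a) * t ^ N := by
      rw [Complex.norm_cpow_eq_rpow_re_of_pos ht0, ← Real.rpow_natCast t N, ← Real.rpow_add ht0]
      simp only [Complex.sub_re, Complex.natCast_re]
      congr 1
      ring
    have h4 : H = t ^ N * ‖z‖ ^ N * ‖k (t * z)‖ := by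
      rw [hH, norm_mul, norm_pow, hntz, mul_pow]
    calc ‖(1 - z) ^ (-w) * z ^ N *
          ((t : ℂ) ^ ((N : ℂ) - w) * ((1 - t * z) ^ (w - 1) * k (t * z)))‖
        = ‖(1 - z) ^ (-w)‖ * ‖(1 - (t : ℂ) * z) ^ (w - 1)‖ * (t ^ (-a) * H) := by
          rw [norm_mul, norm_mul, norm_mul, norm_mul, norm_pow, h3, h4]
          ring
      _ ≤ (E * x ^ (-a)) * (E * y ^ (a - 1)) * (t ^ (-a) * H) := by gcongr
      _ = _ := by ring
  have hexp := rpow_neg_mul_rpow_sub_one_le hx0 hy0 hxy hwA (neg_le_of_abs_le haM)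
  -- the remaining product, in the two ranges of `t`
  have hsplit : (y / x) ^ A * y⁻¹ * (t ^ (-a) * H) ≤
      2 ^ (M + A + 1) * (B * x ^ (-A) * (t ^ (ε - 1) + (1 - t) ^ (ε - 1)) +
          (Ioo (1 / 2 : ℝ) 1).indicator (fun t => (1 - t) ^ (ε - 1) *
            ((1 - ‖z‖) ^ (-ε) * ‖(t * z) ^ N * k (t * z)‖)) t) := by
    rcases le_or_gt t (1 / 2) with ht2 | ht2
    · rw [indicator_of_notMem (fun h => absurd h.1 (not_lt.2 ht2)), add_zero]
      refine kernel_le_of_le_half (n := N) hx0 ht0 ht2 hys hy2 hA0.le hM0 hB hH0 ?_ hwN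
      rw [Real.rpow_natCast, hH, norm_mul, norm_pow, hntz]
      refine mul_le_mul ?_ (hk1 _ ?_) (norm_nonneg _) (by positivity)
      · exact pow_le_pow_left₀ (by positivity) (by nlinarith) N
      · rw [hntz]
        nlinarith [norm_nonneg z]
    · rw [indicator_of_mem (show t ∈ Ioo (1 / 2 : ℝ) 1 from ⟨ht2, ht.2⟩)]
      refine kernel_le_of_half_le hx0 (by linarith) ht.2 ht2.le hys hyz hyx hb hε hε1 hM0 hB hH0 ?_
        (le_of_abs_le haM)
      refine (hk2 _ htz).trans (mul_le_mul_of_nonneg_left ?_ hB)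
      refine Real.rpow_le_rpow_of_nonpos ht1 ?_ (by linarith)
      rw [hntz]
      nlinarith [norm_nonneg z]
  calc _ ≤ E ^ 2 * (x ^ (-a) * y ^ (a - 1)) * (t ^ (-a) * H) := hpow
    _ ≤ E ^ 2 * (2 ^ (A + M) * ((y / x) ^ A * y⁻¹)) * (t ^ (-a) * H) := by gcongr
    _ = E ^ 2 * 2 ^ (A + M) * ((y / x) ^ A * y⁻¹ * (t ^ (-a) * H)) := by ring
    _ ≤ _ := by
      rw [mul_assoc (E ^ 2 * 2 ^ (A + M))]
      exact mul_le_mul_of_nonneg_left hsplit (by positivity)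

theorem enorm_resolventKernel_le {w : ℂ} {N : ℕ} {k : ℂ → ℂ} {z : ℂ} (hz : ‖z‖ < 1) :
    ‖resolventKernel w N k z‖ₑ ≤ ∫⁻ t in Ioo (0 : ℝ) 1,
      ‖(1 - z) ^ (-w) * z ^ N *
        ((t : ℂ) ^ ((N : ℂ) - w) * ((1 - t * z) ^ (w - 1) * k (t * z)))‖ₑ := by
  rw [resolventKernel, indicator_of_mem (by simpa using hz),
    ← intervalIntegral.integral_const_mul, intervalIntegral.integral_of_le zero_le_one,
    integral_Ioc_eq_integral_Ioo]
  exact enorm_integral_le_lintegral_enorm _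

/-- The resolvent kernel maps `A^p_μ` into `A^p_γ`, `γ > μ`, uniformly in the parameter `w`, on
functions with a zero of order `N` at the origin. -/
theorem exists_eLpNorm_resolventKernel_le {p μ ε : ℝ} (hp : 1 < p) (hμ : 0 < μ) (hε : 0 < ε)
    (hε1 : ε ≤ 1) (M : ℝ) (N : ℕ) :
    ∃ K : ℝ, 0 ≤ K ∧ ∀ w : ℂ, ‖w‖ ≤ M → w.re ≤ (2 + μ) / p + ε → w.re ≤ N + 1 - ε →
      ∀ h ∈ holoDisc, ∀ (k : ℂ → ℂ) (B : ℝ), 0 ≤ B → (∀ z : ℂ, ‖z‖ < 1 → h z = z ^ N * k z) →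
      (∀ ζ : ℂ, ‖ζ‖ ≤ 1 / 2 → ‖k ζ‖ ≤ B) →
      eLpNorm h (ENNReal.ofReal p) (bergmanMeasure μ) ≤ ENNReal.ofReal B →
      eLpNorm (resolventKernel w N k) (ENNReal.ofReal p) (bergmanMeasure (μ + 2 * ε * p)) ≤
        ENNReal.ofReal K * ENNReal.ofReal B := by
  have hp0 : 0 < p := one_pos.trans hp
  have hb : 0 ≤ (2 + μ) / p := by positivity
  obtain ⟨Kg, hKg, hgrowth⟩ := exists_growth_bound hp hμ
  obtain ⟨C, hC, hint⟩ := exists_integrand_bound M hb hε hε1 N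
  set A := (2 + μ) / p + ε with hA
  set γ := μ + 2 * ε * p with hγ
  set D : ℝ := max 1 Kg.toReal with hD
  have hD0 : 0 ≤ D := by positivity
  set S₀ := ∫⁻ t in Ioo (0 : ℝ) 1, ENNReal.ofReal (t ^ (ε - 1) + (1 - t) ^ (ε - 1)) with hS₀
  have hS₀t : S₀ ≠ ∞ := by
    refine ne_top_of_le_ne_top ?_ (lintegral_mono fun t => ENNReal.ofReal_add_le)
    rw [lintegral_add_left (by fun_prop)]
    exact ENNReal.add_ne_top.2
      ⟨(lintegral_rpow_lt_top_real hε).ne, (lintegral_one_sub_rpow_lt_top_real hε).ne⟩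
  set L := ∫⁻ z, ENNReal.ofReal (‖1 - z‖ ^ (-A)) ^ p ∂(bergmanMeasure γ) with hL
  have hLt : L ≠ ∞ := by
    refine (lintegral_one_sub_rpow_lt_top hp0 (by positivity) ?_).ne
    have h1 : (2 + γ) / p = (2 + μ) / p + 2 * ε := by
      rw [hγ]
      field_simp
      ring
    rw [hA, h1]
    linarith
  set S := radialMeasure ε univ with hS
  have hSt : S ≠ ∞ := (radialMeasure_univ_lt_top hε).ne
  set K₀ : ℝ≥0∞ := ENNReal.ofReal C ^ p * (2 ^ (p - 1) *
    ((ENNReal.ofReal D * S₀) ^ p * L + 4 * S ^ p)) with hK₀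
  have hK₀t : K₀ ≠ ∞ := by
    have h1 : ∀ x : ℝ≥0∞, x ≠ ∞ → x ^ p ≠ ∞ := fun x hx => ENNReal.rpow_ne_top_of_nonneg hp0.le hx
    refine ENNReal.mul_ne_top (h1 _ ENNReal.ofReal_ne_top) (ENNReal.mul_ne_top ?_ ?_)
    · exact ENNReal.rpow_ne_top_of_nonneg (by linarith) (by simp)
    · exact ENNReal.add_ne_top.2 ⟨ENNReal.mul_ne_top (h1 _ (ENNReal.mul_ne_top
        ENNReal.ofReal_ne_top hS₀t)) hLt, ENNReal.mul_ne_top (by simp) (h1 _ hSt)⟩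
  refine ⟨(K₀ ^ (1 / p)).toReal, ENNReal.toReal_nonneg, ?_⟩
  intro w hwM hwA hwN h hh k B hB hhk hk hhB
  rw [ENNReal.ofReal_toReal (ENNReal.rpow_ne_top_of_nonneg (by positivity) hK₀t)]
  have hhm := holoDisc.measurable hh
  have hDB : ∀ x, x ≤ B → x ≤ D * B := fun x hx =>
    hx.trans (le_mul_of_one_le_left hB (le_max_left _ _))
  have hk2 : ∀ ζ : ℂ, ‖ζ‖ < 1 → ‖ζ ^ N * k ζ‖ ≤ D * B * (1 - ‖ζ‖) ^ (-((2 + μ) / p)) := by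
    intro ζ hζ
    have h0 : 0 ≤ (1 - ‖ζ‖) ^ (-((2 + μ) / p)) := Real.rpow_nonneg (by linarith) _
    rw [← hhk ζ hζ, ← ENNReal.ofReal_le_ofReal_iff (by positivity), ofReal_norm,
      ENNReal.ofReal_mul (by positivity), ENNReal.ofReal_mul hD0]
    refine (hgrowth h hh ζ hζ).trans ?_
    gcongr
    rw [← ENNReal.ofReal_toReal hKg]
    exact ENNReal.ofReal_le_ofReal (le_max_right _ _)
  set W : ℂ → ℝ≥0∞ := fun z => ENNReal.ofReal ((1 - ‖z‖) ^ (-ε)) *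
    ∫⁻ t, ‖h (t * z)‖ₑ ∂(radialMeasure ε) with hW
  have hpt : ∀ z : ℂ, ‖z‖ < 1 → ‖resolventKernel w N k z‖ₑ ≤ ENNReal.ofReal C *
      (ENNReal.ofReal D * S₀ * ENNReal.ofReal B * ENNReal.ofReal (‖1 - z‖ ^ (-A)) + W z) := by
    intro z hz
    have hz0 : 0 ≤ (1 - ‖z‖) ^ (-ε) := Real.rpow_nonneg (by linarith) _
    refine (enorm_resolventKernel_le hz).trans ?_
    calc _ ≤ ∫⁻ t in Ioo (0 : ℝ) 1, ENNReal.ofReal C * (ENNReal.ofReal (D * B * ‖1 - z‖ ^ (-A)) *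
          ENNReal.ofReal (t ^ (ε - 1) + (1 - t) ^ (ε - 1)) +
          (Ioo (1 / 2 : ℝ) 1).indicator (fun t => ENNReal.ofReal ((1 - t) ^ (ε - 1)) *
            (ENNReal.ofReal ((1 - ‖z‖) ^ (-ε)) * ‖h (t * z)‖ₑ)) t) := by
          refine setLIntegral_mono' measurableSet_Ioo fun t ht => ?_
          rw [← ofReal_norm]
          refine (ENNReal.ofReal_le_ofReal (hint w hwM hwA hwN (D * B) k (by positivity)
            (fun ζ hζ => hDB _ (hk ζ hζ)) hk2 z hz t ht)).trans ?_
          rw [ENNReal.ofReal_mul hC]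
          refine mul_le_mul_right (ENNReal.ofReal_add_le.trans ?_) _
          have ht' : 0 ≤ t ^ (ε - 1) + (1 - t) ^ (ε - 1) :=
            add_nonneg (Real.rpow_nonneg ht.1.le _) (Real.rpow_nonneg (by linarith [ht.2]) _)
          rw [← ENNReal.ofReal_mul (by positivity)]
          refine add_le_add_right ?_ _
          by_cases ht2 : t ∈ Ioo (1 / 2 : ℝ) 1
          · have htz : ‖(t : ℂ) * z‖ < 1 := by
              rw [norm_mul, Complex.norm_real, Real.norm_of_nonneg ht.1.le]
              nlinarith [norm_nonneg z, ht.2, ht.1]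
            rw [indicator_of_mem ht2, indicator_of_mem ht2, ← hhk _ htz,
              ENNReal.ofReal_mul (Real.rpow_nonneg (by linarith [ht.2]) _),
              ENNReal.ofReal_mul hz0, ofReal_norm]
          · rw [indicator_of_notMem ht2, indicator_of_notMem ht2, ENNReal.ofReal_zero]
      _ = ENNReal.ofReal C * (ENNReal.ofReal (D * B * ‖1 - z‖ ^ (-A)) * S₀ +
            ∫⁻ t in Ioo (0 : ℝ) 1, (Ioo (1 / 2 : ℝ) 1).indicator
              (fun t => ENNReal.ofReal ((1 - t) ^ (ε - 1)) *
            (ENNReal.ofReal ((1 - ‖z‖) ^ (-ε)) * ‖h (t * z)‖ₑ)) t) := by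
          rw [lintegral_const_mul' _ _ ENNReal.ofReal_ne_top, lintegral_add_left (by fun_prop),
            lintegral_const_mul' _ _ ENNReal.ofReal_ne_top]
      _ = _ := by
          congr 2
          · rw [ENNReal.ofReal_mul (by positivity), ENNReal.ofReal_mul hD0]
            ring
          · rw [lintegral_indicator measurableSet_Ioo, Measure.restrict_restrict measurableSet_Ioo,
              inter_eq_self_of_subset_left (Ioo_subset_Ioo_left (by norm_num)), hW]
            simp only
            rw [radialMeasure, lintegral_withDensity_eq_lintegral_mul_non_measurable _
              (by fun_prop) (Eventually.of_forall fun _ => ENNReal.ofReal_lt_top),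
              ← lintegral_const_mul' _ _ ENNReal.ofReal_ne_top]
            refine lintegral_congr fun t => ?_
            simp only [Pi.mul_apply]
            ring
  have hWint : ∫⁻ z, W z ^ p ∂(bergmanMeasure γ) ≤ 4 * S ^ p * ENNReal.ofReal B ^ p := by
    have h1 : ∫⁻ z, ‖h z‖ₑ ^ p ∂(bergmanMeasure μ) ≤ ENNReal.ofReal B ^ p := by
      rw [eLpNorm_eq_lintegral_rpow_enorm_toReal (by simpa using hp0) (by simp),
        ENNReal.toReal_ofReal hp0.le] at hhB
      have := ENNReal.rpow_le_rpow hhB hp0.le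
      rwa [← ENNReal.rpow_mul, one_div_mul_cancel hp0.ne', ENNReal.rpow_one] at this
    calc _ ≤ ∫⁻ z, W z ^ p ∂(bergmanMeasure (μ + ε * p)) :=
          lintegral_mono' (bergmanMeasure_mono (by rw [hγ]; nlinarith)) le_rfl
      _ ≤ 4 * S ^ p * ∫⁻ z, ‖h z‖ₑ ^ p ∂(bergmanMeasure μ) :=
          lintegral_radial_average_le hp hμ hhm
      _ ≤ _ := mul_le_mul_right h1 _
  have hfinal : ∫⁻ z, ‖resolventKernel w N k z‖ₑ ^ p ∂(bergmanMeasure γ) ≤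
      K₀ * ENNReal.ofReal B ^ p := by
    have hc1 : ENNReal.ofReal C ^ p ≠ ∞ :=
      ENNReal.rpow_ne_top_of_nonneg hp0.le ENNReal.ofReal_ne_top
    have hc2 : (2 : ℝ≥0∞) ^ (p - 1) ≠ ∞ := ENNReal.rpow_ne_top_of_nonneg (by linarith) (by simp)
    have hc3 : (ENNReal.ofReal D * S₀ * ENNReal.ofReal B) ^ p ≠ ∞ :=
      ENNReal.rpow_ne_top_of_nonneg hp0.le (ENNReal.mul_ne_top (ENNReal.mul_ne_top
        ENNReal.ofReal_ne_top hS₀t) ENNReal.ofReal_ne_top)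
    calc _ ≤ ∫⁻ z, ENNReal.ofReal C ^ p * (2 ^ (p - 1) *
          ((ENNReal.ofReal D * S₀ * ENNReal.ofReal B) ^ p * ENNReal.ofReal (‖1 - z‖ ^ (-A)) ^ p +
            W z ^ p)) ∂(bergmanMeasure γ) := by
          refine lintegral_mono_ae ?_
          filter_upwards [ae_bergmanMeasure_mem γ] with z hz
          refine (ENNReal.rpow_le_rpow (hpt z hz) hp0.le).trans ?_
          rw [ENNReal.mul_rpow_of_nonneg (ENNReal.ofReal C) _ hp0.le,
            ← ENNReal.mul_rpow_of_nonneg (ENNReal.ofReal D * S₀ * ENNReal.ofReal B) _ hp0.le]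
          exact mul_le_mul_right (ENNReal.rpow_add_le_mul_rpow_add_rpow _ _ hp.le) _
      _ = ENNReal.ofReal C ^ p * (2 ^ (p - 1) *
          ((ENNReal.ofReal D * S₀ * ENNReal.ofReal B) ^ p * L +
            ∫⁻ z, W z ^ p ∂(bergmanMeasure γ))) := by
          rw [lintegral_const_mul' _ _ hc1, lintegral_const_mul' _ _ hc2,
            lintegral_add_left (by fun_prop), lintegral_const_mul' _ _ hc3]
      _ ≤ ENNReal.ofReal C ^ p * (2 ^ (p - 1) *
          ((ENNReal.ofReal D * S₀ * ENNReal.ofReal B) ^ p * L +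
            4 * S ^ p * ENNReal.ofReal B ^ p)) := by gcongr
      _ = _ := by
          rw [hK₀, ENNReal.mul_rpow_of_nonneg (ENNReal.ofReal D * S₀) _ hp0.le]
          ring
  rw [eLpNorm_eq_lintegral_rpow_enorm_toReal (by simpa using hp0) (by simp),
    ENNReal.toReal_ofReal hp0.le]
  refine (ENNReal.rpow_le_rpow hfinal (by positivity)).trans_eq ?_
  rw [ENNReal.mul_rpow_of_nonneg _ _ (by positivity), ← ENNReal.rpow_mul,
    mul_one_div_cancel hp0.ne', ENNReal.rpow_one]

/-! ### Splitting off eigenfunctions -/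

/-- Subtracting a combination of the first `N` eigenfunctions of `C` leaves a function with a zero
of order `N` at the origin, with control by the size near the origin. -/
theorem exists_eigenfun_decomposition (N : ℕ) : ∃ C : ℝ, 0 ≤ C ∧ ∀ h ∈ holoDisc, ∀ S : ℝ, 0 ≤ S →
    (∀ ζ : ℂ, ‖ζ‖ ≤ 1 / 2 → ‖h ζ‖ ≤ S) → ∃ (c : ℕ → ℂ) (k : ℂ → ℂ),
      DifferentiableOn ℂ k (ball 0 1) ∧ (∀ j < N, ‖c j‖ ≤ C * S) ∧
      (∀ ζ : ℂ, ‖ζ‖ ≤ 1 / 2 → ‖k ζ‖ ≤ C * S) ∧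
      ∀ z : ℂ, ‖z‖ < 1 → h z = ∑ j ∈ Finset.range N, c j * cesaroEigenfun j z + z ^ N * k z := by
  induction N with
  | zero =>
    refine ⟨1, zero_le_one, fun h hh S hS hhS => ⟨0, h, hh.1, by simp, by simpa using hhS, ?_⟩⟩
    intro z _
    simp
  | succ N ih =>
    obtain ⟨C, hC, H⟩ := ih
    refine ⟨2 * (C * (1 + 2 ^ (N + 1))), by positivity, fun h hh S hS hhS => ?_⟩
    obtain ⟨c, k, hk, hc, hkS, hdec⟩ := H h hh S hS hhS
    set q : ℂ → ℂ := fun z => k z - k 0 * ((1 - z) ^ (N + 1))⁻¹ with hq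
    have hqd : DifferentiableOn ℂ q (ball 0 1) := by
      refine hk.sub (DifferentiableOn.const_mul (DifferentiableOn.inv (by fun_prop) ?_) _)
      intro z hz
      exact pow_ne_zero _ (one_sub_ne_zero_of_norm_lt (by simpa using hz))
    have hq0 : q 0 = 0 := by simp [hq]
    have hfac : ∀ z, q z = z * dslope q 0 z := by
      intro z
      have := sub_smul_dslope q 0 z
      rw [hq0, sub_zero, sub_zero, smul_eq_mul] at this
      exact this.symm
    have hdd : DifferentiableOn ℂ (dslope q 0) (ball 0 1) :=
      (Complex.differentiableOn_dslope (ball_mem_nhds 0 one_pos)).2 hqd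
    have hCS : 0 ≤ C * S := by positivity
    have hk0 : ‖k 0‖ ≤ C * S := hkS 0 (by simp)
    have hle : C * S ≤ 2 * (C * (1 + 2 ^ (N + 1))) * S := by
      have h2 : (0 : ℝ) ≤ 2 ^ (N + 1) := by positivity
      nlinarith
    refine ⟨Function.update c N (k 0), dslope q 0, hdd, ?_, ?_, ?_⟩
    · intro j hj
      rcases Nat.lt_succ_iff_lt_or_eq.1 hj with hj | rfl
      · rw [Function.update_of_ne hj.ne]
        exact (hc j hj).trans hle
      · rw [Function.update_self]
        exact hk0.trans hle
    · -- by the maximum principle it suffices to look at the circle of radius `1/2`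
      intro ζ hζ
      have hcl : closure (ball (0 : ℂ) (1 / 2)) = closedBall 0 (1 / 2) :=
        closure_ball _ (by norm_num)
      refine Complex.norm_le_of_forall_mem_frontier_norm_le (U := ball (0 : ℂ) (1 / 2))
        isBounded_ball ?_ ?_ (by rw [hcl]; simpa using hζ)
      · refine DifferentiableOn.diffContOnCl ?_
        rw [hcl]
        exact hdd.mono (closedBall_subset_ball (by norm_num))
      · intro z hz
        rw [frontier_ball _ (by norm_num)] at hz
        have hz : ‖z‖ = 1 / 2 := by simpa using hz
        have hz0 : z ≠ 0 := by
          rintro rfl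
          norm_num at hz
        have h1 : ‖q z‖ ≤ C * S + C * S * 2 ^ (N + 1) := by
          refine (norm_sub_le _ _).trans (add_le_add (hkS z hz.le) ?_)
          rw [norm_mul, norm_inv, norm_pow]
          refine mul_le_mul hk0 ?_ (by positivity) hCS
          have h2 : 1 / 2 ≤ ‖1 - z‖ := by
            have := one_sub_norm_le z
            linarith
          rw [← inv_pow]
          refine pow_le_pow_left₀ (by positivity) ?_ _
          rw [inv_le_comm₀ (by linarith) two_pos]
          linarith
        have h3 : ‖q z‖ = 1 / 2 * ‖dslope q 0 z‖ := by rw [hfac z, norm_mul, hz]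
        rw [h3] at h1
        linarith
    · intro z hz
      rw [hdec z hz, Finset.sum_range_succ, Function.update_self, cesaroEigenfun_apply N hz]
      have hsum : ∑ j ∈ Finset.range N, Function.update c N (k 0) j * cesaroEigenfun j z =
          ∑ j ∈ Finset.range N, c j * cesaroEigenfun j z := by
        refine Finset.sum_congr rfl fun j hj => ?_
        rw [Function.update_of_ne (Finset.mem_range.1 hj).ne]
      have h4 : k z = k 0 * ((1 - z) ^ (N + 1))⁻¹ + z * dslope q 0 z := by
        rw [← hfac z, hq]
        ring
      rw [hsum, h4]
      ring

/-! ### Uniform solution of the resolvent equation -/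

/-- An element of `A^p_μ` as a function. -/
def bergmanToFun (p μ : ℝ) : Bergman p μ →ₗ[ℂ] (ℂ → ℂ) where
  toFun f := f.1
  map_add' _ _ := rfl
  map_smul' _ _ := rfl

/-- The inclusion of `A^p_μ` into `A^p_γ` for `μ ≤ γ`. -/
def bergmanInclusion (p : ℝ) {μ γ : ℝ} (h : μ ≤ γ) : Bergman p μ →ₗ[ℂ] Bergman p γ :=
  Submodule.inclusion (bergmanSubmodule_mono p h)

theorem bergmanToFun_apply {p μ : ℝ} (f : Bergman p μ) : bergmanToFun p μ f = f.1 := rfl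

theorem bergmanToFun_mem_holoDisc {p μ : ℝ} (f : Bergman p μ) : bergmanToFun p μ f ∈ holoDisc :=
  f.2.1

theorem memLp_bergmanToFun {p μ : ℝ} (f : Bergman p μ) :
    MemLp (bergmanToFun p μ f) (ENNReal.ofReal p) (bergmanMeasure μ) :=
  f.2.2

theorem bergmanToFun_inclusion {p μ γ : ℝ} (h : μ ≤ γ) (f : Bergman p μ) :
    bergmanToFun p γ (bergmanInclusion p h f) = bergmanToFun p μ f := by
  rw [bergmanToFun_apply, bergmanToFun_apply]
  exact Submodule.coe_inclusion (bergmanSubmodule_mono p h) f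

section

variable {p : ℝ} [hp : Fact (1 < p)]

theorem bergman_norm_eq_toReal {μ : ℝ} (f : Bergman p μ) :
    ‖f‖ = (eLpNorm (bergmanToFun p μ f) (ENNReal.ofReal p) (bergmanMeasure μ)).toReal :=
  Lp.norm_toLp _ f.2.2

theorem eLpNorm_eq_ofReal_bergman_norm {μ : ℝ} (f : Bergman p μ) :
    eLpNorm (bergmanToFun p μ f) (ENNReal.ofReal p) (bergmanMeasure μ) = ENNReal.ofReal ‖f‖ := by
  rw [bergman_norm_eq_toReal, ENNReal.ofReal_toReal (memLp_bergmanToFun f).eLpNorm_ne_top]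

theorem norm_bergmanInclusion_le {μ γ : ℝ} (h : μ ≤ γ) (f : Bergman p μ) :
    ‖bergmanInclusion p h f‖ ≤ ‖f‖ := by
  rw [bergman_norm_eq_toReal, bergman_norm_eq_toReal, bergmanToFun_inclusion]
  exact ENNReal.toReal_mono (memLp_bergmanToFun f).eLpNorm_ne_top
    (eLpNorm_mono_measure _ (bergmanMeasure_mono h))

theorem exists_bergman_of_eLpNorm_le {γ : ℝ} {f : ℂ → ℂ} (hf : f ∈ holoDisc) {x : ℝ} (hx : 0 ≤ x)
    (h : eLpNorm f (ENNReal.ofReal p) (bergmanMeasure γ) ≤ ENNReal.ofReal x) :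
    ∃ g : Bergman p γ, bergmanToFun p γ g = f ∧ ‖g‖ ≤ x := by
  have hmem : f ∈ bergmanSubmodule p γ :=
    ⟨hf, (holoDisc.measurable hf).aestronglyMeasurable, h.trans_lt ENNReal.ofReal_lt_top⟩
  let g : Bergman p γ := ⟨f, hmem⟩
  refine ⟨g, rfl, ?_⟩
  rw [bergman_norm_eq_toReal]
  exact ENNReal.toReal_le_of_le_ofReal hx h

theorem exists_bergman_growth_bound {μ : ℝ} (hμ : 0 < μ) : ∃ K : ℝ, 0 ≤ K ∧
    ∀ (f : Bergman p μ) (z : ℂ), ‖z‖ < 1 →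
      ‖bergmanToFun p μ f z‖ ≤ K * ‖f‖ * (1 - ‖z‖) ^ (-((2 + μ) / p)) := by
  obtain ⟨K, hK, H⟩ := exists_growth_bound hp.out hμ
  refine ⟨K.toReal, ENNReal.toReal_nonneg, fun f z hz => ?_⟩
  have h0 : 0 ≤ (1 - ‖z‖) ^ (-((2 + μ) / p)) := Real.rpow_nonneg (by linarith) _
  have := H (bergmanToFun p μ f) (bergmanToFun_mem_holoDisc f) z hz
  rw [eLpNorm_eq_ofReal_bergman_norm, ← ENNReal.ofReal_toReal hK,
    ← ENNReal.ofReal_mul (by positivity), ← ENNReal.ofReal_mul (by positivity),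
    ← ofReal_norm] at this
  exact (ENNReal.ofReal_le_ofReal_iff (by positivity)).1 this

theorem exists_bergman_half_disc_bound {μ : ℝ} (hμ : 0 < μ) : ∃ K : ℝ, 0 ≤ K ∧
    ∀ (f : Bergman p μ) (z : ℂ), ‖z‖ ≤ 1 / 2 → ‖bergmanToFun p μ f z‖ ≤ K * ‖f‖ := by
  have hp0 : 0 < p := one_pos.trans hp.out
  obtain ⟨K, hK, H⟩ := exists_bergman_growth_bound (p := p) hμ
  refine ⟨K * (1 / 2) ^ (-((2 + μ) / p)), by positivity, fun f z hz => ?_⟩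
  refine (H f z (by linarith)).trans ?_
  rw [mul_right_comm]
  refine mul_le_mul_of_nonneg_right (mul_le_mul_of_nonneg_left ?_ hK) (norm_nonneg f)
  refine Real.rpow_le_rpow_of_nonpos (show (0 : ℝ) < 1 / 2 by norm_num) (by linarith) ?_
  have : 0 ≤ (2 + μ) / p := by positivity
  linarith

theorem exists_bergman_resolventKernel {μ ε : ℝ} (hμ : 0 < μ) (hε : 0 < ε)
    (hε1 : ε ≤ 1) (M : ℝ) (N : ℕ) :
    ∃ K : ℝ, 0 ≤ K ∧ ∀ w : ℂ, ‖w‖ ≤ M → w.re ≤ (2 + μ) / p + ε → w.re ≤ N + 1 - ε →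
      ∀ (h : Bergman p μ) (k : ℂ → ℂ) (B : ℝ), DifferentiableOn ℂ k (ball 0 1) → ‖h‖ ≤ B →
      (∀ z : ℂ, ‖z‖ < 1 → bergmanToFun p μ h z = z ^ N * k z) →
      (∀ ζ : ℂ, ‖ζ‖ ≤ 1 / 2 → ‖k ζ‖ ≤ B) →
      ∃ g : Bergman p (μ + 2 * ε * p), bergmanToFun p _ g = resolventKernel w N k ∧
        ‖g‖ ≤ K * B := by
  obtain ⟨K, hK, H⟩ := exists_eLpNorm_resolventKernel_le hp.out hμ hε hε1 M N
  refine ⟨K, hK, fun w hwM hwA hwN h k B hk hB hhk hkB => ?_⟩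
  have hB0 : 0 ≤ B := (norm_nonneg h).trans hB
  refine exists_bergman_of_eLpNorm_le (resolventKernel_mem (by linarith) hk) (by positivity) ?_
  rw [ENNReal.ofReal_mul hK]
  refine H w hwM hwA hwN _ (bergmanToFun_mem_holoDisc h) k B hB0 hhk hkB ?_
  exact (eLpNorm_eq_ofReal_bergman_norm h).trans_le (ENNReal.ofReal_le_ofReal hB)

theorem exists_bergman_of_norm_le {μ A C : ℝ} (hμ : 0 < μ) (hC : 0 ≤ C) (hA : A < (2 + μ) / p)
    {f : ℂ → ℂ} (hf : f ∈ holoDisc) (hfC : ∀ z : ℂ, ‖z‖ < 1 → ‖f z‖ ≤ C * ‖1 - z‖ ^ (-A)) :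
    ∃ g : Bergman p μ, bergmanToFun p μ g = f := by
  have hp0 : 0 < p := one_pos.trans hp.out
  have hfin : eLpNorm f (ENNReal.ofReal p) (bergmanMeasure μ) < ∞ := by
    rw [eLpNorm_eq_lintegral_rpow_enorm_toReal (by simpa using hp0) (by simp),
      ENNReal.toReal_ofReal hp0.le]
    refine ENNReal.rpow_lt_top_of_nonneg (by positivity) (ne_of_lt ?_)
    calc ∫⁻ z, ‖f z‖ₑ ^ p ∂(bergmanMeasure μ)
        ≤ ∫⁻ z, ENNReal.ofReal C ^ p * ENNReal.ofReal (‖1 - z‖ ^ (-A)) ^ p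
          ∂(bergmanMeasure μ) := by
          refine lintegral_mono_ae ?_
          filter_upwards [ae_bergmanMeasure_mem μ] with z hz
          rw [← ENNReal.mul_rpow_of_nonneg _ _ hp0.le, ← ENNReal.ofReal_mul hC, ← ofReal_norm]
          exact ENNReal.rpow_le_rpow (ENNReal.ofReal_le_ofReal (hfC z hz)) hp0.le
      _ < ∞ := by
          have hCp : ENNReal.ofReal C ^ p ≠ ∞ :=
            ENNReal.rpow_ne_top_of_nonneg hp0.le ENNReal.ofReal_ne_top
          rw [lintegral_const_mul' _ _ hCp]
          exact ENNReal.mul_lt_top hCp.lt_top (lintegral_one_sub_rpow_lt_top hp0 hμ hA)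
  obtain ⟨g, hg, -⟩ := exists_bergman_of_eLpNorm_le hf ENNReal.toReal_nonneg
    (ENNReal.ofReal_toReal hfin.ne).ge
  exact ⟨g, hg⟩

theorem norm_cesaroEigenfun_le (j : ℕ) {z : ℂ} (hz : ‖z‖ < 1) :
    ‖cesaroEigenfun j z‖ ≤ 1 * ‖1 - z‖ ^ (-((j : ℝ) + 1)) := by
  rw [cesaroEigenfun_apply j hz, norm_mul, norm_pow, norm_inv, norm_pow,
    Real.rpow_neg (norm_nonneg _), ← Nat.cast_add_one, Real.rpow_natCast]
  exact mul_le_mul_of_nonneg_right (pow_le_one₀ (norm_nonneg z) hz.le) (by positivity)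

theorem exists_bergman_cesaroEigenfun {μ : ℝ} (hμ : 0 < μ) {j : ℕ}
    (hj : (j : ℝ) + 1 < (2 + μ) / p) :
    ∃ e : Bergman p μ, bergmanToFun p μ e = cesaroEigenfun j :=
  exists_bergman_of_norm_le hμ zero_le_one hj (cesaroEigenfun_mem j) fun _ hz =>
    norm_cesaroEigenfun_le j hz

theorem exists_small_exponent {α μ η : ℝ} (hμα : μ < α) (hη : 0 < η) :
    ∃ ε : ℝ, 0 < ε ∧ ε ≤ 1 ∧ ε ≤ η ∧ μ + 2 * ε * p < α := by
  have hp0 : 0 < p := one_pos.trans hp.out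
  refine ⟨min (min 1 η) ((α - μ) / (4 * p)), ?_, ?_, ?_, ?_⟩
  · have : 0 < (α - μ) / (4 * p) := div_pos (by linarith) (by positivity)
    positivity
  · exact (min_le_left _ _).trans (min_le_left _ _)
  · exact (min_le_left _ _).trans (min_le_right _ _)
  · have h1 := (le_div_iff₀ (by positivity)).1
      (min_le_right (min 1 η) ((α - μ) / (4 * p)))
    linarith

/-- `C` maps each step continuously into another one. -/
theorem exists_bergman_cesaro {α μ : ℝ} (hμ : 0 < μ) (hμα : μ < α) :
    ∃ (γ : ℝ) (_ : 0 < γ) (_ : γ < α) (K : ℝ), ∀ h : Bergman p μ,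
      ∃ g : Bergman p γ, bergmanToFun p γ g = cesaro (bergmanToFun p μ h) ∧ ‖g‖ ≤ K * ‖h‖ := by
  have hp0 : 0 < p := one_pos.trans hp.out
  obtain ⟨ε, hε, hε1, -, hεα⟩ := exists_small_exponent (p := p) hμα one_pos
  obtain ⟨K, hK, H⟩ := exists_bergman_resolventKernel (p := p) hμ hε hε1 0 0
  obtain ⟨D, hD, HD⟩ := exists_bergman_half_disc_bound (p := p) hμ
  refine ⟨μ + 2 * ε * p, by positivity, hεα, K * max 1 D, fun h => ?_⟩
  obtain ⟨g, hg, hgK⟩ := H 0 (by simp) (by simp; positivity) (by simpa using hε1) h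
    (bergmanToFun p μ h) (max 1 D * ‖h‖) (bergmanToFun_mem_holoDisc h).1
    (le_mul_of_one_le_left (norm_nonneg h) (le_max_left _ _)) (by simp)
    (fun ζ hζ => (HD h ζ hζ).trans
      (mul_le_mul_of_nonneg_right (le_max_right _ _) (norm_nonneg h)))
  refine ⟨g, hg.trans (cesaro_eq_resolventKernel (bergmanToFun_mem_holoDisc h)).symm, ?_⟩
  exact hgK.trans_eq (mul_assoc _ _ _).symm

theorem SolvesOn.sum {w : ℂ} {ι : Type*} (s : Finset ι) {h f : ι → ℂ → ℂ}
    (H : ∀ i ∈ s, SolvesOn w (h i) (f i)) : SolvesOn w (∑ i ∈ s, h i) (∑ i ∈ s, f i) := by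
  classical
  induction s using Finset.induction_on with
  | empty =>
    intro z _
    simpa using hasDerivAt_const z (0 : ℂ)
  | insert a s ha ih =>
    rw [Finset.sum_insert ha, Finset.sum_insert ha]
    exact (H a (Finset.mem_insert_self a s)).add
      (ih fun i hi => H i (Finset.mem_insert_of_mem hi))

theorem exists_bergman_eigenfuns {μ : ℝ} (hμ : 0 < μ) {N : ℕ} (hN : (N : ℝ) < (2 + μ) / p) :
    ∃ e : ℕ → Bergman p μ, ∀ j < N, bergmanToFun p μ (e j) = cesaroEigenfun j := by
  have hex : ∀ j : ℕ, ∃ e : Bergman p μ, j < N → bergmanToFun p μ e = cesaroEigenfun j := by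
    intro j
    by_cases hj : j < N
    · have hj' : (j : ℝ) + 1 ≤ N := by exact_mod_cast hj
      obtain ⟨e, he⟩ := exists_bergman_cesaroEigenfun (p := p) hμ (hj'.trans_lt hN)
      exact ⟨e, fun _ => he⟩
    · exact ⟨0, fun h => absurd h hj⟩
  choose e he using hex
  exact ⟨e, he⟩

/-- The decomposition of `exists_eigenfun_decomposition` with bounds in the norms of the steps. -/
theorem exists_bergman_decomposition {μ γ : ℝ} (hμ : 0 < μ) (hμγ : μ ≤ γ) {N : ℕ}
    {e : ℕ → Bergman p γ} (he : ∀ j < N, bergmanToFun p γ (e j) = cesaroEigenfun j) :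
    ∃ B : ℝ, 0 ≤ B ∧ ∀ h : Bergman p μ, ∃ (c : ℕ → ℂ) (k : ℂ → ℂ) (h' : Bergman p γ),
      DifferentiableOn ℂ k (ball 0 1) ∧ (∀ j < N, ‖c j‖ ≤ B * ‖h‖) ∧
      (∀ ζ : ℂ, ‖ζ‖ ≤ 1 / 2 → ‖k ζ‖ ≤ B * ‖h‖) ∧ ‖h'‖ ≤ B * ‖h‖ ∧
      (∀ z : ℂ, ‖z‖ < 1 → bergmanToFun p γ h' z = z ^ N * k z) ∧
      bergmanToFun p μ h =
        ∑ j ∈ Finset.range N, c j • cesaroEigenfun j + bergmanToFun p γ h' := by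
  obtain ⟨D, hD, HD⟩ := exists_bergman_half_disc_bound (p := p) hμ
  obtain ⟨C, hC, HC⟩ := exists_eigenfun_decomposition N
  obtain ⟨E, hE⟩ : ∃ E, E = ∑ j ∈ Finset.range N, ‖e j‖ := ⟨_, rfl⟩
  have hE0 : 0 ≤ E := hE ▸ Finset.sum_nonneg fun _ _ => norm_nonneg _
  have hCD : 0 ≤ C * D := mul_nonneg hC hD
  have hCDE : 0 ≤ C * D * E := mul_nonneg hCD hE0
  refine ⟨1 + C * D * (E + 1), by positivity, fun h => ?_⟩
  have hh0 := norm_nonneg h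
  obtain ⟨c, k, hk, hc, hkb, hdec⟩ := HC (bergmanToFun p μ h) (bergmanToFun_mem_holoDisc h)
    (D * ‖h‖) (by positivity) (HD h)
  have hle : C * (D * ‖h‖) ≤ (1 + C * D * (E + 1)) * ‖h‖ := by
    rw [← mul_assoc]
    exact mul_le_mul_of_nonneg_right (by linarith) hh0
  have hfun : bergmanToFun p γ
      (bergmanInclusion p hμγ h - ∑ j ∈ Finset.range N, c j • e j) =
      bergmanToFun p μ h - ∑ j ∈ Finset.range N, c j • cesaroEigenfun j := by
    rw [map_sub, bergmanToFun_inclusion, map_sum]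
    congr 1
    refine Finset.sum_congr rfl fun j hj => ?_
    rw [map_smul, he j (Finset.mem_range.1 hj)]
  refine ⟨c, k, bergmanInclusion p hμγ h - ∑ j ∈ Finset.range N, c j • e j, hk,
    fun j hj => (hc j hj).trans hle, fun ζ hζ => (hkb ζ hζ).trans hle, ?_, fun z hz => ?_, ?_⟩
  · have h1 : ‖∑ j ∈ Finset.range N, c j • e j‖ ≤ C * (D * ‖h‖) * E := by
      rw [hE, Finset.mul_sum]
      refine (norm_sum_le _ _).trans (Finset.sum_le_sum fun j hj => ?_)
      rw [norm_smul]
      exact mul_le_mul_of_nonneg_right (hc j (Finset.mem_range.1 hj)) (norm_nonneg _)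
    have h3 := norm_bergmanInclusion_le (p := p) hμγ h
    refine ((norm_sub_le _ _).trans (add_le_add h3 h1)).trans ?_
    have h2 : ‖h‖ + C * (D * ‖h‖) * E = (1 + C * D * E) * ‖h‖ := by ring
    rw [h2]
    exact mul_le_mul_of_nonneg_right (by linarith) hh0
  · rw [hfun, Pi.sub_apply, hdec z hz, Finset.sum_apply]
    simp
  · rw [hfun]
    abel

theorem solvesOn_decomposition {w : ℂ} {N : ℕ} {c : ℕ → ℂ} {k h h' : ℂ → ℂ}
    (hw : w.re < N + 1) (hne : ∀ j < N, (j : ℂ) + 1 - w ≠ 0)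
    (hk : DifferentiableOn ℂ k (ball 0 1)) (hh' : ∀ z : ℂ, ‖z‖ < 1 → h' z = z ^ N * k z)
    (hdec : h = ∑ j ∈ Finset.range N, c j • cesaroEigenfun j + h') :
    SolvesOn w h (∑ j ∈ Finset.range N, (c j * (w * (j + 1) / (j + 1 - w))) • cesaroEigenfun j +
      (w • h' + w ^ 2 • resolventKernel w N k)) := by
  rw [hdec]
  refine SolvesOn.add (SolvesOn.sum _ fun j hj => ?_) (solvesOn_resolventKernel hw hk hh')
  rw [mul_smul]
  exact (solvesOn_cesaroEigenfun j (hne j (Finset.mem_range.1 hj))).const_smul (c j)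

/-- Solution of the equation on a step by splitting off `N` eigenfunctions and applying the
resolvent kernel to the rest; `Q j` bounds the factor by which the resolvent acts on the `j`-th one. -/
theorem exists_solution_bound {μ γ ε : ℝ} (hμ : 0 < μ) (hμγ : μ ≤ γ) (hε : 0 < ε) (hε1 : ε ≤ 1)
    {N : ℕ} (hN : (N : ℝ) < (2 + γ) / p) {M : ℝ} (hM : 0 ≤ M) {Q : ℕ → ℝ} (hQ : ∀ j, 0 ≤ Q j) :
    ∃ K : ℝ, ∀ w : ℂ, ‖w‖ ≤ M → w.re ≤ (2 + γ) / p + ε → w.re ≤ N + 1 - ε →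
      (∀ j < N, (j : ℂ) + 1 - w ≠ 0 ∧ ‖w * (j + 1) / (j + 1 - w)‖ ≤ Q j) →
      ∀ h : Bergman p μ, ∃ f : Bergman p (γ + 2 * ε * p),
        SolvesOn w (bergmanToFun p μ h) (bergmanToFun p _ f) ∧ ‖f‖ ≤ K * ‖h‖ := by
  have hp0 : 0 < p := one_pos.trans hp.out
  obtain ⟨e, he⟩ := exists_bergman_eigenfuns (p := p) (hμ.trans_le hμγ) hN
  obtain ⟨B, hB, HB⟩ := exists_bergman_decomposition hμ hμγ he
  obtain ⟨K, hK, H⟩ := exists_bergman_resolventKernel (p := p) (hμ.trans_le hμγ) hε hε1 M N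
  have hle : γ ≤ γ + 2 * ε * p := by
    have : 0 < 2 * ε * p := by positivity
    linarith
  refine ⟨(∑ j ∈ Finset.range N, B * Q j * ‖e j‖) + (M * B + M ^ 2 * (K * B)), ?_⟩
  intro w hwM hwγ hwN hwj h
  obtain ⟨c, k, h', hk, hc, hkB, hh'n, hh', hdec⟩ := HB h
  obtain ⟨T, hT, hTn⟩ := H w hwM hwγ hwN h' k (B * ‖h‖) hk hh'n hh' hkB
  refine ⟨∑ j ∈ Finset.range N, (c j * (w * (j + 1) / (j + 1 - w))) • bergmanInclusion p hle (e j) +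
    (w • bergmanInclusion p hle h' + w ^ 2 • T), ?_, ?_⟩
  · have hs := solvesOn_decomposition (by linarith) (fun j hj => (hwj j hj).1) hk hh' hdec
    convert! hs using 1
    rw [map_add, map_add, map_sum, map_smul, map_smul, bergmanToFun_inclusion, hT]
    congr 1
    refine Finset.sum_congr rfl fun j hj => ?_
    rw [map_smul, bergmanToFun_inclusion, he j (Finset.mem_range.1 hj)]
  · have hh0 := norm_nonneg h
    have hn1 : ‖∑ j ∈ Finset.range N,
        (c j * (w * (j + 1) / (j + 1 - w))) • bergmanInclusion p hle (e j)‖ ≤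
        (∑ j ∈ Finset.range N, B * Q j * ‖e j‖) * ‖h‖ := by
      rw [Finset.sum_mul]
      refine (norm_sum_le _ _).trans (Finset.sum_le_sum fun j hj => ?_)
      rw [norm_smul, norm_mul]
      have h1 := mul_le_mul (hc j (Finset.mem_range.1 hj)) (hwj j (Finset.mem_range.1 hj)).2
        (norm_nonneg _) (by positivity)
      have hQj := hQ j
      refine (mul_le_mul h1 (norm_bergmanInclusion_le hle (e j)) (norm_nonneg _)
        (by positivity)).trans_eq ?_
      ring
    have hn2 : ‖w • bergmanInclusion p hle h'‖ ≤ M * (B * ‖h‖) := by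
      rw [norm_smul]
      exact mul_le_mul hwM ((norm_bergmanInclusion_le hle h').trans hh'n) (norm_nonneg _) hM
    have hn3 : ‖w ^ 2 • T‖ ≤ M ^ 2 * (K * (B * ‖h‖)) := by
      rw [norm_smul, norm_pow]
      exact mul_le_mul (pow_le_pow_left₀ (norm_nonneg w) hwM 2) hTn (norm_nonneg _) (by positivity)
    refine (norm_add_le _ _).trans ?_
    have := norm_add_le (w • bergmanInclusion p hle h') (w ^ 2 • T)
    linarith

/-- For `Re w₀ < (2 + α) / p` and `w₀` not a positive integer the equation `f - w C f = w h` can be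
solved for all `w` close to `w₀`, with uniform bounds. -/
theorem exists_uniform_solution {α : ℝ} (hα : 0 < α) {w₀ : ℂ} (hw₀ : w₀.re < (2 + α) / p)
    (hne : ∀ j : ℕ, (j : ℂ) + 1 ≠ w₀) :
    ∀ᶠ W in (𝓝 w₀).smallSets, ∀ μ : ℝ, 0 < μ → μ < α →
      ∃ (γ : ℝ) (_ : 0 < γ) (_ : γ < α) (K : ℝ), ∀ w ∈ W, ∀ h : Bergman p μ,
        ∃ f : Bergman p γ, SolvesOn w (bergmanToFun p μ h) (bergmanToFun p γ f) ∧
          ‖f‖ ≤ K * ‖h‖ := by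
  have hp0 : 0 < p := one_pos.trans hp.out
  set r := (2 + α) / p with hr
  have hr0 : 0 < r := by positivity
  -- the number of eigenfunctions to split off
  obtain ⟨N, hNr, hN⟩ : ∃ N : ℕ, (N : ℝ) < r ∧ w₀.re < N + 1 :=
    ⟨⌊max w₀.re 0⌋₊, (Nat.floor_le (le_max_right _ _)).trans_lt (max_lt hw₀ hr0),
      (le_max_left _ _).trans_lt (Nat.lt_floor_add_one _)⟩
  obtain ⟨r₁, hr₁, hr₁'⟩ := exists_between (lt_min hw₀ hN)
  have hr₁r : r₁ < r := hr₁'.trans_le (min_le_left _ _)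
  have hr₁N : r₁ < N + 1 := hr₁'.trans_le (min_le_right _ _)
  set M := ‖w₀‖ + 1 with hM
  have hM0 : 0 ≤ M := by positivity
  set Q : ℕ → ℝ := fun j => ‖w₀ * (j + 1) / (j + 1 - w₀)‖ + 1 with hQ
  have hQ0 : ∀ j, 0 ≤ Q j := fun j => by positivity
  have hnhds : ∀ᶠ w in 𝓝 w₀, w.re ≤ r₁ ∧ ‖w‖ ≤ M ∧
      ∀ j ∈ Finset.range N, (j : ℂ) + 1 - w ≠ 0 ∧ ‖w * (j + 1) / (j + 1 - w)‖ ≤ Q j := by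
    refine (((Complex.continuous_re.tendsto w₀).eventually_lt_const hr₁).mono
      fun _ h => h.le).and ((((continuous_norm.tendsto w₀).eventually_lt_const
      (lt_add_one _)).mono fun _ h => h.le).and ?_)
    refine (eventually_all_finset _).2 fun j _ => ?_
    have h1 : (j : ℂ) + 1 - w₀ ≠ 0 := sub_ne_zero.2 (hne j)
    have h2 : ContinuousAt (fun w : ℂ => (j : ℂ) + 1 - w) w₀ := by fun_prop
    have h3 : ContinuousAt (fun w : ℂ => ‖w * (j + 1) / (j + 1 - w)‖) w₀ :=
      (ContinuousAt.div (by fun_prop) h2 h1).norm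
    exact (h2.eventually_ne h1).and
      ((h3.tendsto.eventually_lt_const (lt_add_one _)).mono fun _ h => h.le)
  refine eventually_smallSets.2 ⟨_, hnhds, fun W hW μ hμ hμα => ?_⟩
  -- replace `μ` by a larger exponent for which the eigenfunctions lie in the step
  obtain ⟨μ', hμ', hμ'α⟩ : ∃ μ', max μ (max (p * r₁ - 2) (p * N - 2)) < μ' ∧ μ' < α := by
    have hlt : ∀ x, x < r → p * x - 2 < α := fun x hx => by
      have := (lt_div_iff₀ hp0).1 (hr ▸ hx)
      linarith
    exact exists_between (max_lt hμα (max_lt (hlt _ hr₁r) (hlt _ hNr)))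
  have hμμ' : μ < μ' := (le_max_left _ _).trans_lt hμ'
  have hμ'0 : 0 < μ' := hμ.trans hμμ'
  have hr₁μ : r₁ < (2 + μ') / p := by
    rw [lt_div_iff₀ hp0]
    have := ((le_max_left _ _).trans (le_max_right _ _)).trans_lt hμ'
    linarith
  have hNμ : (N : ℝ) < (2 + μ') / p := by
    rw [lt_div_iff₀ hp0]
    have := ((le_max_right _ _).trans (le_max_right _ _)).trans_lt hμ'
    linarith
  obtain ⟨ε, hε, hε1, hεN, hεα⟩ := exists_small_exponent (p := p) hμ'α
    (show 0 < (N : ℝ) + 1 - r₁ by linarith)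
  obtain ⟨K, H⟩ := exists_solution_bound (p := p) hμ hμμ'.le hε hε1 hNμ hM0 hQ0
  refine ⟨μ' + 2 * ε * p, by positivity, hεα, K, fun w hw => ?_⟩
  obtain ⟨hwr, hwM, hwj⟩ := hW hw
  exact H w hwM (by linarith) (by linarith) fun j hj => hwj j (Finset.mem_range.2 hj)

end

/-! ### The Cesàro operator on the inductive limit -/

theorem cesaro_mem_holoDisc {f : ℂ → ℂ} (hf : f ∈ holoDisc) : cesaro f ∈ holoDisc := by
  rw [cesaro_eq_resolventKernel hf]
  exact resolventKernel_mem (by simp) hf.1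

theorem cesaro_add {f g : ℂ → ℂ} (hf : f ∈ holoDisc) (hg : g ∈ holoDisc) :
    cesaro (f + g) = cesaro f + cesaro g := by
  refine cesaro_eq_of_hasDerivAt (holoDisc.add_mem hf hg)
    (holoDisc.add_mem (cesaro_mem_holoDisc hf) (cesaro_mem_holoDisc hg)) fun z hz => ?_
  convert! (hasDerivAt_mul_cesaro hf hz).add (hasDerivAt_mul_cesaro hg hz) using 1
  · funext ζ
    simp only [Pi.add_apply]
    ring
  · simp only [Pi.add_apply]
    ring

theorem cesaro_smul (c : ℂ) {f : ℂ → ℂ} (hf : f ∈ holoDisc) :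
    cesaro (c • f) = c • cesaro f := by
  refine cesaro_eq_of_hasDerivAt (holoDisc.smul_mem c hf)
    (holoDisc.smul_mem c (cesaro_mem_holoDisc hf)) fun z hz => ?_
  convert! (hasDerivAt_mul_cesaro hf hz).const_mul c using 1
  · funext ζ
    simp only [Pi.smul_apply, smul_eq_mul]
    ring
  · simp only [Pi.smul_apply, smul_eq_mul]
    ring

/-- An element of `A^p_{α-}` as a function. -/
def bergmanMinusToFun (p α : ℝ) [Fact (0 < α)] : BergmanMinus p α →ₗ[ℂ] (ℂ → ℂ) where
  toFun f := f.1
  map_add' _ _ := rfl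
  map_smul' _ _ := rfl

section

variable {p α : ℝ} [hα : Fact (0 < α)]

theorem bergmanMinusToFun_injective : Function.Injective (bergmanMinusToFun p α) :=
  fun _ _ h => Subtype.ext h

theorem bergmanMinusToFun_mem_holoDisc (f : BergmanMinus p α) :
    bergmanMinusToFun p α f ∈ holoDisc := by
  obtain ⟨f, μ, h0, h1, hf⟩ := f
  exact hf.1

theorem bergmanMinusToFun_stepInclusion {μ : ℝ} (h0 : 0 < μ) (h1 : μ < α) (f : Bergman p μ) :
    bergmanMinusToFun p α (stepInclusion p α μ h0 h1 f) = bergmanToFun p μ f :=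
  rfl

theorem exists_stepInclusion_eq (f : BergmanMinus p α) : ∃ (μ : ℝ) (h0 : 0 < μ) (h1 : μ < α)
    (g : Bergman p μ), stepInclusion p α μ h0 h1 g = f := by
  obtain ⟨f, μ, h0, h1, hf⟩ := f
  exact ⟨μ, h0, h1, ⟨f, hf⟩, rfl⟩

variable [hp : Fact (1 < p)]

theorem cesaro_mem_bergmanMinusSubmodule (f : BergmanMinus p α) :
    cesaro (bergmanMinusToFun p α f) ∈ bergmanMinusSubmodule p α := by
  obtain ⟨μ, h0, h1, f, rfl⟩ := exists_stepInclusion_eq f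
  obtain ⟨γ, h2, h3, K, H⟩ := exists_bergman_cesaro (p := p) h0 h1
  obtain ⟨g, hg, -⟩ := H f
  rw [bergmanMinusToFun_stepInclusion, ← hg]
  exact (stepInclusion p α γ h2 h3 g).2

variable (p α) in
/-- The Cesàro operator as a linear map on `A^p_{α-}`. -/
def cesaroLinearMap : BergmanMinus p α →ₗ[ℂ] BergmanMinus p α where
  toFun f := ⟨cesaro (bergmanMinusToFun p α f), cesaro_mem_bergmanMinusSubmodule f⟩
  map_add' f g := Subtype.ext <|
    cesaro_add (bergmanMinusToFun_mem_holoDisc f) (bergmanMinusToFun_mem_holoDisc g)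
  map_smul' c f := Subtype.ext <| cesaro_smul c (bergmanMinusToFun_mem_holoDisc f)

theorem bergmanMinusToFun_cesaroLinearMap (f : BergmanMinus p α) :
    bergmanMinusToFun p α (cesaroLinearMap p α f) = cesaro (bergmanMinusToFun p α f) :=
  rfl

theorem continuous_cesaroLinearMap : Continuous (cesaroLinearMap p α) := by
  refine UniformlyStepBounded.continuous (ι := Unit) (T := fun _ => cesaroLinearMap p α) ?_ ()
  intro μ h0 h1
  obtain ⟨γ, h2, h3, K, H⟩ := exists_bergman_cesaro (p := p) h0 h1
  refine ⟨γ, h2, h3, K, fun _ f => ?_⟩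
  obtain ⟨g, hg, hgK⟩ := H f
  refine ⟨g, bergmanMinusToFun_injective ?_, hgK⟩
  rw [bergmanMinusToFun_cesaroLinearMap, bergmanMinusToFun_stepInclusion,
    bergmanMinusToFun_stepInclusion, hg]

variable (p α) in
/-- The Cesàro operator as a continuous linear operator on `A^p_{α-}`. -/
def cesaroCLM : BergmanMinus p α →L[ℂ] BergmanMinus p α :=
  ⟨cesaroLinearMap p α, continuous_cesaroLinearMap⟩

theorem bergmanMinusToFun_cesaroCLM (f : BergmanMinus p α) :
    bergmanMinusToFun p α (cesaroCLM p α f) = cesaro (bergmanMinusToFun p α f) :=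
  bergmanMinusToFun_cesaroLinearMap f

theorem bergmanMinusToFun_sub_cesaroCLM (l : ℂ) (f : BergmanMinus p α) :
    bergmanMinusToFun p α
      ((algebraMap ℂ (BergmanMinus p α →L[ℂ] BergmanMinus p α) l - cesaroCLM p α) f) =
      l • bergmanMinusToFun p α f - cesaro (bergmanMinusToFun p α f) := by
  rw [sub_apply, map_sub, bergmanMinusToFun_cesaroCLM,
    Algebra.algebraMap_eq_smul_one, smul_apply, map_smul,
    one_apply_eq_self]

theorem sub_cesaroCLM_apply_eq_iff {l : ℂ} (hl : l ≠ 0) (f h : BergmanMinus p α) :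
    (algebraMap ℂ (BergmanMinus p α →L[ℂ] BergmanMinus p α) l - cesaroCLM p α) f = h ↔
      SolvesOn l⁻¹ (bergmanMinusToFun p α h) (bergmanMinusToFun p α f) := by
  rw [solvesOn_iff hl (bergmanMinusToFun_mem_holoDisc h) (bergmanMinusToFun_mem_holoDisc f),
    ← bergmanMinusToFun_sub_cesaroCLM]
  exact bergmanMinusToFun_injective.eq_iff.symm

/-! ### The point spectrum -/

/-- Elements of `A^p_{α-}` are `o((1 - |z|) ^ (-(2 + α) / p))` along every radius. -/
theorem tendsto_rpow_mul_norm_bergmanMinus (f : BergmanMinus p α) {a : ℝ} (ha : (2 + α) / p ≤ a)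
    {ω : ℂ} (hω : ‖ω‖ = 1) :
    Tendsto (fun s : ℝ => s ^ a * ‖bergmanMinusToFun p α f (ω * (1 - s))‖) (𝓝[>] 0) (𝓝 0) := by
  have hp0 : 0 < p := one_pos.trans hp.out
  obtain ⟨μ, h0, h1, f, rfl⟩ := exists_stepInclusion_eq f
  obtain ⟨K, hK, H⟩ := exists_bergman_growth_bound (p := p) h0
  have hexp : 0 < a - (2 + μ) / p := by
    have : (2 + μ) / p < (2 + α) / p := by gcongr
    linarith
  have hlim : Tendsto (fun s : ℝ => K * ‖f‖ * s ^ (a - (2 + μ) / p)) (𝓝[>] 0) (𝓝 0) := by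
    have h2 : Tendsto (fun s : ℝ => s ^ (a - (2 + μ) / p)) (𝓝[>] 0) (𝓝 0) := by
      have := (Real.continuousAt_rpow_const 0 _ (Or.inr hexp.le)).tendsto
      rw [Real.zero_rpow hexp.ne'] at this
      exact this.mono_left nhdsWithin_le_nhds
    simpa using h2.const_mul (K * ‖f‖)
  have hnear : ∀ᶠ s : ℝ in 𝓝[>] 0, s ∈ Ioo (0 : ℝ) 1 := Ioo_mem_nhdsGT one_pos
  refine squeeze_zero' ?_ ?_ hlim
  · filter_upwards [hnear] with s hs
    exact mul_nonneg (Real.rpow_nonneg hs.1.le _) (norm_nonneg _)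
  · filter_upwards [hnear] with s hs
    have hnorm : ‖ω * (1 - s)‖ = 1 - s := by
      rw [norm_mul, hω, one_mul, ← Complex.ofReal_one, ← Complex.ofReal_sub, Complex.norm_real,
        Real.norm_of_nonneg (by linarith [hs.2])]
    have h3 := H f (ω * (1 - s)) (by rw [hnorm]; linarith [hs.1])
    rw [hnorm, sub_sub_cancel] at h3
    rw [bergmanMinusToFun_stepInclusion]
    refine (mul_le_mul_of_nonneg_left h3 (Real.rpow_nonneg hs.1.le a)).trans_eq ?_
    rw [sub_eq_add_neg, Real.rpow_add hs.1]
    ring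

theorem exists_bergmanMinus_of_norm_le {A C : ℝ} (hC : 0 ≤ C) (hA : A < (2 + α) / p)
    {f : ℂ → ℂ} (hf : f ∈ holoDisc) (hfC : ∀ z : ℂ, ‖z‖ < 1 → ‖f z‖ ≤ C * ‖1 - z‖ ^ (-A)) :
    ∃ g : BergmanMinus p α, bergmanMinusToFun p α g = f := by
  have hp0 : 0 < p := one_pos.trans hp.out
  have hlt : max 0 (A * p - 2) < α := by
    rw [lt_div_iff₀ hp0] at hA
    exact max_lt hα.out (by linarith)
  obtain ⟨μ, hμ, hμα⟩ := exists_between hlt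
  have hμ0 : 0 < μ := (le_max_left _ _).trans_lt hμ
  have hAμ : A < (2 + μ) / p := by
    rw [lt_div_iff₀ hp0]
    linarith [(le_max_right 0 (A * p - 2)).trans_lt hμ]
  obtain ⟨g, hg⟩ := exists_bergman_of_norm_le hμ0 hC hAμ hf hfC
  exact ⟨stepInclusion p α μ hμ0 hμα g, hg⟩

theorem exists_bergmanMinus_cesaroEigenfun_iff (j : ℕ) :
    (∃ g : BergmanMinus p α, bergmanMinusToFun p α g = cesaroEigenfun j) ↔
      (j : ℝ) + 1 < (2 + α) / p := by
  constructor
  · rintro ⟨g, hg⟩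
    by_contra! hle
    have h1 := tendsto_rpow_mul_norm_bergmanMinus g hle (ω := 1) norm_one
    have h2 : Tendsto (fun s : ℝ => (1 - s) ^ j) (𝓝[>] 0) (𝓝 1) := by
      have : Tendsto (fun s : ℝ => (1 - s) ^ j) (𝓝 0) (𝓝 ((1 - 0) ^ j)) :=
        Continuous.tendsto (by fun_prop) 0
      rw [sub_zero, one_pow] at this
      exact this.mono_left nhdsWithin_le_nhds
    refine zero_ne_one (tendsto_nhds_unique h1 (h2.congr' ?_))
    filter_upwards [Ioo_mem_nhdsGT (one_pos : (0 : ℝ) < 1)] with s hs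
    have hcast : (1 : ℂ) * (1 - s) = ((1 - s : ℝ) : ℂ) := by push_cast; ring
    have hnorm : ‖((1 - s : ℝ) : ℂ)‖ = 1 - s := by
      rw [Complex.norm_real, Real.norm_of_nonneg (by linarith [hs.2])]
    have hs0 : s ≠ 0 := hs.1.ne'
    rw [hg, hcast, cesaroEigenfun_apply j (by rw [hnorm]; linarith [hs.1]), norm_mul, norm_pow,
      hnorm, norm_inv, norm_pow, ← Complex.ofReal_one, ← Complex.ofReal_sub, sub_sub_cancel,
      Complex.norm_real, Real.norm_of_nonneg hs.1.le, ← Nat.cast_add_one, Real.rpow_natCast]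
    field_simp
  · intro hj
    exact exists_bergmanMinus_of_norm_le zero_le_one hj (cesaroEigenfun_mem j) fun z hz =>
      norm_cesaroEigenfun_le j hz

theorem eq_zero_of_cesaro_eq_zero {f : ℂ → ℂ} (hf : f ∈ holoDisc) (h : cesaro f = 0) : f = 0 := by
  funext z
  by_cases hz : ‖z‖ < 1
  · have h1 := hasDerivAt_mul_cesaro hf hz
    simp only [h, Pi.zero_apply, mul_zero] at h1
    have h2 := h1.unique (hasDerivAt_const z (0 : ℂ))
    exact (div_eq_zero_iff.1 h2).resolve_right (one_sub_ne_zero_of_norm_lt hz)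
  · exact hf.2 z (by simpa using hz)

theorem injective_sub_cesaroCLM_iff (l : ℂ) :
    Function.Injective (algebraMap ℂ (BergmanMinus p α →L[ℂ] BergmanMinus p α) l - cesaroCLM p α) ↔
      ∀ f : BergmanMinus p α,
        l • bergmanMinusToFun p α f - cesaro (bergmanMinusToFun p α f) = 0 → f = 0 := by
  rw [injective_iff_map_eq_zero]
  refine forall_congr' fun f => ?_
  rw [← bergmanMinusToFun_sub_cesaroCLM, ← map_zero (bergmanMinusToFun p α),
    bergmanMinusToFun_injective.eq_iff]

theorem injective_sub_cesaroCLM {l : ℂ} (hl : l ≠ 0) (hne : ∀ j : ℕ, (j : ℂ) + 1 ≠ l⁻¹) :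
    Function.Injective
      (algebraMap ℂ (BergmanMinus p α →L[ℂ] BergmanMinus p α) l - cesaroCLM p α) := by
  refine (injective_sub_cesaroCLM_iff l).2 fun f hf => ?_
  by_contra hne0
  have hfm := bergmanMinusToFun_mem_holoDisc f
  rw [← solvesOn_iff hl holoDisc.zero_mem hfm] at hf
  obtain ⟨k, -, hk, -⟩ := hf.exists_eq_natCast hfm fun h0 =>
    hne0 (bergmanMinusToFun_injective (h0.trans (map_zero _).symm))
  exact hne k hk.symm

theorem pointSpectrum_cesaroCLM : pointSpectrum (cesaroCLM p α) =
    {l : ℂ | ∃ m : ℕ, 1 ≤ m ∧ (m : ℝ) < (2 + α) / p ∧ l = 1 / (m : ℂ)} := by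
  ext l
  simp only [pointSpectrum, mem_ofPred_eq, injective_sub_cesaroCLM_iff]
  constructor
  · intro h
    push Not at h
    obtain ⟨f, hf, hf0⟩ := h
    have hfm := bergmanMinusToFun_mem_holoDisc f
    have hne : bergmanMinusToFun p α f ≠ 0 := fun h0 =>
      hf0 (bergmanMinusToFun_injective (h0.trans (map_zero _).symm))
    have hl : l ≠ 0 := by
      rintro rfl
      refine hne (eq_zero_of_cesaro_eq_zero hfm ?_)
      simpa using hf
    rw [← solvesOn_iff hl holoDisc.zero_mem hfm] at hf
    obtain ⟨j, c, hj, hc, hfj⟩ := hf.exists_eq_smul_eigenfun hfm hne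
    refine ⟨j + 1, by omega, ?_, ?_⟩
    · rw [Nat.cast_add_one, ← exists_bergmanMinus_cesaroEigenfun_iff]
      refine ⟨c⁻¹ • f, ?_⟩
      rw [map_smul, hfj, smul_smul, inv_mul_cancel₀ hc, one_smul]
    · rw [Nat.cast_add_one, ← hj, one_div, inv_inv]
  · rintro ⟨m, hm, hmr, rfl⟩ h
    obtain ⟨j, rfl⟩ := Nat.exists_eq_add_of_le' hm
    obtain ⟨g, hg⟩ := (exists_bergmanMinus_cesaroEigenfun_iff (p := p) (α := α) j).2
      (by simpa using hmr)
    have hl : (1 / ((j + 1 : ℕ) : ℂ)) ≠ 0 := one_div_ne_zero (Nat.cast_ne_zero.2 (by omega))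
    have hg0 : g = 0 := by
      refine h g ?_
      rw [← solvesOn_iff hl holoDisc.zero_mem (bergmanMinusToFun_mem_holoDisc g), hg, one_div,
        inv_inv, Nat.cast_add_one]
      exact solvesOn_zero_cesaroEigenfun j
    have h0 : cesaroEigenfun j (1 / 2) = 0 := by rw [← hg, hg0, map_zero, Pi.zero_apply]
    rw [cesaroEigenfun_apply j (by norm_num)] at h0
    norm_num at h0

end

/-! ### The resolvent set -/

theorem eventually_forall_natCast_add_one_ne {w₀ : ℂ} (hne : ∀ j : ℕ, (j : ℂ) + 1 ≠ w₀) :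
    ∀ᶠ w in 𝓝 w₀, ∀ j : ℕ, (j : ℂ) + 1 ≠ w := by
  have hcl : IsClosed (range fun j : ℕ => ((j : ℝ) : ℂ)) :=
    (Complex.isometry_ofReal.isClosedEmbedding.comp Nat.isClosedEmbedding_coe_real).isClosed_range
  have hopen : IsOpen ((fun w : ℂ => w - 1) ⁻¹' (range fun j : ℕ => ((j : ℝ) : ℂ))ᶜ) :=
    hcl.isOpen_compl.preimage (by fun_prop)
  have hmem : w₀ ∈ (fun w : ℂ => w - 1) ⁻¹' (range fun j : ℕ => ((j : ℝ) : ℂ))ᶜ := by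
    rintro ⟨j, hj⟩
    refine hne j ?_
    rw [← Complex.ofReal_natCast]
    exact eq_sub_iff_add_eq.1 hj
  filter_upwards [hopen.mem_nhds hmem] with w hw j hj
  exact hw ⟨j, by simp [← hj]⟩

section

variable {p α : ℝ} [hα : Fact (0 < α)] [hp : Fact (1 < p)]

/-- The solution bound is uniform for `l⁻¹` in a neighbourhood, so the inverses there form a family
of maps which is bounded from step to step, hence equicontinuous. -/
theorem mem_waelbroeckResolventSet_cesaroCLM {l : ℂ} (hl : l ≠ 0) (hre : l⁻¹.re < (2 + α) / p)
    (hne : ∀ j : ℕ, (j : ℂ) + 1 ≠ l⁻¹) : l ∈ waelbroeckResolventSet (cesaroCLM p α) := by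
  obtain ⟨W, hW, HW⟩ := eventually_smallSets.1 (exists_uniform_solution (p := p) hα.out hre hne)
  have hinv : Tendsto (fun ν : ℂ => ν⁻¹) (𝓝 l) (𝓝 l⁻¹) := tendsto_inv₀ hl
  obtain ⟨δ, hδ, hball⟩ := Metric.eventually_nhds_iff_ball.1 ((eventually_ne_nhds hl).and
    ((hinv.eventually hW).and (hinv.eventually (eventually_forall_natCast_add_one_ne hne))))
  set L : ball l δ → BergmanMinus p α →L[ℂ] BergmanMinus p α := fun ν =>
    algebraMap ℂ (BergmanMinus p α →L[ℂ] BergmanMinus p α) ν - cesaroCLM p α with hL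
  have hsolve : ∀ (μ : ℝ) (h0 : 0 < μ) (h1 : μ < α), ∃ (γ : ℝ) (h2 : 0 < γ) (h3 : γ < α) (K : ℝ),
      ∀ (ν : ball l δ) (h : Bergman p μ), ∃ f : Bergman p γ,
        L ν (stepInclusion p α γ h2 h3 f) = stepInclusion p α μ h0 h1 h ∧ ‖f‖ ≤ K * ‖h‖ := by
    intro μ h0 h1
    obtain ⟨γ, h2, h3, K, H⟩ := HW W subset_rfl μ h0 h1
    refine ⟨γ, h2, h3, K, fun ν h => ?_⟩
    obtain ⟨f, hf, hfK⟩ := H _ (hball ν ν.2).2.1 h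
    exact ⟨f, (sub_cesaroCLM_apply_eq_iff (hball ν ν.2).1 _ _).2 hf, hfK⟩
  have hbij : ∀ ν, Function.Bijective (L ν) := by
    refine fun ν => ⟨injective_sub_cesaroCLM (hball ν ν.2).1 (hball ν ν.2).2.2, fun h => ?_⟩
    obtain ⟨μ, h0, h1, h, rfl⟩ := exists_stepInclusion_eq h
    obtain ⟨γ, h2, h3, K, H⟩ := hsolve μ h0 h1
    obtain ⟨f, hf, -⟩ := H ν h
    exact ⟨_, hf⟩
  set R : ball l δ → BergmanMinus p α ≃ₗ[ℂ] BergmanMinus p α := fun ν =>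
    LinearEquiv.ofBijective (L ν).toLinearMap (hbij ν) with hR
  have hbdd : UniformlyStepBounded fun ν => ((R ν).symm : BergmanMinus p α →ₗ[ℂ] _) := by
    intro μ h0 h1
    obtain ⟨γ, h2, h3, K, H⟩ := hsolve μ h0 h1
    refine ⟨γ, h2, h3, K, fun ν h => ?_⟩
    obtain ⟨f, hf, hfK⟩ := H ν h
    exact ⟨f, (R ν).symm_apply_eq.2 hf.symm, hfK⟩
  have hunit : ∀ ν, ∃ u : (BergmanMinus p α →L[ℂ] BergmanMinus p α)ˣ, (u : _ →L[ℂ] _) = L ν ∧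
      ∀ x, (↑u⁻¹ : BergmanMinus p α →L[ℂ] BergmanMinus p α) x = (R ν).symm x := fun ν =>
    ⟨⟨L ν, ⟨(R ν).symm, hbdd.continuous ν⟩,
      ContinuousLinearMap.ext fun x => (R ν).apply_symm_apply x,
      ContinuousLinearMap.ext fun x => (R ν).symm_apply_apply x⟩, rfl, fun _ => rfl⟩
  refine ⟨δ, hδ, fun ν hν => ?_, ?_⟩
  · obtain ⟨u, hu, -⟩ := hunit ⟨ν, hν⟩
    exact ⟨u, hu⟩
  · convert! hbdd.equicontinuous using 1
    funext ν x
    obtain ⟨u, hu, hux⟩ := hunit ν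
    rw [resolvent]
    change Ring.inverse (L ν) x = _
    rw [← hu, Ring.inverse_unit, hux]
    rfl

theorem bijective_of_mem_resolventSet {l : ℂ} (h : l ∈ resolventSet ℂ (cesaroCLM p α)) :
    Function.Bijective
      (algebraMap ℂ (BergmanMinus p α →L[ℂ] BergmanMinus p α) l - cesaroCLM p α) := by
  obtain ⟨u, hu⟩ := h
  rw [← hu]
  exact (ContinuousLinearEquiv.unitsEquiv ℂ (BergmanMinus p α) u).bijective

end

/-! ### Right-hand sides without a solution in the space -/

/-- The function `(1 - z) ^ (-v)` on the disc, extended by zero. -/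
def oneSubCpow (v : ℂ) : ℂ → ℂ := (ball (0 : ℂ) 1).indicator fun z => (1 - z) ^ (-v)

theorem oneSubCpow_mem (v : ℂ) : oneSubCpow v ∈ holoDisc :=
  indicator_mem_holoDisc fun _ hz => (hasDerivAt_one_sub_cpow (-v)
    (by simpa using hz)).differentiableAt.differentiableWithinAt

theorem oneSubCpow_apply (v : ℂ) {z : ℂ} (hz : ‖z‖ < 1) : oneSubCpow v z = (1 - z) ^ (-v) :=
  indicator_of_mem (by simpa using hz) _

theorem norm_oneSubCpow_le (v : ℂ) {z : ℂ} (hz : ‖z‖ < 1) :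
    ‖oneSubCpow v z‖ ≤ Real.exp (Real.pi * |v.im|) * ‖1 - z‖ ^ (-v.re) := by
  rw [oneSubCpow_apply v hz]
  simpa using norm_cpow_le_exp_mul (one_sub_ne_zero_of_norm_lt hz) (w := -v) (M := |v.im|)
    (by simp)

theorem solvesOn_oneSubCpow {w : ℂ} (hw : w ≠ 0) (v : ℂ) :
    SolvesOn w (((1 - v) / w ^ 2) • oneSubCpow (v - 1) + ((v - w) / w ^ 2) • oneSubCpow v)
      (((1 - v) / w) • oneSubCpow (v - 1) + (v / w) • oneSubCpow v) := by
  intro z hz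
  have h1z := one_sub_ne_zero_of_norm_lt hz
  have h1 : HasDerivAt (fun ζ => ζ * oneSubCpow v ζ)
      (1 * oneSubCpow v z + z * (-(-v) * (1 - z) ^ (-v - 1))) z := by
    refine (hasDerivAt_id' z).fun_mul ?_
    convert! (hasDerivAt_one_sub_cpow (-v) hz).congr_of_eventuallyEq
      (indicator_disc_eventuallyEq _ hz) using 1
  convert! h1 using 1
  · funext ζ
    simp only [Pi.add_apply, Pi.smul_apply, smul_eq_mul]
    field_simp
    ring
  · have h2 : (1 - z) ^ (-(v - 1)) = (1 - z) * (1 - z) * (1 - z) ^ (-v - 1) := by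
      rw [show -(v - 1) = (-v - 1) + 1 + 1 by ring, Complex.cpow_add _ _ h1z,
        Complex.cpow_add _ _ h1z, Complex.cpow_one]
      ring
    have h3 : (1 - z) ^ (-v) = (1 - z) * (1 - z) ^ (-v - 1) := by
      rw [Complex.cpow_sub _ _ h1z, Complex.cpow_one]
      field_simp
    simp only [Pi.add_apply, Pi.smul_apply, smul_eq_mul, oneSubCpow_apply _ hz, h2, h3]
    field_simp
    ring

theorem tendsto_cpow_mul_oneSubCpow (w : ℂ) (k : ℕ) :
    Tendsto (fun s : ℝ => (s : ℂ) ^ w * oneSubCpow (w - k) (1 - s)) (𝓝[>] 0) (𝓝 (0 ^ k)) := by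
  have h1 : Tendsto (fun s : ℝ => (s : ℂ) ^ k) (𝓝[>] 0) (𝓝 (0 ^ k)) := by
    have : Tendsto (fun s : ℝ => (s : ℂ) ^ k) (𝓝 0) (𝓝 (((0 : ℝ) : ℂ) ^ k)) :=
      Continuous.tendsto (by fun_prop) 0
    rw [Complex.ofReal_zero] at this
    exact this.mono_left nhdsWithin_le_nhds
  refine h1.congr' ?_
  filter_upwards [Ioo_mem_nhdsGT (one_pos : (0 : ℝ) < 1)] with s hs
  have hs0 : (s : ℂ) ≠ 0 := Complex.ofReal_ne_zero.2 hs.1.ne'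
  have hnorm : ‖(1 - s : ℂ)‖ < 1 := by
    rw [← Complex.ofReal_one, ← Complex.ofReal_sub, Complex.norm_real,
      Real.norm_of_nonneg (by linarith [hs.2])]
    linarith [hs.1]
  rw [oneSubCpow_apply _ hnorm, sub_sub_cancel, ← Complex.cpow_add _ _ hs0,
    show w + -(w - k) = (k : ℂ) by ring, Complex.cpow_natCast]

/-- Successive corrections by the explicit solutions `solvesOn_oneSubCpow` with `v = w - n` improve
the right-hand side while the leading singularity `(1 - z) ^ (-w)` of the solution persists. -/
theorem exists_solvesOn_oneSubCpow_sub {w : ℂ} (hw : w ≠ 0) (n : ℕ) :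
    ∃ (c : ℂ) (f : ℂ → ℂ), f ∈ holoDisc ∧ SolvesOn w (c • oneSubCpow (w - (n + 1 : ℕ))) f ∧
      Tendsto (fun s : ℝ => (s : ℂ) ^ w * f (1 - s)) (𝓝[>] 0) (𝓝 1) := by
  have hmem : ∀ a b v : ℂ, a • oneSubCpow (v - 1) + b • oneSubCpow v ∈ holoDisc := fun a b v =>
    holoDisc.add_mem (holoDisc.smul_mem _ (oneSubCpow_mem _))
      (holoDisc.smul_mem _ (oneSubCpow_mem _))
  induction n with
  | zero =>
    refine ⟨(1 - w) / w ^ 2, _, hmem ((1 - w) / w) (w / w) w, ?_, ?_⟩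
    · convert! solvesOn_oneSubCpow hw w using 1
      simp
    · have h0 := tendsto_cpow_mul_oneSubCpow w 0
      have h1 := tendsto_cpow_mul_oneSubCpow w 1
      convert! (h1.const_mul ((1 - w) / w)).add (h0.const_mul (w / w)) using 1
      · funext s
        simp only [Pi.add_apply, Pi.smul_apply, smul_eq_mul, Nat.cast_one, Nat.cast_zero, sub_zero]
        ring
      · simp [hw]
  | succ n ih =>
    obtain ⟨c, f, hf, H, hlim⟩ := ih
    set v : ℂ := w - (n + 1 : ℕ) with hv
    have hn : ((n + 1 : ℕ) : ℂ) ≠ 0 := Nat.cast_ne_zero.2 (by omega)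
    -- The multiple `a` is such that the terms in `(1 - z) ^ (-v)` cancel.
    set a : ℂ := c * w ^ 2 / (n + 1 : ℕ) with ha
    have hv1 : w - (n + 1 + 1 : ℕ) = v - 1 := by
      rw [hv]
      push_cast
      ring
    refine ⟨a * ((1 - v) / w ^ 2), f + a • (((1 - v) / w) • oneSubCpow (v - 1) +
      (v / w) • oneSubCpow v), holoDisc.add_mem hf (holoDisc.smul_mem _ (hmem _ _ _)), ?_, ?_⟩
    · convert! H.add ((solvesOn_oneSubCpow hw v).const_smul a) using 1
      have hcancel : a * ((v - w) / w ^ 2) = -c := by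
        rw [hv, ha]
        field_simp
        ring
      rw [smul_add, smul_smul, smul_smul, hcancel, neg_smul, hv1]
      abel
    · have h0 := tendsto_cpow_mul_oneSubCpow w (n + 1)
      have h1 := tendsto_cpow_mul_oneSubCpow w (n + 1 + 1)
      rw [hv1] at h1
      rw [← hv] at h0
      convert! hlim.add ((h1.const_mul (a * ((1 - v) / w))).add (h0.const_mul (a * (v / w))))
        using 1
      · funext s
        simp only [Pi.add_apply, Pi.smul_apply, smul_eq_mul]
        ring
      · simp

section

variable {p α : ℝ} [hα : Fact (0 < α)] [hp : Fact (1 < p)]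

theorem not_surjective_of_ne_natCast {l : ℂ} (hl : l ≠ 0) (hre : (2 + α) / p ≤ l⁻¹.re)
    (hne : ∀ j : ℕ, (j : ℂ) + 1 ≠ l⁻¹) : ¬ Function.Surjective
      (algebraMap ℂ (BergmanMinus p α →L[ℂ] BergmanMinus p α) l - cesaroCLM p α) := by
  intro hsurj
  obtain ⟨n, hn⟩ := exists_nat_gt (l⁻¹.re - (2 + α) / p)
  obtain ⟨c, f, hf, H, hlim⟩ := exists_solvesOn_oneSubCpow_sub (inv_ne_zero hl) n
  set v : ℂ := l⁻¹ - (n + 1 : ℕ) with hv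
  have hvre : v.re < (2 + α) / p := by
    rw [hv, Complex.sub_re, Complex.natCast_re]
    push_cast
    linarith
  obtain ⟨h, hh⟩ := exists_bergmanMinus_of_norm_le (p := p) (α := α)
    (C := ‖c‖ * Real.exp (Real.pi * |v.im|)) (by positivity) hvre
    (holoDisc.smul_mem c (oneSubCpow_mem v)) fun z hz => by
      rw [Pi.smul_apply, norm_smul, mul_assoc]
      exact mul_le_mul_of_nonneg_left (norm_oneSubCpow_le v hz) (norm_nonneg c)
  obtain ⟨g, hg⟩ := hsurj h
  rw [sub_cesaroCLM_apply_eq_iff hl, hh] at hg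
  have hgm := bergmanMinusToFun_mem_holoDisc g
  have hdiff : bergmanMinusToFun p α g = f := by
    rw [← sub_eq_zero]
    by_contra hne0
    have h0 : SolvesOn l⁻¹ 0 (bergmanMinusToFun p α g - f) := by
      convert! hg.add (H.const_smul (-1)) using 1
      · rw [neg_one_smul, add_neg_cancel]
      · rw [neg_one_smul, sub_eq_add_neg]
    obtain ⟨k, -, hk, -⟩ := h0.exists_eq_natCast (holoDisc.sub_mem hgm hf) hne0
    exact hne k hk.symm
  have hdecay := tendsto_rpow_mul_norm_bergmanMinus g hre (ω := 1) norm_one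
  refine zero_ne_one (tendsto_nhds_unique hdecay ?_)
  rw [← norm_one (α := ℂ)]
  refine hlim.norm.congr' ?_
  filter_upwards [self_mem_nhdsWithin] with s hs
  rw [norm_mul, Complex.norm_cpow_eq_rpow_re_of_pos hs, hdiff, one_mul]

theorem not_surjective_of_eq_natCast {l : ℂ} (hl : l ≠ 0) {m : ℕ} (hm : (m : ℂ) + 1 = l⁻¹) :
    ¬ Function.Surjective
      (algebraMap ℂ (BergmanMinus p α →L[ℂ] BergmanMinus p α) l - cesaroCLM p α) := by
  intro hsurj
  have hp0 : 0 < p := one_pos.trans hp.out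
  have hα0 := hα.out
  have hmem : (ball (0 : ℂ) 1).indicator (fun z => z ^ m) ∈ holoDisc :=
    indicator_mem_holoDisc (by fun_prop)
  have happ : ∀ z : ℂ, ‖z‖ < 1 → (ball (0 : ℂ) 1).indicator (fun z => z ^ m) z = z ^ m :=
    fun z hz => indicator_of_mem (by simpa using hz) _
  obtain ⟨h, hh⟩ := exists_bergmanMinus_of_norm_le (p := p) (α := α) (A := 0) zero_le_one
    (by positivity) hmem fun z hz => by
      rw [happ z hz, norm_pow, neg_zero, Real.rpow_zero, one_mul]
      exact pow_le_one₀ (norm_nonneg z) hz.le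
  obtain ⟨g, hg⟩ := hsurj h
  rw [sub_cesaroCLM_apply_eq_iff hl, hh, ← hm] at hg
  exact not_solvesOn_pow (bergmanMinusToFun_mem_holoDisc g) happ hg

/-- The space is invariant under the reflection `z ↦ -z`. -/
theorem exists_bergmanMinus_comp_neg (f : BergmanMinus p α) :
    ∃ g : BergmanMinus p α, ∀ z, bergmanMinusToFun p α g z = bergmanMinusToFun p α f (-z) := by
  have hp0 : 0 < p := one_pos.trans hp.out
  obtain ⟨μ, h0, h1, f, rfl⟩ := exists_stepInclusion_eq f
  have hf := bergmanToFun_mem_holoDisc f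
  have hmem : (fun z => bergmanToFun p μ f (-z)) ∈ holoDisc := by
    refine ⟨fun z hz => ?_, fun z hz => hf.2 _ (by simpa using hz)⟩
    have h2 : DifferentiableAt ℂ (bergmanToFun p μ f) (-z) :=
      holoDisc.differentiableAt hf (by simpa using hz)
    exact (h2.comp z differentiableAt_id.neg).differentiableWithinAt
  have hnorm : eLpNorm (fun z => bergmanToFun p μ f (-z)) (ENNReal.ofReal p) (bergmanMeasure μ) =
      eLpNorm (bergmanToFun p μ f) (ENNReal.ofReal p) (bergmanMeasure μ) := by
    rw [eLpNorm_eq_lintegral_rpow_enorm_toReal (by simpa using hp0) (by simp),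
      eLpNorm_eq_lintegral_rpow_enorm_toReal (by simpa using hp0) (by simp),
      lintegral_bergmanMeasure, lintegral_bergmanMeasure,
      ← lintegral_indicator measurableSet_ball, ← lintegral_indicator measurableSet_ball]
    congr 1
    rw [← lintegral_neg_eq_self]
    refine lintegral_congr fun z => ?_
    by_cases hz : z ∈ ball (0 : ℂ) 1
    · have hz' : -z ∈ ball (0 : ℂ) 1 := by simpa using hz
      rw [indicator_of_mem hz, indicator_of_mem hz', norm_neg, neg_neg]
    · have hz' : -z ∉ ball (0 : ℂ) 1 := by simpa using hz
      rw [indicator_of_notMem hz, indicator_of_notMem hz']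
  obtain ⟨g, hg, -⟩ := exists_bergman_of_eLpNorm_le hmem (norm_nonneg f)
    (hnorm.trans (eLpNorm_eq_ofReal_bergman_norm f)).le
  refine ⟨stepInclusion p α μ h0 h1 g, fun z => ?_⟩
  rw [bergmanMinusToFun_stepInclusion, hg, bergmanMinusToFun_stepInclusion]

/-- The operator is not onto: solving `C f = h` costs a derivative away from the point `1`, and so
fails for `h = (1 + z) ^ (-b)` when `b < (2 + α) / p ≤ b + 1`. -/
theorem not_surjective_cesaroCLM : ¬ Function.Surjective (cesaroCLM p α) := by
  intro hsurj
  have hp0 : 0 < p := one_pos.trans hp.out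
  have hr : 0 < (2 + α) / p := div_pos (by linarith [hα.out]) hp0
  obtain ⟨b, hb0, hb1, hb2⟩ : ∃ b : ℝ, 0 < b ∧ b < (2 + α) / p ∧ (2 + α) / p ≤ b + 1 := by
    obtain ⟨b, hb⟩ := exists_between (max_lt hr (sub_one_lt ((2 + α) / p)))
    exact ⟨b, (le_max_left _ _).trans_lt hb.1, hb.2,
      by linarith [(le_max_right _ _).trans_lt hb.1]⟩
  obtain ⟨q, hq⟩ := exists_bergmanMinus_of_norm_le (p := p) (α := α)
    (C := Real.exp (Real.pi * |(b : ℂ).im|)) (by positivity) hb1 (oneSubCpow_mem b)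
    fun z hz => by simpa using norm_oneSubCpow_le (b : ℂ) hz
  obtain ⟨h, hh⟩ := exists_bergmanMinus_comp_neg q
  obtain ⟨f, hf⟩ := hsurj h
  have hfm := bergmanMinusToFun_mem_holoDisc f
  have hval : ∀ z : ℂ, ‖z‖ < 1 → bergmanMinusToFun p α f z =
      (1 - z) * ((1 + z) ^ (-(b : ℂ)) - z * b * (1 + z) ^ (-(b : ℂ) - 1)) := by
    intro z hz
    have h1 := hasDerivAt_mul_cesaro hfm hz
    rw [← bergmanMinusToFun_cesaroCLM, hf] at h1
    have hev : bergmanMinusToFun p α h =ᶠ[𝓝 z] fun ζ => (1 - -ζ) ^ (-(b : ℂ)) := by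
      filter_upwards [isOpen_ball.mem_nhds (show z ∈ ball (0 : ℂ) 1 by simpa using hz)] with x hx
      rw [hh, hq, oneSubCpow_apply _ (by simpa using hx)]
    have h2 : HasDerivAt (fun ζ : ℂ => (1 - -ζ) ^ (-(b : ℂ)))
        (-(-(b : ℂ)) * (1 - -z) ^ (-(b : ℂ) - 1) * -1) z :=
      (hasDerivAt_one_sub_cpow (-(b : ℂ)) (z := -z) (by simpa using hz)).comp z
        (hasDerivAt_id' z).neg
    have h3 := h1.unique ((hasDerivAt_id' z).fun_mul (h2.congr_of_eventuallyEq hev))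
    rw [div_eq_iff (one_sub_ne_zero_of_norm_lt hz), hev.self_of_nhds, sub_neg_eq_add] at h3
    rw [h3]
    ring_nf
  have hdecay := tendsto_rpow_mul_norm_bergmanMinus f hb2 (ω := -1) (by simp)
  have hlim : Tendsto (fun s : ℝ => (2 - s) * (s + (1 - s) * b)) (𝓝[>] 0) (𝓝 (2 * b)) := by
    have : Tendsto (fun s : ℝ => (2 - s) * (s + (1 - s) * b)) (𝓝 0)
        (𝓝 ((2 - 0) * (0 + (1 - 0) * b))) := Continuous.tendsto (by fun_prop) 0
    rw [show (2 - 0) * (0 + (1 - 0) * b) = 2 * b by ring] at this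
    exact this.mono_left nhdsWithin_le_nhds
  have h2b : (0 : ℝ) ≠ 2 * b := by positivity
  refine h2b (tendsto_nhds_unique hdecay (hlim.congr' ?_))
  filter_upwards [Ioo_mem_nhdsGT (one_pos : (0 : ℝ) < 1)] with s hs
  have hnorm : ‖(-1 : ℂ) * (1 - s)‖ < 1 := by
    rw [neg_one_mul, norm_neg, ← Complex.ofReal_one, ← Complex.ofReal_sub, Complex.norm_real,
      Real.norm_of_nonneg (by linarith [hs.2])]
    linarith [hs.1]
  have hreal : bergmanMinusToFun p α f (-1 * (1 - s)) =
      (((2 - s) * (s ^ (-b) + (1 - s) * b * s ^ (-b - 1)) : ℝ) : ℂ) := by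
    rw [hval _ hnorm, show (1 : ℂ) + -1 * (1 - s) = s by ring]
    push_cast [Complex.ofReal_cpow hs.1.le]
    ring
  have hpos : 0 ≤ (2 - s) * (s ^ (-b) + (1 - s) * b * s ^ (-b - 1)) := by
    have hs1 : 0 ≤ 1 - s := by linarith [hs.2]
    have hs2 : 0 ≤ 2 - s := by linarith [hs.2]
    have hs3 := hs.1.le
    positivity
  rw [hreal, Complex.norm_real, Real.norm_of_nonneg hpos, Real.rpow_add hs.1, Real.rpow_one,
    Real.rpow_sub hs.1, Real.rpow_one, Real.rpow_neg hs.1.le]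
  have := Real.rpow_pos_of_pos hs.1 b
  have hs0 := hs.1
  field_simp

end

/-! ### The spectra -/

theorem mem_closedDisc_iff {r : ℝ} (hr : 0 < r) (l : ℂ) :
    l ∈ closedDisc r ↔ l = 0 ∨ r ≤ l⁻¹.re := by
  have hdisc : l ∈ closedDisc r ↔ r * Complex.normSq l ≤ l.re := by
    have hcast : (1 / (2 * r) : ℂ) = ((1 / (2 * r) : ℝ) : ℂ) := by push_cast; rfl
    have hsq : Complex.normSq (l - ((1 / (2 * r) : ℝ) : ℂ)) =
        (1 / (2 * r)) ^ 2 + (r * Complex.normSq l - l.re) / r := by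
      simp only [Complex.normSq_apply, Complex.sub_re, Complex.sub_im, Complex.ofReal_re,
        Complex.ofReal_im]
      field_simp
      ring
    rw [closedDisc, mem_ofPred_eq, hcast, ← abs_of_pos (show 0 < 1 / (2 * r) by positivity),
      ← abs_norm, ← sq_le_sq, abs_of_pos (show 0 < 1 / (2 * r) by positivity),
      ← Complex.normSq_eq_norm_sq, hsq, add_le_iff_nonpos_right, div_le_iff₀ hr, zero_mul,
      sub_nonpos]
  rw [hdisc]
  by_cases hl : l = 0
  · simp [hl]
  · rw [or_iff_right hl, Complex.inv_re, le_div_iff₀ (Complex.normSq_pos.2 hl)]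

section

variable {p α : ℝ} [hα : Fact (0 < α)] [hp : Fact (1 < p)]

theorem mem_pointSpectrum_of_eq_natCast {l : ℂ} (hre : l⁻¹.re < (2 + α) / p) {m : ℕ}
    (hm : (m : ℂ) + 1 = l⁻¹) : l ∈ pointSpectrum (cesaroCLM p α) := by
  rw [pointSpectrum_cesaroCLM]
  refine ⟨m + 1, by omega, ?_, ?_⟩
  · rw [← hm] at hre
    simpa using hre
  · rw [Nat.cast_add_one, hm, one_div, inv_inv]

theorem pointSpectrum_union_closedDisc_subset_spectrum :
    pointSpectrum (cesaroCLM p α) ∪ closedDisc ((2 + α) / p) ⊆ spectrum ℂ (cesaroCLM p α) := by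
  have hr : 0 < (2 + α) / p :=
    div_pos (by linarith [hα.out]) (one_pos.trans hp.out)
  rintro l (hl | hl) hres
  · exact hl (bijective_of_mem_resolventSet hres).1
  · have hsurj := (bijective_of_mem_resolventSet hres).2
    by_cases hl0 : l = 0
    · refine not_surjective_cesaroCLM (p := p) (α := α) fun h => ?_
      obtain ⟨f, hf⟩ := hsurj (-h)
      refine ⟨f, neg_injective ?_⟩
      rw [← hf, hl0, map_zero, zero_sub, neg_apply]
    · have hre := ((mem_closedDisc_iff hr l).1 hl).resolve_left hl0
      by_cases hne : ∀ j : ℕ, (j : ℂ) + 1 ≠ l⁻¹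
      · exact not_surjective_of_ne_natCast hl0 hre hne hsurj
      · push Not at hne
        obtain ⟨m, hm⟩ := hne
        exact not_surjective_of_eq_natCast hl0 hm hsurj

theorem compl_subset_waelbroeckResolventSet :
    (pointSpectrum (cesaroCLM p α) ∪ closedDisc ((2 + α) / p))ᶜ ⊆
      waelbroeckResolventSet (cesaroCLM p α) := by
  have hr : 0 < (2 + α) / p :=
    div_pos (by linarith [hα.out]) (one_pos.trans hp.out)
  intro l hl
  rw [compl_union, mem_inter_iff, mem_compl_iff, mem_compl_iff, mem_closedDisc_iff hr, not_or,
    not_le] at hl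
  exact mem_waelbroeckResolventSet_cesaroCLM hl.2.1 hl.2.2 fun m hm =>
    hl.1 (mem_pointSpectrum_of_eq_natCast hl.2.2 hm)

theorem waelbroeckResolventSet_subset_resolventSet :
    waelbroeckResolventSet (cesaroCLM p α) ⊆ resolventSet ℂ (cesaroCLM p α) := by
  rintro l ⟨δ, hδ, hball, -⟩
  exact hball (mem_ball_self hδ)

end

end

/-- The Cesàro operator is a continuous linear operator on the (LB)-space `A^p_{α-}`, with the
stated point spectrum, spectrum and Waelbroeck spectrum. -/
theorem theorem2p5 (p α : ℝ) [Fact (1 < p)] [Fact (0 < α)] :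
    ∃ C : BergmanMinus p α →L[ℂ] BergmanMinus p α,
      (∀ (f : BergmanMinus p α) (z : ℂ), C f z = cesaro f z) ∧
      pointSpectrum C = {l : ℂ | ∃ m : ℕ, 1 ≤ m ∧ (m : ℝ) < (2 + α) / p ∧ l = 1 / (m : ℂ)} ∧
      spectrum ℂ C = pointSpectrum C ∪ closedDisc ((2 + α) / p) ∧
      waelbroeckSpectrum C = spectrum ℂ C := by
  have hlower := pointSpectrum_union_closedDisc_subset_spectrum (p := p) (α := α)
  have hupper := compl_subset_waelbroeckResolventSet (p := p) (α := α)
  have hsub := waelbroeckResolventSet_subset_resolventSet (p := p) (α := α)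
  have hspec : spectrum ℂ (cesaroCLM p α) =
      pointSpectrum (cesaroCLM p α) ∪ closedDisc ((2 + α) / p) :=
    subset_antisymm (Set.compl_subset_comm.1 (hupper.trans hsub)) hlower
  refine ⟨cesaroCLM p α, fun f z => congrFun (bergmanMinusToFun_cesaroCLM f) z,
    pointSpectrum_cesaroCLM, hspec, subset_antisymm ?_ (Set.compl_subset_compl.2 hsub)⟩
  rw [hspec]
  exact Set.compl_subset_comm.1 hupper
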